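/- \textbf{Setting.} Let $K_\alpha(\theta)=\sum_{p\in\mathbb Z}e^{-\alpha p^2+ip\theta}$ be the heat kernel of $\mathrm U(1)$ with respect to the normalized Haar measure. Let $m>0$, $M>1$, and for $\rho\in\mathbb N$ let $$C^\rho(g_1,\dots,g_4;g_1',\dots,g_4')=\int_{M^{-2\rho}}^{\infty}d\alpha\,e^{-\alpha m^2}\int_{\mathrm U(1)}dh\prod_{c=1}^4K_\alpha(g_c\,h\,g_c'^{-1})$$ be the regularized covariance of a complex rank-$4$ tensor field $\varphi$ on $\mathrm U(1)^4$. A $4$-bubble $b$ is a finite connected bipartite graph whose lines carry colours $1,\dots,4$, with exactly one line of each colour at every node; it encodes the tensor invariant $I_b$ (white nodes are fields $\varphi$, black nodes are fields $\overline\varphi$, and a line of colour $c$ identifies the $c$-th arguments). Let $\mathcal B$ be any finite set of $4$-bubbles. A Feynman graph $\mathcal G$ over $\mathcal B$ consists of finitely many vertices, each a copy of a bubble of $\mathcal B$, and of lines of colour $0$ joining white to black nodes, with at most one at each node; nodes without line are the external legs. $\mathcal G$ is connected if the graph formed by all nodes and all lines of colours $0,\dots,4$ is connected, and non-vacuum if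 it has at least one external leg. A subgraph $\mathcal H$ is a set of lines of colour $0$. Its internal faces are the circuits alternating lines of $\mathcal H$ and lines of a fixed colour $c\in\{1,\dots,4\}$. $\mathcal H$ is connected if it is non-empty and any two of its lines are joined by a chain of lines in which consecutive lines share an internal face of $\mathcal H$. Contracting a line of colour $0$ deletes its two end nodes and the coloured lines between them, and reconnects the open coloured lines colour by colour; the line is a $4$-dipole if its end nodes are joined by exactly three coloured lines. A melopole is a connected subgraph all of whose lines are attached to a single bubble and can be ordered so that each is a $4$-dipole after contraction of the previous ones. A meloforest is a set of melopoles, any two of which are nested or have no line and no internal face in common. The bare amplitude of $\mathcal G$ is the integral, over one $\mathrm U(1)$ variable for each line of colours $1,\dots,4$, of the product of one propagator $C^\rho$ for each line of colour $0$, times one propagator joining each external leg to an external point (or, in the amputated amplitude, times a test function of the variables at the external legs). For a subgraph $\mathcal H$, an external face of $\mathcal H$ is a maximal open piece of a circuit or path alternating lines of $\mathcal H$ and lines of one colour $c$; the localization operator $\tau_{\mathcal H}$ acts on the integrand by replacing, in all factors not belonging to $\mathcal H$, the variable at one end of each external face of $\mathcal H$ by the variable at its other end. The renormalized amplitude is $$\mathcal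 A^R_{\mathcal G}=\sum_{\mathcal M}\ \prod_{\mathcal H\in\mathcal M}(-\tau_{\mathcal H})\,\mathcal A_{\mathcal G},$$ the sum running over all meloforests $\mathcal M$ of $\mathcal G$, including the empty one. The melordered invariant is $\Omega_\rho(I_b)=\sum_{\mathcal M}\prod_{\mathcal H\in\mathcal M}(-\tau_{\mathcal H})\,I^{\mathcal M}_{b,\rho}$, the sum running over the meloforests of $b$ (meloforests of graphs with the single vertex $b$); here $I^{\mathcal M}_{b,\rho}$ is $I_b$ with the fields at the ends of the lines of $\bigcup\mathcal M$ contracted by $C^\rho$. \textbf{Theorem.} The melordered $\mathrm U(1)$ model in $d=4$ with interaction $\sum_{b\in\mathcal B}t_b\,\Omega_\rho(I_b)$ is perturbatively finite at every order. Precisely: (1) For every connected non-vacuum Feynman graph $\mathcal G$ over $\mathcal B$, the renormalized amplitude $\mathcal A^R_{\mathcal G}$ with propagators on its external legs converges, uniformly in the external points, to a finite limit as $\rho\to\infty$; and the amputated renormalized amplitude, integrated against any smooth function of the variables at the external legs, converges to a finite limit as $\rho\to\infty$. (2) For all couplings $t_b\in\mathbb C$ and all $n\ge1$, $N\ge1$,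 the term of order $n$ in the couplings of the connected Schwinger function $\langle\varphi(x_1)\cdots\varphi(x_N)\overline\varphi(y_1)\cdots\overline\varphi(y_N)\rangle_c$ of this model converges, uniformly in $x_1,\dots,x_N,y_1,\dots,y_N\in\mathrm U(1)^4$, to a finite limit as $\rho\to\infty$. -/

import Mathlib

open MeasureTheory Filter Topology
open scoped Real ContDiff

noncomputable section

namespace TGFT

/-! ### Bubbles and Feynman graphs -/

/-- A `4`-bubble, i.e. a connected tensor invariant of rank `4`: a connected bipartite `4`-coloured
graph. White nodes (fields `φ`) and black nodes (conjugate fields) are both labelled by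
`Fin size`; the line of colour `c` at the white node `i` ends at the black node `edge c i`. -/
structure Bubble where
  size : ℕ
  edge : Fin 4 → Equiv.Perm (Fin size)
  connected : (SimpleGraph.fromRel fun x y : Fin size ⊕ Fin size =>
    ∃ i c, x = Sum.inl i ∧ y = Sum.inr (edge c i)).Connected

/-- White nodes of the disjoint union of the bubbles `b v`. -/
abbrev White {n : ℕ} (b : Fin n → Bubble) : Type := Σ v : Fin n, Fin (b v).size

/-- Black nodes of the disjoint union of the bubbles `b v`. -/
abbrev Black {n : ℕ} (b : Fin n → Bubble) : Type := Σ v : Fin n, Fin (b v).size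

/-- The pairs (white node, black node); the lines of colour `0` are such pairs. -/
abbrev Line {n : ℕ} (b : Fin n → Bubble) : Type := White b × Black b

/-- The coloured line of colour `c` at the white node `w` ends at the black node `col b c w`. -/
def col {n : ℕ} (b : Fin n → Bubble) (c : Fin 4) : White b ≃ Black b :=
  Equiv.sigmaCongrRight fun v => (b v).edge c

/-- A Feynman graph whose vertices are the bubbles `b v`: a set of (internal) lines of colour `0`,
joining white nodes to black nodes, with at most one line at each node. -/
@[ext]
structure FeynmanGraph {n : ℕ} (b : Fin n → Bubble) where
  lines : Finset (Line b)
  white_inj : ∀ l ∈ lines, ∀ l' ∈ lines, l.1 = l'.1 → l = l'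
  black_inj : ∀ l ∈ lines, ∀ l' ∈ lines, l.2 = l'.2 → l = l'

instance {n : ℕ} (b : Fin n → Bubble) : Fintype (FeynmanGraph b) :=
  Fintype.ofInjective FeynmanGraph.lines fun _ _ h => FeynmanGraph.ext h

section Combinatorics

variable {n : ℕ} {b : Fin n → Bubble}

/-- External legs at white nodes: the white nodes without internal line. -/
abbrev WhiteLeg (G : FeynmanGraph b) : Type := {w : White b // ∀ l ∈ G.lines, l.1 ≠ w}

/-- External legs at black nodes. -/
abbrev BlackLeg (G : FeynmanGraph b) : Type := {u : Black b // ∀ l ∈ G.lines, l.2 ≠ u}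

instance (G : FeynmanGraph b) : Fintype (WhiteLeg G) := Subtype.fintype _

instance (G : FeynmanGraph b) : Fintype (BlackLeg G) := Subtype.fintype _

/-- Connectedness of the Feynman graph, that is of its coloured extension (all the nodes, with the
lines of the colours `0, …, 4`). -/
def FeynmanGraph.Connected (G : FeynmanGraph b) : Prop :=
  (SimpleGraph.fromRel fun x y : White b ⊕ Black b =>
    ∃ w u, x = Sum.inl w ∧ y = Sum.inr u ∧ ((w, u) ∈ G.lines ∨ ∃ c, col b c w = u)).Connected

/-- A graph is non-vacuum if it has external legs. -/
def FeynmanGraph.NonVacuum (G : FeynmanGraph b) : Prop :=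
  Nonempty (WhiteLeg G) ∨ Nonempty (BlackLeg G)

/-! ### Faces, contractions, melopoles -/

/-- `f` is a closed face of colour `c` passing only through lines of `H`, i.e. an internal face of
the subgraph `H`: a circuit alternating lines of `H` and coloured lines of colour `c`. It is given
by its set of lines. -/
def IsInternalFace (H : Finset (Line b)) (c : Fin 4) (f : Finset (Line b)) : Prop :=
  f ⊆ H ∧
    Minimal (fun f : Finset (Line b) =>
      f.Nonempty ∧ ∀ l ∈ f, ∃ l' ∈ f, col b c l'.1 = l.2) f

/-- Connectedness of a non-empty subgraph `H`: its incidence matrix between lines and internal faces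
does not factorize into blocks, i.e. any two lines are joined by a chain of lines in which
consecutive ones have a common internal face. -/
def FaceConnected (H : Finset (Line b)) : Prop :=
  H.Nonempty ∧ ∀ l ∈ H, ∀ l' ∈ H,
    Relation.ReflTransGen (fun k k' => ∃ c f, IsInternalFace H c f ∧ k ∈ f ∧ k' ∈ f) l l'

/-- Contraction of the line `l = (w, u)` in a coloured graph with coloured lines `κ`: in each colour
the two coloured lines ending at `u` and starting at `w` are replaced by a single one. The deleted
nodes `w` and `u` are kept as an isolated pair, joined to each other in all the colours. -/
def contract (κ : Fin 4 → (White b ≃ Black b)) (l : Line b) : Fin 4 → (White b ≃ Black b) :=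
  fun c => (κ c).trans (Equiv.swap l.2 (κ c l.1))

/-- `l` is a `k`-dipole: its end nodes are joined by exactly `k - 1` coloured lines. -/
def IsDipole (κ : Fin 4 → (White b ≃ Black b)) (k : ℕ) (l : Line b) : Prop :=
  (Finset.univ.filter fun c => κ c l.1 = l.2).card + 1 = k

/-- Each line of the list is a `4`-dipole once the previous lines have been contracted. -/
def IsMelonicOrdering (κ : Fin 4 → (White b ≃ Black b)) : List (Line b) → Prop
  | [] => True
  | l :: ls => IsDipole κ 4 l ∧ IsMelonicOrdering (contract κ l) ls

/-- A (non-empty) melopole of `G`: a connected subgraph made of tadpole lines at a single vertex,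
whose lines can be ordered so that each of them is a `4`-dipole once the previous ones have been
contracted. -/
def FeynmanGraph.IsMelopole (G : FeynmanGraph b) (H : Finset (Line b)) : Prop :=
  H ⊆ G.lines ∧ FaceConnected H ∧ (∃ v : Fin n, ∀ l ∈ H, l.1.1 = v ∧ l.2.1 = v) ∧
    ∃ ls : List (Line b), ls.Nodup ∧ ls.toFinset = H ∧ IsMelonicOrdering (col b) ls

/-- A meloforest of `G`: a set of melopoles, any two of which are nested or else line-disjoint and
face-disjoint. -/
def FeynmanGraph.IsMeloforest (G : FeynmanGraph b) (M : Finset (Finset (Line b))) : Prop :=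
  (∀ H ∈ M, G.IsMelopole H) ∧
    ∀ H ∈ M, ∀ H' ∈ M, H ⊆ H' ∨ H' ⊆ H ∨
      (Disjoint H H' ∧ ∀ c f, ¬ (IsInternalFace H c f ∧ IsInternalFace H' c f))

open Classical in
/-- The set of all meloforests of `G`, including the empty one. -/
def FeynmanGraph.meloforests (G : FeynmanGraph b) : Finset (Finset (Finset (Line b))) :=
  G.lines.powerset.powerset.filter G.IsMeloforest

/-! ### The localization operators

Before the integration over the bubbles, the integrand of an amplitude has one group variable for
each coloured line, and a coloured line is named by its white node and its colour. A product of
propagators is described by a *placement* `s`: the propagator attached to the white node `w` has as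
argument of colour `c` the variable of the coloured line of colour `c` at the white node `s w c`.
In the bare integrand `s w c = w`. At a black node `u` the argument is always the variable of the
coloured line ending at `u`. -/

/-- One step along a face, through a line of `H`: if the coloured line `x` of colour `c` ends at the
black node of a line `l` of `H`, go to the variable of colour `c` at the other end of `l`. -/
def faceStep (H : Finset (Line b)) (s : White b → Fin 4 → White b) (c : Fin 4) (x : White b) :
    White b :=
  open Classical in
  if h : ∃ l ∈ H, col b c x = l.2 then s h.choose.1 c else x

/-- The localization operator `τ_H`: in the propagators not belonging to `H` (external legs
included), the variable at one end of each external face of `H` is replaced by the variable at the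
other end. The factors belonging to `H` are unchanged. -/
def tau (H : Finset (Line b)) (s : White b → Fin 4 → White b) : White b → Fin 4 → White b :=
  fun w c => if ∃ l ∈ H, l.1 = w then s w c else (faceStep H s c)^[H.card] (s w c)

/-- The effect on the bare integrand of the product of the operators `τ_H`, `H ∈ M` (for a forest
they commute). -/
def tauProd (M : Finset (Finset (Line b))) : White b → Fin 4 → White b :=
  M.toList.foldr tau fun w _ => w

end Combinatorics

/-! ### Propagator and amplitudes -/

/-- The group `U(1)`, with angle coordinate modulo `2π`. -/
abbrev U1 : Type := AddCircle (2 * π)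

instance : Fact (0 < 2 * π) := ⟨Real.two_pi_pos⟩

/-- The normalized Haar measure of `U(1)`. -/
abbrev haar : Measure U1 := AddCircle.haarAddCircle

/-- The heat kernel of `U(1)` at time `α > 0`, with respect to the normalized Haar measure:
`K_α(θ) = ∑ₚ exp (-α p²) exp (i p θ)`. -/
def heatKernel (α : ℝ) (θ : U1) : ℝ := ∑' p : ℤ, Real.exp (-α * (p : ℝ) ^ 2) * (fourier p θ).re

/-- The propagator with mass `m` and Schwinger parameter restricted to `α > a`:
`∫_a^∞ dα exp(-α m²) ∫ dh ∏_c K_α(g_c h g'_c⁻¹)`. -/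
def propagator (m a : ℝ) (g g' : Fin 4 → U1) : ℝ :=
  ∫ α in Set.Ioi a, Real.exp (-α * m ^ 2) *
    ∫ h : U1, ∏ c, heatKernel α (g c + h - g' c) ∂haar

section Amplitudes

variable {n : ℕ} {b : Fin n → Bubble}

/-- Functions of the group variables of the external legs (first at white nodes, then at black
nodes). -/
abbrev LegFunction (G : FeynmanGraph b) : Type :=
  (WhiteLeg G → Fin 4 → U1) → (BlackLeg G → Fin 4 → U1) → ℂ

/-- The amputated Feynman integral of `G` with placement `s`, integrated against a function `Φ` of
the variables of the external legs: integrate over the variables of all the coloured lines, with one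
propagator per internal line. -/
def feynmanIntegral (m a : ℝ) (G : FeynmanGraph b) (s : White b → Fin 4 → White b)
    (Φ : LegFunction G) : ℂ :=
  ∫ θ : White b × Fin 4 → U1,
    ((∏ l ∈ G.lines, propagator m a (fun c => θ (s l.1 c, c))
        (fun c => θ ((col b c).symm l.2, c)) : ℝ) : ℂ) *
      Φ (fun w c => θ (s w.1 c, c)) (fun u c => θ ((col b c).symm u.1, c))
    ∂Measure.pi fun _ => haar

/-- The product of the propagators joining the external legs to external points: `y w` is the
argument of the external conjugate field contracted with the white node `w`, and `x u` the argument
of the external field contracted with the black node `u`. -/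
def legPropagators (m a : ℝ) (G : FeynmanGraph b) (x : BlackLeg G → Fin 4 → U1)
    (y : WhiteLeg G → Fin 4 → U1) : LegFunction G :=
  fun gw gb => (((∏ w, propagator m a (gw w) (y w)) * ∏ u, propagator m a (x u) (gb u) : ℝ) : ℂ)

/-- The renormalized amplitude `∑_M ∏_{H ∈ M} (-τ_H) A_G`, amputated and integrated against `Φ`. -/
def smearedRenormalizedAmplitude (m a : ℝ) (G : FeynmanGraph b) (Φ : LegFunction G) : ℂ :=
  ∑ M ∈ G.meloforests, (-1 : ℂ) ^ M.card * feynmanIntegral m a G (tauProd M) Φ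

/-- The renormalized amplitude `∑_M ∏_{H ∈ M} (-τ_H) A_G` of `G`, with propagators on the external
legs, as a function of the external points. -/
def renormalizedAmplitude (m a : ℝ) (G : FeynmanGraph b) (x : BlackLeg G → Fin 4 → U1)
    (y : WhiteLeg G → Fin 4 → U1) : ℂ :=
  smearedRenormalizedAmplitude m a G (legPropagators m a G x y)

/-- `Φ` is a smooth function on the torus. -/
def IsSmooth (G : FeynmanGraph b) (Φ : LegFunction G) : Prop :=
  ContDiff ℝ ∞ fun z : WhiteLeg G ⊕ BlackLeg G → Fin 4 → ℝ =>
    Φ (fun w c => (z (Sum.inl w) c : U1)) (fun u c => (z (Sum.inr u) c : U1))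

end Amplitudes

open Classical in
/-- The term of order `n ≥ 1` in the couplings of the connected Schwinger function
`⟨φ(x₁) ⋯ φ(x_N) φ̄(y₁) ⋯ φ̄(y_N)⟩` of the model with the melordered interaction
`∑_b t_b Ω(I_b)`, `Ω(I_b) = ∑_M ∏_{H ∈ M} (-τ_H) I_b^M`, where `I_b^M` is the invariant `I_b` in
which the lines of the melopoles of the meloforest `M` of `b` have been contracted with the
propagator.
For each choice of the `n` bubbles, one sums over the terms of the `n` melordered interactions (`P`
consists of the lines of the melopoles and `M` of all the meloforests), then over the connected Wick
contractions of the remaining fields (`G` consists of `P` and the new internal lines, while `σ` and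
`σ'` attach the external points to the remaining nodes). -/
def schwingerTerm (m a : ℝ) (𝓑 : Finset Bubble) (t : 𝓑 → ℂ) (n N : ℕ)
    (x y : Fin N → Fin 4 → U1) : ℂ :=
  (n.factorial : ℂ)⁻¹ * ∑ b : Fin n → 𝓑, (∏ v, -t (b v)) *
    ∑ P : FeynmanGraph fun v => (b v : Bubble),
      ∑ M ∈ P.meloforests.filter fun M => M.sup id = P.lines,
        ∑ G : FeynmanGraph fun v => (b v : Bubble),
          if P.lines ⊆ G.lines ∧ G.Connected then
            ∑ σ : BlackLeg G ≃ Fin N, ∑ σ' : WhiteLeg G ≃ Fin N,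
              (-1 : ℂ) ^ M.card * feynmanIntegral m a G (tauProd M)
                (legPropagators m a G (fun u => x (σ u)) (fun w => y (σ' w)))
          else 0

/-- The value `M ^ (-2 ρ)` of the ultraviolet cutoff on the Schwinger parameters. -/
def cutoff (M : ℝ) (ρ : ℕ) : ℝ := (M ^ (2 * ρ))⁻¹

end TGFT

end

/-!
The renormalized amplitude is computed exactly in momentum space, where the subtractions become
differences of propagators, and the resulting multiple series is dominated uniformly in the cutoff.

*Combinatorics of the subtractions.* A line is called melonic, with an external colour `d`, if its
faces of the three other colours are closed and only run through further lines which are melonic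
with the colour of the face as external colour (`IsMelonic`). The latter lines are inserted on the
former, and this makes the melonic lines into a forest (`wellFounded_isChild`,
`IsChild.parent_unique`). If `G` is connected and has an external leg, no non-empty set of lines
contains all the faces which it meets, and from this it follows that the melopoles are exactly the
trees of the melonic lines (`isMelopole_iff`) and that every set of them is a meloforest
(`sum_meloforests`). So the forest formula is a sum over all the sets of melonic lines.

*Momentum space.* Fourier expansion (`hasSum_propagator`, `hasSum_feynmanIntegral`) attaches a
momentum to each face. The localization operator of the tree of a melonic line sets to zero the
momentum of the external face in the propagator of that line only (`isPlacement_tauProd`), so the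
sum over the meloforests turns the propagator `C(q, u)` of each melonic line, with `q` the momentum
of its external face, into `C(q, u) - C(0, u)` (`hasSum_smearedRenormalizedAmplitude`).

*Melonic lines.* The sums over the closed faces of the melonic lines are performed from the
innermost lines outwards. Each sum leaves a function of `q` which grows more slowly than any power
and whose increments are almost `O(1 / |q|)`, uniformly in the cutoff (`IsMild`). Products of such
functions are of the same kind, and so is the result of one more subtracted loop (`isMild_loop`);
by induction, the forest of melonic lines only contributes mild functions of the momenta of the
other faces (`exists_mild_factors`).

*Other lines.* For these absolute values suffice. Gauge invariance imposes `∑ c, P c = 0` on the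
momenta `P` of a line, and its propagator is bounded by the inverse square of their size. The lines
are ordered by starting from the external faces, such that each line has at most three faces which
have not been met before (`exists_isOld`); when it has three, one of them runs through a later line,
since the line would be melonic otherwise (`exists_common_face`). The lines are summed in the
opposite order. The sum for one line runs over at most two independent momenta, so that it diverges
at most logarithmically, and in the case of two momenta the small power of decay left over in the
common face by the lines summed before makes it converge (`exists_bound_newFaces`).

*External faces.* Their momenta are summed with the help of the external propagators, two for each
face (`tendstoUniformly_renormalizedAmplitude`), or of the decay of the Fourier coefficients of a
smooth function (`exists_tendsto_smearedRenormalizedAmplitude`). As the domination is uniform in the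
cutoff, the limit follows by dominated convergence
(`tendstoUniformly_smearedRenormalizedAmplitude`).

*Schwinger functions.* A contraction inside a melordered interaction followed by a Wick contraction
of the remaining fields is the same as a Feynman graph with one of its meloforests, so a Schwinger
function is a finite sum of renormalized amplitudes (`schwingerTerm_eq`).
-/

noncomputable section

namespace TGFT

/-! ### Faces and contractions -/

section Faces

variable {n : ℕ} {b : Fin n → Bubble} (G : FeynmanGraph b)

/-- One step along a strand: the coloured line `x` ends at the black node of a line of `G`, and `y`
is the coloured line of the same colour at the white end of that line. -/
def strandRel (x y : White b × Fin 4) : Prop :=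
  x.2 = y.2 ∧ ∃ l ∈ G.lines, col b x.2 x.1 = l.2 ∧ y.1 = l.1

/-- The faces of `G`, closed or not, as classes of coloured lines. A coloured line is named by its
white node and its colour. -/
def Face : Type := Quot (strandRel G)

instance : Finite (Face G) := Quot.finite _

/-- The face running through the coloured line of colour `c` at the white node `w`. -/
def face (w : White b) (c : Fin 4) : Face G := Quot.mk _ (w, c)

variable {G}

lemma face_pred {l : Line b} (hl : l ∈ G.lines) (c : Fin 4) :
    face G ((col b c).symm l.2) c = face G l.1 c :=
  Quot.sound ⟨rfl, l, hl, by simp, rfl⟩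

lemma face_of_col_eq {l : Line b} (hl : l ∈ G.lines) {c : Fin 4} {x : White b}
    (h : col b c x = l.2) : face G x c = face G l.1 c := by
  rw [← face_pred hl, ← h, Equiv.symm_apply_apply]

lemma face_surjective (f : Face G) : ∃ w c, face G w c = f := by
  induction f using Quot.ind with | _ x => exact ⟨x.1, x.2, rfl⟩

lemma face_colour {w w' : White b} {c c' : Fin 4} (h : face G w c = face G w' c') : c = c' :=
  congrArg (Quot.lift (fun x : White b × Fin 4 => x.2) fun _ _ h => h.1) h

/-- A function on the white nodes which is constant along the strands of colour `c` is constant on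
the faces of colour `c`. -/
lemma eq_of_face_eq {α : Sort*} {c : Fin 4} (r : White b → α)
    (hr : ∀ l ∈ G.lines, ∀ x, col b c x = l.2 → r x = r l.1) {x y : White b}
    (h : face G x c = face G y c) : r x = r y := by
  have key : ∀ z z' : White b × Fin 4, Quot.mk (strandRel G) z = Quot.mk (strandRel G) z' →
      z.2 = c → z'.2 = c → r z.1 = r z'.1 := by
    intro z z' hzz
    have := Quot.eqvGen_exact hzz
    induction this with
    | rel z z' h =>
      intro h1 h2
      obtain ⟨h3, l, hl, h4, h5⟩ := h
      rw [h1] at h4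
      rw [h5]; exact hr l hl _ h4
    | refl => intros; rfl
    | symm z z' h ih => exact fun h1 h2 => (ih (Quot.eqvGen_sound h) h2 h1).symm
    | trans z z' z'' h h' ih ih' =>
      intro h1 h2
      have h3 : z.2 = z'.2 := face_colour (w := z.1) (w' := z'.1) (Quot.eqvGen_sound h)
      exact (ih (Quot.eqvGen_sound h) h1 (h3 ▸ h1)).trans (ih' (Quot.eqvGen_sound h') (h3 ▸ h1) h2)
  exact key _ _ h rfl rfl

/-- A set of white nodes which is invariant along the strands of colour `c` contains each face of
colour `c` which it meets. -/
lemma mem_of_face_eq {c : Fin 4} (S : Set (White b))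
    (hS : ∀ l ∈ G.lines, ∀ x, col b c x = l.2 → (x ∈ S ↔ l.1 ∈ S)) {x y : White b}
    (h : face G x c = face G y c) (hy : y ∈ S) : x ∈ S := by
  have := eq_of_face_eq (fun x => x ∈ S) (fun l hl x hx => propext (hS l hl x hx)) h
  exact this.symm ▸ hy

lemma line_eq_of_white {l l' : Line b} (hl : l ∈ G.lines) (hl' : l' ∈ G.lines) (h : l.1 = l'.1) :
    l = l' := G.white_inj l hl l' hl' h

lemma line_eq_of_black {l l' : Line b} (hl : l ∈ G.lines) (hl' : l' ∈ G.lines) (h : l.2 = l'.2) :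
    l = l' := G.black_inj l hl l' hl' h

/-- A closed face is also closed at the black nodes. -/
lemma exists_line_of_closed {c : Fin 4} {w : White b}
    (h : ∀ y, face G y c = face G w c → ∃ k ∈ G.lines, k.1 = y) {x : White b}
    (hx : face G x c = face G w c) : ∃ k ∈ G.lines, k.2 = col b c x := by
  -- going backwards along the strand is injective on the finite face, hence surjective
  set S : Set (White b) := {y | face G y c = face G w c}
  choose! k hk hk' using h
  have hmaps : Set.MapsTo (fun y => (col b c).symm (k y).2) S S := fun y hy => by
    change face G _ c = _
    rw [face_pred (hk y hy), hk' y hy]; exact hy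
  have hinj : Set.InjOn (fun y => (col b c).symm (k y).2) S := fun y hy y' hy' e => by
    rw [← hk' y hy, ← hk' y' hy',
      line_eq_of_black (hk y hy) (hk y' hy') ((col b c).symm.injective e)]
  obtain ⟨y, hy, hy'⟩ :=
    (S.toFinite.injOn_iff_bijOn_of_mapsTo hmaps).1 hinj |>.surjOn hx
  exact ⟨k y, hk y hy, by rw [← hy', Equiv.apply_symm_apply]⟩

/-- The coloured lines after contraction of the lines of a list. -/
def contractList (ls : List (Line b)) : Fin 4 → (White b ≃ Black b) := ls.foldl contract (col b)

/-- After contraction of a list of lines, each strand is followed backwards by a function `r` to the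
white node at which its contracted coloured line begins. -/
lemma exists_strand_start (c : Fin 4) (ls : List (Line b)) (hnd : ls.Nodup)
    (hls : ∀ l ∈ ls, l ∈ G.lines) :
    (∀ l ∈ ls, contractList ls c l.1 = l.2) ∧
    (∀ x, face G ((col b c).symm (contractList ls c x)) c = face G x c) ∧
    ∃ r : White b → White b,
      (∀ x, (∀ l ∈ ls, l.1 ≠ x) → r x = x) ∧
      (∀ l ∈ ls, ∀ x, col b c x = l.2 → r x = r l.1) ∧
      (∀ x, r ((col b c).symm (contractList ls c x)) = r x) ∧
      (∀ x, (∀ l ∈ ls, l.2 ≠ col b c x) → contractList ls c (r x) = col b c x) := by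
  induction ls using List.reverseRecOn with
  | nil => exact ⟨by simp, by simp [contractList], id, by simp, by simp, by simp [contractList],
      by simp [contractList]⟩
  | append_singleton ls l ih =>
    have hnd' : ls.Nodup := hnd.of_append_left
    have hl : l ∈ G.lines := hls l (by simp)
    have hlls : l ∉ ls := by
      have := List.nodup_append.1 hnd
      intro h
      exact this.2.2 l h l (by simp) rfl
    have hls' : ∀ l ∈ ls, l ∈ G.lines := fun l' h => hls l' (by simp [h])
    obtain ⟨i2, i1, r, r1, r2, r3, r4⟩ := ih hnd' hls'
    have hw : ∀ l' ∈ ls, l'.1 ≠ l.1 := fun l' h e =>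
      hlls (line_eq_of_white (hls' l' h) hl e ▸ h)
    have hu : ∀ l' ∈ ls, l'.2 ≠ l.2 := fun l' h e =>
      hlls (line_eq_of_black (hls' l' h) hl e ▸ h)
    have hk : ∀ x, contractList (ls ++ [l]) c x =
        Equiv.swap l.2 (contractList ls c l.1) (contractList ls c x) := by
      intro x; simp [contractList, contract]
    set κ := contractList ls c with hκ
    have rl : r l.1 = l.1 := r1 _ hw
    set ρ := r ((col b c).symm l.2) with hρ
    have hρ' : κ ρ = l.2 := by
      have := r4 ((col b c).symm l.2) (by simpa using hu)
      simpa using this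
    refine ⟨?_, ?_, fun x => if r x = l.1 then ρ else r x, ?_, ?_, ?_, ?_⟩
    · intro l' h
      rw [hk]
      rcases List.mem_append.1 h with h | h
      · rw [i2 l' h, Equiv.swap_apply_of_ne_of_ne (hu l' h)]
        rw [← i2 l' h]; exact fun e => hw l' h (κ.injective e)
      · obtain rfl : l' = l := by simpa using h
        simp
    · intro x
      rw [hk]
      by_cases h1 : κ x = l.2
      · rw [h1, Equiv.swap_apply_left, i1 l.1, ← face_pred hl, ← h1, i1]
      · by_cases h2 : x = l.1
        · rw [h2, Equiv.swap_apply_right, face_pred hl]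
        · rw [Equiv.swap_apply_of_ne_of_ne h1 (fun e => h2 (κ.injective e)), i1]
    · intro x hx
      have h1 : r x = x := r1 x fun l' h => hx l' (by simp [h])
      have h2 : l.1 ≠ x := hx l (by simp)
      simp [h1, h2.symm]
    · intro l' h x hx
      rcases List.mem_append.1 h with h | h
      · simp only [r2 l' h x hx]
      · obtain rfl : l' = l := by simpa using h
        have : r x = ρ := by rw [hρ, ← hx, Equiv.symm_apply_apply]
        simp only [rl, this, if_true]; split_ifs <;> rfl
    · intro x
      simp only [hk]
      by_cases h1 : κ x = l.2
      · have h2 : r x = ρ := by rw [hρ, ← h1, r3]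
        rw [h1, Equiv.swap_apply_left, r3 l.1, rl, h2]; simp
      · by_cases h2 : x = l.1
        · rw [h2, Equiv.swap_apply_right, rl, ← hρ]; simp
        · rw [Equiv.swap_apply_of_ne_of_ne h1 (fun e => h2 (κ.injective e)), r3]
    · intro x hx
      have h1 := r4 x fun l' h => hx l' (by simp [h])
      have h2 : l.2 ≠ col b c x := hx l (by simp)
      rw [hk]
      beta_reduce
      split_ifs with h3
      · rw [hρ', Equiv.swap_apply_left, ← h3, h1]
      · rw [h1, Equiv.swap_apply_of_ne_of_ne h2.symm]
        rw [← h1]; exact fun e => h3 (κ.injective e)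

/-- After contraction of `ls`, the ends of a further line `l` are joined by a line of colour `c` if
and only if the face of colour `c` through `l` is closed and runs only through `l` and `ls`. -/
lemma contractList_eq_iff {ls : List (Line b)} (hnd : ls.Nodup) (hls : ∀ l ∈ ls, l ∈ G.lines)
    {l : Line b} (hl : l ∈ G.lines) (hlls : l ∉ ls) (c : Fin 4) :
    contractList ls c l.1 = l.2 ↔
      ∀ y, face G y c = face G l.1 c → y = l.1 ∨ ∃ l' ∈ ls, l'.1 = y := by
  obtain ⟨i2, i1, r, r1, r2, r3, r4⟩ := exists_strand_start c ls hnd hls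
  have hw : ∀ l' ∈ ls, l'.1 ≠ l.1 := fun l' h e => hlls (line_eq_of_white (hls l' h) hl e ▸ h)
  have hu : ∀ l' ∈ ls, l'.2 ≠ l.2 := fun l' h e => hlls (line_eq_of_black (hls l' h) hl e ▸ h)
  have rl : r l.1 = l.1 := r1 _ hw
  constructor
  · intro h y hy
    have hx0 : r ((col b c).symm l.2) = l.1 := by rw [← h, r3, rl]
    have : y ∈ {y | r y = l.1} := by
      refine mem_of_face_eq _ ?_ hy rl
      intro l' hl' x hx
      by_cases h1 : l' ∈ ls
      · simp only [Set.mem_ofPred_eq, r2 l' h1 x hx]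
      · by_cases h2 : l' = l
        · subst h2
          simp only [Set.mem_ofPred_eq, rl, iff_true]
          rw [← hx0, ← hx, Equiv.symm_apply_apply]
        · have h3 : r l'.1 = l'.1 := r1 _ fun k hk e =>
            h1 (line_eq_of_white (hls k hk) hl' e ▸ hk)
          have h4 : l'.1 ≠ l.1 := fun e => h2 (line_eq_of_white hl' hl e)
          simp only [Set.mem_ofPred_eq, h3, h4, iff_false]
          intro h5
          have h6 := r4 x fun k hk e =>
            h1 (line_eq_of_black (hls k hk) hl' (e.trans hx) ▸ hk)
          rw [h5, h, hx] at h6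
          exact h2 (line_eq_of_black hl' hl h6.symm)
    by_contra! hcon
    exact hcon.1 ((r1 y hcon.2).symm.trans this)
  · intro h
    have hcl : ∀ y, face G y c = face G l.1 c → ∃ k ∈ G.lines, k.1 = y := by
      intro y hy
      rcases h y hy with h1 | ⟨l', h1, h2⟩
      · exact ⟨l, hl, h1.symm⟩
      · exact ⟨l', hls l' h1, h2⟩
    obtain ⟨k, hk, hk2⟩ := exists_line_of_closed hcl (i1 l.1)
    rw [Equiv.apply_symm_apply] at hk2
    rcases h k.1 (by rw [← face_pred hk, hk2, i1]) with h1 | ⟨l', h1, h2⟩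
    · rw [← hk2, line_eq_of_white hk hl h1]
    · rw [← line_eq_of_white (hls l' h1) hk h2, ← i2 l' h1] at hk2
      exact absurd ((contractList ls c).injective hk2) (hw l' h1)

end Faces

/-! ### Melonic lines and their trees -/

section Melonic

variable {n : ℕ} {b : Fin n → Bubble} {G : FeynmanGraph b}

/-- In a connected non-vacuum graph, a non-empty set of lines meets a face which it does not
contain. -/
lemma exists_open_face (hG : G.Connected) (hv : G.NonVacuum) {H : Finset (Line b)}
    (hH : H.Nonempty) (hs : H ⊆ G.lines) :
    ∃ l ∈ H, ∃ c y, face G y c = face G l.1 c ∧ ∀ l' ∈ H, l'.1 ≠ y := by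
  by_contra! hcon
  let N : White b ⊕ Black b → Prop :=
    Sum.elim (fun w => ∃ l ∈ H, l.1 = w) (fun u => ∃ l ∈ H, l.2 = u)
  have hstep : ∀ w u, ((w, u) ∈ G.lines ∨ ∃ c, col b c w = u) →
      (N (Sum.inl w) ↔ N (Sum.inr u)) := by
    rintro w u (h | ⟨c, rfl⟩)
    · constructor
      · rintro ⟨l, hl, rfl⟩
        exact ⟨l, hl, congrArg Prod.snd (line_eq_of_white (hs hl) h rfl)⟩
      · rintro ⟨l, hl, rfl⟩
        exact ⟨l, hl, congrArg Prod.fst (line_eq_of_black (hs hl) h rfl)⟩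
    · constructor
      · rintro ⟨l, hl, rfl⟩
        obtain ⟨k, hk, hk2⟩ := exists_line_of_closed (c := c) (w := l.1) (x := l.1)
          (fun y hy => by
            obtain ⟨l', h, h'⟩ := hcon l hl c y hy
            exact ⟨l', hs h, h'⟩) rfl
        obtain ⟨l', h, h'⟩ := hcon l hl c k.1 (face_of_col_eq hk hk2.symm).symm
        rw [line_eq_of_white (hs h) hk h'] at h
        exact ⟨k, h, hk2⟩
      · rintro ⟨l, hl, h⟩
        exact hcon l hl c w (face_of_col_eq (hs hl) h.symm)
  have hall : ∀ x y, N x → N y := by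
    intro x y hx
    obtain ⟨p⟩ := hG.preconnected x y
    induction p with
    | nil => exact hx
    | cons h p ih =>
      refine ih ?_
      rw [SimpleGraph.fromRel_adj] at h
      rcases h.2 with ⟨w, u, rfl, rfl, h'⟩ | ⟨w, u, rfl, rfl, h'⟩
      · exact (hstep w u h').1 hx
      · exact (hstep w u h').2 hx
  obtain ⟨l, hl⟩ := hH
  have hl' : N (Sum.inl l.1) := ⟨l, hl, rfl⟩
  rcases hv with ⟨⟨w, hw⟩⟩ | ⟨⟨u, hu⟩⟩
  · obtain ⟨k, hk, hk'⟩ := hall _ (Sum.inl w) hl'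
    exact hw k (hs hk) hk'
  · obtain ⟨k, hk, hk'⟩ := hall _ (Sum.inr u) hl'
    exact hu k (hs hk) hk'

variable (G) in
/-- `l` is a melonic line of `G` with external colour `d`: its three faces of the colours `c ≠ d`
are closed, and all the other lines on them are themselves melonic, with external colour `c`.
So `l` becomes a `4`-dipole once the melonic lines inserted on its three faces are contracted. -/
inductive IsMelonic : Line b → Fin 4 → Prop
  | mk {l : Line b} {d : Fin 4} (hl : l ∈ G.lines)
      (hclosed : ∀ c, c ≠ d → ∀ y, face G y c = face G l.1 c → ∃ k ∈ G.lines, k.1 = y)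
      (hmel : ∀ c, c ≠ d → ∀ k ∈ G.lines, face G k.1 c = face G l.1 c → k ≠ l → IsMelonic k c) :
      IsMelonic l d

namespace IsMelonic

lemma mem {l : Line b} {d : Fin 4} (h : IsMelonic G l d) : l ∈ G.lines := by cases h; assumption

lemma closed {l : Line b} {d : Fin 4} (h : IsMelonic G l d) {c : Fin 4} (hc : c ≠ d) :
    ∀ y, face G y c = face G l.1 c → ∃ k ∈ G.lines, k.1 = y := by
  cases h with | mk _ h _ => exact h c hc

lemma child {l : Line b} {d : Fin 4} (h : IsMelonic G l d) {c : Fin 4} (hc : c ≠ d) :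
    ∀ k ∈ G.lines, face G k.1 c = face G l.1 c → k ≠ l → IsMelonic G k c := by
  cases h with | mk _ _ h => exact h c hc

end IsMelonic

variable (G) in
/-- `k` is inserted on one of the three closed faces of the melonic line `l`. -/
def IsChild (k l : Line b) : Prop :=
  ∃ d c, IsMelonic G l d ∧ c ≠ d ∧ k ∈ G.lines ∧ k ≠ l ∧ face G k.1 c = face G l.1 c

variable (G) in
open Classical in
/-- The melonic line `l` together with all the lines inserted on it, recursively. -/
def melonTree (l : Line b) : Finset (Line b) :=
  G.lines.filter fun k => Relation.ReflTransGen (IsChild G) k l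

lemma mem_melonTree {k l : Line b} :
    k ∈ melonTree G l ↔ k ∈ G.lines ∧ Relation.ReflTransGen (IsChild G) k l := by
  classical simp [melonTree]

lemma melonTree_subset (l : Line b) : melonTree G l ⊆ G.lines :=
  fun _ h => (mem_melonTree.1 h).1

lemma IsChild.isMelonic {k l : Line b} (h : IsChild G k l) : ∃ d, IsMelonic G k d := by
  obtain ⟨d, c, h1, h2, h3, h4, h5⟩ := h
  exact ⟨c, h1.child h2 k h3 h5 h4⟩

/-- All four faces of a line of a tree other than the root, and the three closed faces of the root,
are contained in the tree. -/
lemma exists_mem_melonTree {l k : Line b} {d c : Fin 4} (hl : IsMelonic G l d)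
    (hk : k ∈ melonTree G l) (hc : k = l → c ≠ d) {y : White b}
    (hy : face G y c = face G k.1 c) : ∃ k' ∈ melonTree G l, k'.1 = y := by
  have key : ∀ k d', k ∈ melonTree G l → IsMelonic G k d' → c ≠ d' →
      face G y c = face G k.1 c → ∃ k' ∈ melonTree G l, k'.1 = y := by
    intro k d' hk hm hcd hy
    obtain ⟨k', hk', rfl⟩ := hm.closed hcd y hy
    by_cases h : k' = k
    · exact ⟨k, hk, by rw [h]⟩
    · exact ⟨k', mem_melonTree.2
        ⟨hk', .head ⟨d', c, hm, hcd, hk', h, hy⟩ (mem_melonTree.1 hk).2⟩, rfl⟩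
  rcases Relation.ReflTransGen.cases_head (mem_melonTree.1 hk).2 with rfl | ⟨k₁, hk₁, h⟩
  · exact key k d hk hl (hc rfl) hy
  · obtain ⟨d', c', h1, h2, h3, h4, h5⟩ := hk₁
    by_cases hcc : c = c'
    · subst hcc
      exact key k₁ d' (mem_melonTree.2 ⟨h1.mem, h⟩) h1 h2 (hy.trans h5)
    · exact key k c' hk (h1.child h2 k h3 h5 h4) hcc hy

lemma self_mem_melonTree {l : Line b} (hl : l ∈ G.lines) : l ∈ melonTree G l :=
  mem_melonTree.2 ⟨hl, .refl⟩

section Connected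

variable (hG : G.Connected) (hv : G.NonVacuum)

include hG hv

/-- No face consists only of melonic lines having its colour as external colour: otherwise these
lines and their trees would form a closed component of `G`. -/
lemma exists_not_isMelonic (x : White b) (c : Fin 4) :
    ∃ y, face G y c = face G x c ∧ ∀ l ∈ G.lines, l.1 = y → ¬ IsMelonic G l c := by
  classical
  by_contra! hcon
  let H : Finset (Line b) := G.lines.filter fun k =>
    ∃ z ∈ G.lines, face G z.1 c = face G x c ∧ Relation.ReflTransGen (IsChild G) k z
  have hH : H.Nonempty := by
    obtain ⟨l, hl, h1, h2⟩ := hcon x rfl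
    exact ⟨l, by simp only [H, Finset.mem_filter]; exact ⟨hl, l, hl, by rw [h1], .refl⟩⟩
  obtain ⟨l, hl, c', y, hy, hne⟩ := exists_open_face hG hv hH (Finset.filter_subset _ _)
  have hchild : ∀ l d c' y, l ∈ H → IsMelonic G l d → c' ≠ d → face G y c' = face G l.1 c' →
      ∃ k ∈ H, k.1 = y := by
    intro l d c' y hl hm hc hy
    obtain ⟨k, hk, rfl⟩ := hm.closed hc y hy
    by_cases hkl : k = l
    · subst hkl; exact ⟨k, hl, rfl⟩
    · simp only [H, Finset.mem_filter] at hl ⊢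
      obtain ⟨hl, z, hz, h1, h2⟩ := hl
      exact ⟨k, ⟨hk, z, hz, h1, .head ⟨d, c', hm, hc, hk, hkl, hy⟩ h2⟩, rfl⟩
  have hl' := hl
  simp only [H, Finset.mem_filter] at hl'
  obtain ⟨hlG, z, hz, h1, h2⟩ := hl'
  have hzm : IsMelonic G z c := by
    obtain ⟨k, hk, h3, h4⟩ := hcon z.1 h1
    rwa [line_eq_of_white hz hk h3.symm]
  rcases Relation.ReflTransGen.cases_head h2 with rfl | ⟨k, hk, hkz⟩
  · by_cases hc : c' = c
    · subst hc
      obtain ⟨k, hk, h3, h4⟩ := hcon y (hy.trans h1)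
      refine hne k ?_ h3
      simp only [H, Finset.mem_filter]
      exact ⟨hk, k, hk, by rw [h3, hy, h1], .refl⟩
    · obtain ⟨k, hk, h3⟩ := hchild l c c' y hl hzm hc hy
      exact hne k hk h3
  · obtain ⟨d, c₁, h3, h4, h5, h6, h7⟩ := hk
    by_cases hc : c' = c₁
    · subst hc
      have hkH : k ∈ H := by
        simp only [H, Finset.mem_filter]; exact ⟨h3.mem, z, hz, h1, hkz⟩
      obtain ⟨k', hk', h8⟩ := hchild k d c' y hkH h3 h4 (hy.trans h7)
      exact hne k' hk' h8
    · obtain ⟨k', hk', h8⟩ := hchild l c₁ c' y hl (h3.child h4 l h5 h7 h6) hc hy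
      exact hne k' hk' h8

lemma IsMelonic.colour_unique {l : Line b} {d d' : Fin 4} (h : IsMelonic G l d)
    (h' : IsMelonic G l d') : d = d' := by
  by_contra hne
  obtain ⟨y, hy, hy'⟩ := exists_not_isMelonic hG hv l.1 d
  obtain ⟨k, hk, rfl⟩ := h'.closed hne y hy
  by_cases hkl : k = l
  · exact hy' k hk rfl (hkl ▸ h)
  · exact hy' k hk rfl (h'.child hne k hk hy hkl)

lemma IsMelonic.acc {l : Line b} {d : Fin 4} (h : IsMelonic G l d) : Acc (IsChild G) l := by
  induction h with
  | mk hl hc hm ih =>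
    refine Acc.intro _ fun k hk => ?_
    obtain ⟨d', c, h1, h2, h3, h4, h5⟩ := hk
    obtain rfl := h1.colour_unique hG hv (IsMelonic.mk hl hc hm)
    exact ih c h2 k h3 h5 h4

lemma wellFounded_isChild : WellFounded (IsChild G) := by
  refine ⟨fun l => Acc.intro _ fun k hk => ?_⟩
  obtain ⟨d, hd⟩ := hk.isMelonic
  exact hd.acc hG hv

lemma IsChild.parent_unique {k l l' : Line b} (h : IsChild G k l) (h' : IsChild G k l') :
    l = l' := by
  obtain ⟨d, c, h1, h2, h3, h4, h5⟩ := h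
  obtain ⟨d', c', h1', h2', h3', h4', h5'⟩ := h'
  obtain rfl := (h1.child h2 k h3 h5 h4).colour_unique hG hv (h1'.child h2' k h3' h5' h4')
  by_contra hne
  exact h2 ((h1'.child h2' l h1.mem (h5.symm.trans h5') hne).colour_unique hG hv h1)

/-- The face of the external colour through the root is not contained in the tree. -/
lemma exists_notMem_melonTree {l : Line b} {d : Fin 4} (hl : IsMelonic G l d) :
    ∃ y, face G y d = face G l.1 d ∧ ∀ k ∈ melonTree G l, k.1 ≠ y := by
  obtain ⟨k, hk, c, y, hy, hne⟩ := exists_open_face hG hv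
    ⟨l, self_mem_melonTree hl.mem⟩ (melonTree_subset l)
  by_cases h : k = l → c ≠ d
  · obtain ⟨k', h1, h2⟩ := exists_mem_melonTree hl hk h hy
    exact absurd h2 (hne k' h1)
  · push Not at h
    obtain ⟨rfl, rfl⟩ := h
    exact ⟨y, hy, hne⟩

lemma melonTree_injective {l l' : Line b} {d d' : Fin 4} (hl : IsMelonic G l d)
    (hl' : IsMelonic G l' d') (h : melonTree G l = melonTree G l') : l = l' := by
  have h1 := (mem_melonTree.1 (h ▸ self_mem_melonTree hl.mem)).2
  have h2 := (mem_melonTree.1 (h.symm ▸ self_mem_melonTree hl'.mem)).2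
  by_contra hne
  have h3 : Relation.TransGen (IsChild G) l l' :=
    (Relation.reflTransGen_iff_eq_or_transGen.1 h1).resolve_left (Ne.symm hne)
  have h4 : Relation.TransGen (IsChild G) l l := h3.trans_left h2
  exact ((wellFounded_isChild hG hv).transGen.irrefl).irrefl _ h4

lemma melonTree_laminar (l l' : Line b) :
    melonTree G l ⊆ melonTree G l' ∨ melonTree G l' ⊆ melonTree G l ∨
      Disjoint (melonTree G l) (melonTree G l') := by
  by_cases h : Disjoint (melonTree G l) (melonTree G l')
  · exact Or.inr (Or.inr h)
  · obtain ⟨k, hk, hk'⟩ := Finset.not_disjoint_iff.1 h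
    have h1 := (mem_melonTree.1 hk).2
    have h2 := (mem_melonTree.1 hk').2
    have hu : Relator.RightUnique (IsChild G) := fun a b c h h' => h.parent_unique hG hv h'
    rcases Relation.ReflTransGen.total_of_right_unique hu h1 h2 with h | h
    · exact Or.inl fun x hx => mem_melonTree.2
        ⟨(mem_melonTree.1 hx).1, (mem_melonTree.1 hx).2.trans h⟩
    · exact Or.inr (Or.inl fun x hx => mem_melonTree.2
        ⟨(mem_melonTree.1 hx).1, (mem_melonTree.1 hx).2.trans h⟩)

end Connected

end Melonic

/-! ### Classification of the melopoles and meloforests -/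

section Melopoles

variable {n : ℕ} {b : Fin n → Bubble} {G : FeynmanGraph b}

/-- The white nodes of a set of lines closed under the strands of colour `c` form a union of
faces. -/
lemma exists_line_of_face_eq {f : Finset (Line b)} (hf : f ⊆ G.lines) {c : Fin 4}
    (hc : ∀ l ∈ f, ∃ l' ∈ f, col b c l'.1 = l.2) {l : Line b} (hl : l ∈ f) {x : White b}
    (hx : face G x c = face G l.1 c) : ∃ k ∈ f, k.1 = x := by
  choose! φ hφ hφ' using hc
  have hinj : Set.InjOn φ f := fun k hk k' hk' e => by
    have := hφ' k hk
    rw [e, hφ' k' hk'] at this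
    exact line_eq_of_black (hf hk) (hf hk') this.symm
  have hsurj : Set.SurjOn φ f f :=
    (f.finite_toSet.injOn_iff_bijOn_of_mapsTo hφ).1 hinj |>.surjOn
  refine mem_of_face_eq {x | ∃ k ∈ f, k.1 = x} (fun k hk x hx => ⟨?_, ?_⟩) hx ⟨l, hl, rfl⟩
  · rintro ⟨k', hk', rfl⟩
    obtain ⟨k₂, hk₂, rfl⟩ := hsurj hk'
    rw [hφ' k₂ hk₂] at hx
    exact ⟨k, line_eq_of_black (hf hk₂) hk hx ▸ hk₂, rfl⟩
  · rintro ⟨k', hk', h⟩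
    obtain rfl := line_eq_of_white (hf hk') hk h
    exact ⟨φ k', hφ k' hk', (col b c).injective ((hφ' k' hk').trans hx.symm)⟩

lemma IsInternalFace.face_eq {H : Finset (Line b)} (hH : H ⊆ G.lines) {c : Fin 4}
    {f : Finset (Line b)} (hf : IsInternalFace H c f) {k k' : Line b} (hk : k ∈ f) (hk' : k' ∈ f) :
    face G k'.1 c = face G k.1 c := by
  classical
  obtain ⟨hfH, ⟨-, hcl⟩, hmin⟩ := hf
  have h := hmin (y := f.filter fun l => face G l.1 c = face G k.1 c)
    ⟨⟨k, by simp [hk]⟩, fun l hl => by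
      rw [Finset.mem_filter] at hl
      obtain ⟨l', h1, h2⟩ := hcl l hl.1
      refine ⟨l', Finset.mem_filter.2 ⟨h1, ?_⟩, h2⟩
      rw [← hl.2, face_of_col_eq (hH (hfH hl.1)) h2]⟩ (Finset.filter_subset _ _)
  exact (Finset.mem_filter.1 (h hk')).2

/-- The lines on a closed face form an internal face. -/
lemma exists_isInternalFace {H : Finset (Line b)} (hH : H ⊆ G.lines) {c : Fin 4} {w : White b}
    (h : ∀ y, face G y c = face G w c → ∃ k ∈ H, k.1 = y) :
    ∃ f, IsInternalFace H c f ∧ ∀ k ∈ G.lines, face G k.1 c = face G w c → k ∈ f := by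
  classical
  have hmem : ∀ k ∈ G.lines, face G k.1 c = face G w c →
      k ∈ H.filter fun l => face G l.1 c = face G w c := by
    intro k hk e
    obtain ⟨k', h1, h2⟩ := h _ e
    rw [line_eq_of_white (hH h1) hk h2] at h1
    exact Finset.mem_filter.2 ⟨h1, e⟩
  refine ⟨H.filter fun l => face G l.1 c = face G w c, ⟨Finset.filter_subset _ _, ⟨?_, ?_⟩, ?_⟩,
    hmem⟩
  · obtain ⟨k, h1, rfl⟩ := h w rfl
    exact ⟨k, by simp [h1]⟩
  · intro l hl
    rw [Finset.mem_filter] at hl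
    have e : face G ((col b c).symm l.2) c = face G w c := (face_pred (hH hl.1) c).trans hl.2
    obtain ⟨k, h1, h2⟩ := h _ e
    exact ⟨k, hmem k (hH h1) (h2 ▸ e), by rw [h2, Equiv.apply_symm_apply]⟩
  · rintro f' ⟨⟨k, hk⟩, hcl⟩ hsub l hl
    have hf' : f' ⊆ G.lines := hsub.trans ((Finset.filter_subset _ _).trans hH)
    rw [Finset.mem_filter] at hl
    obtain ⟨l', h1, h2⟩ := exists_line_of_face_eq hf' hcl hk
      (hl.2.trans (Finset.mem_filter.1 (hsub hk)).2.symm)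
    rwa [line_eq_of_white (hf' h1) (hH hl.1) h2] at h1

lemma col_fst (c : Fin 4) (x : White b) : (col b c x).1 = x.1 := rfl

/-- If all the other lines on a closed face are tadpoles, then `l` is a tadpole: a closed face
enters each vertex as often as it leaves it. -/
lemma tadpole_of_closed {c : Fin 4} {l : Line b} (hl : l ∈ G.lines)
    (hcl : ∀ y, face G y c = face G l.1 c → ∃ k ∈ G.lines, k.1 = y)
    (ht : ∀ k ∈ G.lines, face G k.1 c = face G l.1 c → k ≠ l → k.1.1 = k.2.1) :
    l.1.1 = l.2.1 := by
  classical
  by_contra hne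
  let f := G.lines.filter fun k => face G k.1 c = face G l.1 c
  have hφ : ∀ k ∈ f, ∃ k' ∈ f, k'.2 = col b c k.1 := by
    intro k hk
    simp only [f, Finset.mem_filter] at hk ⊢
    obtain ⟨k', h1, h2⟩ := exists_line_of_closed hcl hk.2
    exact ⟨k', ⟨h1, (face_of_col_eq h1 h2.symm).symm.trans hk.2⟩, h2⟩
  choose! φ hφ hφ' using hφ
  have hlt : (f.filter fun k => k.2.1 = l.1.1).card < (f.filter fun k => k.1.1 = l.1.1).card := by
    refine Finset.card_lt_card ⟨?_, ?_⟩
    · intro k hk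
      simp only [f, Finset.mem_filter] at hk ⊢
      have : k ≠ l := by rintro rfl; exact hne hk.2.symm
      exact ⟨hk.1, by rw [ht k hk.1.1 hk.1.2 this, hk.2]⟩
    · intro h
      have : l ∈ f.filter fun k => k.1.1 = l.1.1 := by simp [f, hl]
      exact hne (Finset.mem_filter.1 (h this)).2.symm
  refine absurd (Finset.card_le_card_of_injOn φ ?_ ?_) hlt.not_ge
  · intro k hk
    simp only [Finset.coe_filter, Set.mem_ofPred_eq] at hk ⊢
    exact ⟨hφ k hk.1, by rw [hφ' k hk.1, col_fst, hk.2]⟩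
  · intro k hk k' hk' e
    simp only [Finset.coe_filter, Set.mem_ofPred_eq] at hk hk'
    have := hφ' k hk.1
    rw [e, hφ' k' hk'.1] at this
    exact line_eq_of_white (Finset.mem_filter.1 hk.1).1 (Finset.mem_filter.1 hk'.1).1
      ((col b c).injective this.symm)

lemma IsMelonic.tadpole {l : Line b} {d : Fin 4} (h : IsMelonic G l d) : l.1.1 = l.2.1 := by
  induction h with
  | @mk l d hl hc hm ih =>
    obtain ⟨c, hcd⟩ := exists_ne d
    exact tadpole_of_closed hl (hc c hcd) fun k hk e hkl => ih c hcd k hk e hkl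

lemma IsChild.vertex_eq {k l : Line b} (h : IsChild G k l) : k.1.1 = l.1.1 := by
  obtain ⟨d, c, h1, h2, h3, h4, h5⟩ := h
  have ht : ∀ k ∈ G.lines, face G k.1 c = face G l.1 c → k.1.1 = k.2.1 := by
    intro k hk e
    by_cases hkl : k = l
    · exact hkl ▸ h1.tadpole
    · exact (h1.child h2 k hk e hkl).tadpole
  refine (mem_of_face_eq {y | face G y c = face G l.1 c ∧ y.1 = l.1.1} ?_ h5 ⟨rfl, rfl⟩).2
  intro k' hk' x hx
  have e : face G x c = face G k'.1 c := face_of_col_eq hk' hx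
  simp only [Set.mem_ofPred_eq, e]
  refine and_congr_right fun e' => ?_
  rw [ht k' hk' e', ← hx, col_fst]

lemma isMelonicOrdering_append_singleton (κ : Fin 4 → (White b ≃ Black b)) (ls : List (Line b))
    (l : Line b) : IsMelonicOrdering κ (ls ++ [l]) ↔
      IsMelonicOrdering κ ls ∧ IsDipole (ls.foldl contract κ) 4 l := by
  induction ls generalizing κ with
  | nil => simp [IsMelonicOrdering]
  | cons k ls ih => simp [IsMelonicOrdering, ih, and_assoc]

/-- A line is a `4`-dipole if its ends are joined in all the colours but one. -/
lemma isDipole_four_iff (κ : Fin 4 → (White b ≃ Black b)) (l : Line b) :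
    IsDipole κ 4 l ↔ ∃ d, ∀ c, κ c l.1 = l.2 ↔ c ≠ d := by
  unfold IsDipole
  constructor
  · intro h
    have h1 : (Finset.univ.filter fun c => ¬ κ c l.1 = l.2).card = 1 := by
      have := Finset.card_filter_add_card_filter_not (s := Finset.univ) fun c => κ c l.1 = l.2
      simp only [Finset.card_univ, Fintype.card_fin] at this
      omega
    obtain ⟨d, hd⟩ := Finset.card_eq_one.1 h1
    refine ⟨d, fun c => ?_⟩
    have := Finset.ext_iff.1 hd c
    simp only [Finset.mem_filter, Finset.mem_univ, true_and, Finset.mem_singleton] at this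
    rw [ne_eq, ← this, not_not]
  · rintro ⟨d, hd⟩
    have : (Finset.univ.filter fun c => κ c l.1 = l.2) = Finset.univ.erase d := by
      ext c; simp [hd]
    rw [this]; simp

section Connected

variable (hG : G.Connected) (hv : G.NonVacuum)

include hG hv

/-- The lines of a melonic ordering are melonic, and preceded by their children. -/
lemma isMelonic_of_isMelonicOrdering {ls : List (Line b)} (hnd : ls.Nodup)
    (hls : ∀ l ∈ ls, l ∈ G.lines) (ho : IsMelonicOrdering (col b) ls) :
    ∀ l ∈ ls, (∃ d, IsMelonic G l d) ∧ ∀ k, IsChild G k l → k ∈ ls := by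
  induction ls using List.reverseRecOn with
  | nil => simp
  | append_singleton ls l ih =>
    have hnd' : ls.Nodup := hnd.of_append_left
    have hl : l ∈ G.lines := hls l (by simp)
    have hlls : l ∉ ls := fun h => (List.nodup_append.1 hnd).2.2 l h l (by simp) rfl
    have hls' : ∀ l ∈ ls, l ∈ G.lines := fun l' h => hls l' (by simp [h])
    rw [isMelonicOrdering_append_singleton, isDipole_four_iff] at ho
    have ih := ih hnd' hls' ho.1
    obtain ⟨-, d, hd⟩ := ho
    have hface : ∀ c, c ≠ d → ∀ y, face G y c = face G l.1 c → y = l.1 ∨ ∃ l' ∈ ls, l'.1 = y :=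
      fun c hc => (contractList_eq_iff hnd' hls' hl hlls c).1 ((hd c).2 hc)
    have hprev : ∀ c, c ≠ d → ∀ k ∈ G.lines, face G k.1 c = face G l.1 c → k ≠ l → k ∈ ls := by
      intro c hc k hk e hkl
      rcases hface c hc _ e with h | ⟨l', h, h'⟩
      · exact absurd (line_eq_of_white hk hl h) hkl
      · rwa [line_eq_of_white (hls' l' h) hk h'] at h
    have hm : IsMelonic G l d := by
      refine .mk hl (fun c hc y hy => ?_) fun c hc k hk e hkl => ?_
      · rcases hface c hc y hy with rfl | ⟨l', h, h'⟩
        · exact ⟨l, hl, rfl⟩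
        · exact ⟨l', hls' l' h, h'⟩
      · obtain ⟨⟨d', hd'⟩, h2⟩ := ih k (hprev c hc k hk e hkl)
        by_cases hdc : c = d'
        · rwa [hdc]
        · exact absurd (h2 l ⟨d', c, hd', hdc, hl, Ne.symm hkl, e.symm⟩) hlls
    intro l' hl'
    rcases List.mem_append.1 hl' with h | h
    · exact ⟨(ih l' h).1, fun k hk => List.mem_append_left _ ((ih l' h).2 k hk)⟩
    · obtain rfl : l' = l := by simpa using h
      refine ⟨⟨d, hm⟩, fun k hk => List.mem_append_left _ ?_⟩
      obtain ⟨d', c, h1, h2, h3, h4, h5⟩ := hk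
      obtain rfl := h1.colour_unique hG hv hm
      exact hprev c h2 k h3 h5 h4

/-- A set of melonic lines containing the children of its elements has a melonic ordering. -/
lemma exists_isMelonicOrdering (H : Finset (Line b)) (hm : ∀ l ∈ H, ∃ d, IsMelonic G l d)
    (hc : ∀ l ∈ H, ∀ k, IsChild G k l → k ∈ H) :
    ∃ ls : List (Line b), ls.Nodup ∧ ls.toFinset = H ∧ IsMelonicOrdering (col b) ls := by
  induction hn : H.card generalizing H with
  | zero => exact ⟨[], by simp, by simp [Finset.card_eq_zero.1 hn], trivial⟩
  | succ N ih =>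
    have hne : H.Nonempty := by rw [← Finset.card_pos]; omega
    obtain ⟨k, hk, hmax⟩ : ∃ k ∈ H, ∀ l ∈ H, ¬ IsChild G k l := by
      have hirr : Std.Irrefl (Relation.TransGen (IsChild G)) :=
        (wellFounded_isChild hG hv).transGen.irrefl
      have : Std.Irrefl (Function.swap (Relation.TransGen (IsChild G))) :=
        ⟨fun a h => hirr.irrefl a h⟩
      have : IsTrans _ (Function.swap (Relation.TransGen (IsChild G))) :=
        ⟨fun a b c h h' => Relation.TransGen.trans h' h⟩
      have hwf := Finite.wellFounded_of_trans_of_irrefl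
        (Function.swap (Relation.TransGen (IsChild G)))
      obtain ⟨k, hk, h⟩ := hwf.has_min (H : Set (Line b)) hne
      exact ⟨k, hk, fun l hl h' => h l hl (.single h')⟩
    obtain ⟨ls, hnd, hls, ho⟩ := ih (H.erase k) (fun l hl => hm l (Finset.mem_of_mem_erase hl))
      (fun l hl k' hk' => Finset.mem_erase.2
        ⟨fun e => hmax l (Finset.mem_of_mem_erase hl) (e ▸ hk'),
          hc l (Finset.mem_of_mem_erase hl) k' hk'⟩)
      (by rw [Finset.card_erase_of_mem hk]; omega)
    have hmem : ∀ l, l ∈ ls ↔ l ≠ k ∧ l ∈ H := by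
      intro l; rw [← List.mem_toFinset, hls, Finset.mem_erase]
    have hlsG : ∀ l ∈ ls, l ∈ G.lines := fun l hl => by
      obtain ⟨d, hd⟩ := hm l ((hmem l).1 hl).2; exact hd.mem
    obtain ⟨d, hd⟩ := hm k hk
    have hkls : k ∉ ls := fun h => ((hmem k).1 h).1 rfl
    refine ⟨ls ++ [k], ?_, ?_, ?_⟩
    · rw [List.nodup_append]
      refine ⟨hnd, by simp, fun a ha b hb => ?_⟩
      obtain rfl : b = k := by simpa using hb
      rintro rfl; exact hkls ha
    · ext l; by_cases h : l = k <;> simp [hmem, h, hk]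
    · rw [isMelonicOrdering_append_singleton, isDipole_four_iff]
      refine ⟨ho, d, fun c => ?_⟩
      change contractList ls c k.1 = k.2 ↔ _
      rw [contractList_eq_iff hnd hlsG hd.mem hkls c]
      constructor
      · rintro h rfl
        obtain ⟨y, hy, hy'⟩ := exists_not_isMelonic hG hv k.1 c
        rcases h y hy with rfl | ⟨l, hl, rfl⟩
        · exact hy' k hd.mem rfl hd
        · obtain ⟨d', hd'⟩ := hm l ((hmem l).1 hl).2
          refine hmax l ((hmem l).1 hl).2 ⟨d', c, hd', ?_, hd.mem, ((hmem l).1 hl).1.symm, hy.symm⟩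
          rintro rfl
          exact hy' l hd'.mem rfl hd'
      · intro hcd y hy
        obtain ⟨l, hl, rfl⟩ := hd.closed hcd y hy
        by_cases hlk : l = k
        · exact Or.inl (by rw [hlk])
        · exact Or.inr ⟨l, (hmem l).2 ⟨hlk, hc k hk l ⟨d, c, hd, hcd, hl, hlk, hy⟩⟩, rfl⟩

/-- The melopoles of a connected non-vacuum graph are the trees of its melonic lines. -/
theorem isMelopole_iff (H : Finset (Line b)) :
    G.IsMelopole H ↔ ∃ l d, IsMelonic G l d ∧ melonTree G l = H := by
  classical
  constructor
  · rintro ⟨hHG, ⟨hne, hcon⟩, -, ls, hnd, rfl, ho⟩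
    simp only [List.mem_toFinset] at hcon
    have hlsG : ∀ l ∈ ls, l ∈ G.lines := fun l hl => hHG (List.mem_toFinset.2 hl)
    have hmel := isMelonic_of_isMelonicOrdering hG hv hnd hlsG ho
    obtain ⟨ls', r, rfl⟩ : ∃ ls' r, ls = ls' ++ [r] := by
      rcases List.eq_nil_or_concat ls with rfl | ⟨ls', r, h⟩
      · simp at hne
      · exact ⟨ls', r, by simpa using h⟩
    have hr : r ∈ ls' ++ [r] := by simp
    obtain ⟨d, hd⟩ := (hmel r hr).1
    -- the last line of a melonic ordering is not inserted on another one
    have hroot : ∀ l ∈ ls' ++ [r], ¬ IsChild G r l := by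
      intro l hl hrl
      rcases List.mem_append.1 hl with h | h
      · have := (isMelonic_of_isMelonicOrdering hG hv hnd.of_append_left
          (fun l hl => hlsG l (List.mem_append_left _ hl))
          ((isMelonicOrdering_append_singleton _ _ _).1 ho).1 l h).2 r hrl
        exact (List.nodup_append.1 hnd).2.2 r this r (by simp) rfl
      · obtain rfl : l = r := by simpa using h
        obtain ⟨_, _, _, _, _, h, _⟩ := hrl
        exact h rfl
    refine ⟨r, d, hd, Finset.Subset.antisymm ?_ ?_⟩
    · intro k hk
      rw [List.mem_toFinset]
      refine Relation.ReflTransGen.head_induction_on (mem_melonTree.1 hk).2 hr ?_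
      exact fun {k k'} h _ ih => (hmel k' ih).2 k h
    · intro l hl
      rw [List.mem_toFinset] at hl
      have hstep : ∀ k k', k ∈ melonTree G r →
          (∃ c f, IsInternalFace (ls' ++ [r]).toFinset c f ∧ k ∈ f ∧ k' ∈ f) →
          k' ∈ melonTree G r := by
        rintro k k' hk ⟨c, f, hf, hkf, hkf'⟩
        have hin : ∀ p d c, p ∈ melonTree G r → IsMelonic G p d → c ≠ d →
            k' ∈ G.lines → face G k'.1 c = face G p.1 c → k' ∈ melonTree G r := by
          intro p d c hp hpd hcd hk' e
          by_cases h : k' = p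
          · exact h ▸ hp
          · exact mem_melonTree.2
              ⟨hk', .head ⟨d, c, hpd, hcd, hk', h, e⟩ (mem_melonTree.1 hp).2⟩
        have hfG : f ⊆ G.lines := hf.1.trans hHG
        have e := hf.face_eq hHG hkf hkf'
        obtain ⟨d', hd'⟩ := (hmel k (List.mem_toFinset.1 (hf.1 hkf))).1
        by_cases hcd : c = d'
        · subst hcd
          obtain ⟨y, hy, hy'⟩ := exists_not_isMelonic hG hv k.1 c
          obtain ⟨p, hpf, rfl⟩ := exists_line_of_face_eq hfG hf.2.1.2 hkf hy
          have hpls := List.mem_toFinset.1 (hf.1 hpf)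
          obtain ⟨d'', hd''⟩ := (hmel p hpls).1
          have hne : c ≠ d'' := by rintro rfl; exact hy' p hd''.mem rfl hd''
          have hkp : IsChild G k p := ⟨d'', c, hd'', hne, hd'.mem,
            by rintro rfl; exact hy' k hd'.mem rfl hd', hy.symm⟩
          rcases Relation.ReflTransGen.cases_head (mem_melonTree.1 hk).2 with rfl | ⟨q, hq, hqr⟩
          · exact absurd hkp (hroot p hpls)
          · obtain rfl := hkp.parent_unique hG hv hq
            exact hin p d'' c (mem_melonTree.2 ⟨hd''.mem, hqr⟩) hd'' hne (hfG hkf')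
              (e.trans hy.symm)
        · exact hin k d' c hk hd' hcd (hfG hkf') e
      have := hcon r hr l hl
      induction this with
      | refl => exact self_mem_melonTree hd.mem
      | @tail k k' _ h ih =>
        obtain ⟨c, f, hf, h1, h2⟩ := h
        exact hstep k k' (ih (List.mem_toFinset.1 (hf.1 h1))) ⟨c, f, hf, h1, h2⟩
  · rintro ⟨l, d, hl, rfl⟩
    have hd : ∀ k ∈ melonTree G l, ∃ d, IsMelonic G k d := by
      intro k hk
      rcases Relation.ReflTransGen.cases_head (mem_melonTree.1 hk).2 with rfl | ⟨q, hq, -⟩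
      · exact ⟨d, hl⟩
      · exact hq.isMelonic
    have hdown : ∀ p ∈ melonTree G l, ∀ k, IsChild G k p → k ∈ melonTree G l := by
      intro p hp k hk
      exact mem_melonTree.2 ⟨hk.isMelonic.choose_spec.mem, .head hk (mem_melonTree.1 hp).2⟩
    refine ⟨melonTree_subset l, ⟨⟨l, self_mem_melonTree hl.mem⟩, ?_⟩, ⟨l.1.1, ?_⟩,
      exists_isMelonicOrdering hG hv _ hd hdown⟩
    · set S : Line b → Line b → Prop :=
        fun k k' => ∃ c f, IsInternalFace (melonTree G l) c f ∧ k ∈ f ∧ k' ∈ f with hS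
      have hsymm : Std.Symm S := ⟨fun k k' ⟨c, f, h1, h2, h3⟩ => ⟨c, f, h1, h3, h2⟩⟩
      have key : ∀ k ∈ melonTree G l, Relation.ReflTransGen S k l := by
        intro k hk
        refine Relation.ReflTransGen.head_induction_on (mem_melonTree.1 hk).2 .refl ?_
        intro k p hkp hp ih
        refine .head ?_ ih
        obtain ⟨d', c, h1, h2, h3, h4, h5⟩ := hkp
        obtain ⟨f, hf, hf'⟩ := exists_isInternalFace (melonTree_subset l) (c := c) (w := p.1)
          (fun y hy => exists_mem_melonTree hl (mem_melonTree.2 ⟨h1.mem, hp⟩)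
            (fun e => by subst e; rwa [hl.colour_unique hG hv h1]) hy)
        exact ⟨c, f, hf, hf' k h3 h5, hf' p h1.mem rfl⟩
      intro k hk k' hk'
      exact (key k hk).trans (Std.Symm.symm (r := Relation.ReflTransGen S) _ _ (key k' hk'))
    · intro k hk
      have h1 : k.1.1 = l.1.1 := by
        refine Relation.ReflTransGen.head_induction_on (mem_melonTree.1 hk).2 rfl ?_
        exact fun {k p} h _ ih => h.vertex_eq.trans ih
      obtain ⟨d', hd'⟩ := hd k hk
      exact ⟨h1, hd'.tadpole ▸ h1⟩

variable (G) in
open Classical in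
/-- The melonic lines of `G`. -/
def melonicLines : Finset (Line b) := G.lines.filter fun l => ∃ d, IsMelonic G l d

omit hG hv in
lemma mem_melonicLines {l : Line b} : l ∈ melonicLines G ↔ ∃ d, IsMelonic G l d := by
  classical
  simp only [melonicLines, Finset.mem_filter, and_iff_right_iff_imp]
  rintro ⟨d, hd⟩; exact hd.mem

omit hG hv in
lemma melonicLines_subset : melonicLines G ⊆ G.lines := fun l hl => by
  obtain ⟨d, hd⟩ := mem_melonicLines.1 hl; exact hd.mem

/-- Every set of melopoles is a meloforest, so the sum over the meloforests is a sum over the sets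
of melonic lines. -/
theorem sum_meloforests {α : Type*} [AddCommMonoid α] (g : Finset (Finset (Line b)) → α) :
    ∑ M ∈ G.meloforests, g M =
      ∑ A ∈ (melonicLines G).powerset, g (A.image (melonTree G)) := by
  classical
  symm
  refine Finset.sum_bij (fun A _ => A.image (melonTree G)) ?_ ?_ ?_ (fun _ _ => rfl)
  · intro A hA
    rw [Finset.mem_powerset] at hA
    have hpol : ∀ H ∈ A.image (melonTree G), ∃ l d, IsMelonic G l d ∧ melonTree G l = H := by
      intro H hH
      obtain ⟨l, hl, rfl⟩ := Finset.mem_image.1 hH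
      obtain ⟨d, hd⟩ := mem_melonicLines.1 (hA hl)
      exact ⟨l, d, hd, rfl⟩
    simp only [FeynmanGraph.meloforests, Finset.mem_filter, Finset.mem_powerset]
    refine ⟨fun H hH => ?_, fun H hH => (isMelopole_iff hG hv H).2 (hpol H hH), ?_⟩
    · obtain ⟨l, d, hd, rfl⟩ := hpol H hH
      exact Finset.mem_powerset.2 (melonTree_subset l)
    · intro H hH H' hH'
      obtain ⟨l, d, hd, rfl⟩ := hpol H hH
      obtain ⟨l', d', hd', rfl⟩ := hpol H' hH'
      refine (melonTree_laminar hG hv l l').imp_right (Or.imp_right fun hdisj => ⟨hdisj, ?_⟩)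
      rintro c f ⟨h1, h2⟩
      obtain ⟨k, hk⟩ := h1.2.1.1
      exact Finset.disjoint_left.1 hdisj (h1.1 hk) (h2.1 hk)
  · intro A hA A' hA' h
    have hinj : Set.InjOn (melonTree G) (melonicLines G) := by
      intro l hl l' hl' e
      obtain ⟨d, hd⟩ := mem_melonicLines.1 hl
      obtain ⟨d', hd'⟩ := mem_melonicLines.1 hl'
      exact melonTree_injective hG hv hd hd' e
    rw [Finset.mem_powerset] at hA hA'
    have h' := congrArg (fun s : Finset (Finset (Line b)) => (s : Set (Finset (Line b)))) h
    simp only [Finset.coe_image] at h'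
    exact Finset.coe_injective ((hinj.image_eq_image_iff hA hA').1 h')
  · intro M hM
    simp only [FeynmanGraph.meloforests, Finset.mem_filter, Finset.mem_powerset] at hM
    refine ⟨(melonicLines G).filter fun l => melonTree G l ∈ M, ?_, ?_⟩
    · exact Finset.mem_powerset.2 (Finset.filter_subset _ _)
    · ext H
      simp only [Finset.mem_image, Finset.mem_filter]
      constructor
      · rintro ⟨l, ⟨-, h⟩, rfl⟩; exact h
      · intro hH
        obtain ⟨l, d, hd, rfl⟩ := (isMelopole_iff hG hv H).1 (hM.2.1 H hH)
        exact ⟨l, ⟨mem_melonicLines.2 ⟨d, hd⟩, hH⟩, rfl⟩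

end Connected

end Melopoles

/-! ### External faces -/

section ExternalFaces

variable {n : ℕ} {b : Fin n → Bubble} {G : FeynmanGraph b}

/-- When all the lines are contracted, `r x` is the white node at which the strand of colour `c`
through `x` begins, which only depends on the face, and `κ` joins the two ends of a strand. -/
lemma strand_start_lines (G : FeynmanGraph b) (c : Fin 4) :
    ∃ κ : White b ≃ Black b, ∃ r : White b → White b,
      (∀ l ∈ G.lines, κ l.1 = l.2) ∧
      (∀ x, face G ((col b c).symm (κ x)) c = face G x c) ∧
      (∀ x, (∀ l ∈ G.lines, l.1 ≠ x) → r x = x) ∧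
      (∀ x y, face G x c = face G y c → r x = r y) ∧
      (∀ x, (∀ l ∈ G.lines, l.2 ≠ col b c x) → κ (r x) = col b c x) := by
  obtain ⟨i2, i1, r, r1, r2, -, r4⟩ := exists_strand_start (G := G) c G.lines.toList
    (Finset.nodup_toList _) (by simp)
  simp only [Finset.mem_toList] at i2 r1 r2 r4
  exact ⟨_, r, i2, i1, r1, fun x y h => eq_of_face_eq r r2 h, r4⟩

lemma WhiteLeg.face_injective {w w' : WhiteLeg G} {c c' : Fin 4}
    (h : face G w.1 c = face G w'.1 c') : w = w' ∧ c = c' := by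
  obtain rfl := face_colour h
  obtain ⟨κ, r, -, -, r1, r2, -⟩ := strand_start_lines G c
  refine ⟨Subtype.ext ?_, rfl⟩
  rw [← r1 _ w.2, ← r1 _ w'.2, r2 _ _ h]

lemma BlackLeg.face_injective {u u' : BlackLeg G} {c c' : Fin 4}
    (h : face G ((col b c).symm u.1) c = face G ((col b c').symm u'.1) c') : u = u' ∧ c = c' := by
  obtain rfl := face_colour h
  obtain ⟨κ, r, -, -, -, r2, r4⟩ := strand_start_lines G c
  refine ⟨Subtype.ext ?_, rfl⟩
  have h1 := r4 ((col b c).symm u.1) (by simpa using u.2)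
  have h2 := r4 ((col b c).symm u'.1) (by simpa using u'.2)
  rw [Equiv.apply_symm_apply] at h1 h2
  rw [← h1, ← h2, r2 _ _ h]

/-- The external face which begins at a white leg ends at a black leg. -/
lemma WhiteLeg.exists_blackLeg (w : WhiteLeg G) (c : Fin 4) :
    ∃ u : BlackLeg G, face G ((col b c).symm u.1) c = face G w.1 c := by
  obtain ⟨κ, r, i2, i1, -⟩ := strand_start_lines G c
  refine ⟨⟨κ w.1, fun l hl h => w.2 l hl ?_⟩, i1 _⟩
  rw [← i2 l hl] at h
  exact κ.injective h

lemma BlackLeg.exists_whiteLeg (u : BlackLeg G) (c : Fin 4) :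
    ∃ w : WhiteLeg G, face G w.1 c = face G ((col b c).symm u.1) c := by
  obtain ⟨κ, r, i2, i1, r1, r2, r4⟩ := strand_start_lines G c
  have h := r4 ((col b c).symm u.1) (by simpa using u.2)
  rw [Equiv.apply_symm_apply] at h
  refine ⟨⟨κ.symm u.1, fun l hl e => u.2 l hl ?_⟩, ?_⟩
  · rw [← i2 l hl, e, Equiv.apply_symm_apply]
  · rw [← i1 (κ.symm u.1), Equiv.apply_symm_apply]

variable (G) in
open Classical in
/-- The set of the external faces of `G`. -/
def externalFaces [Fintype (Face G)] : Finset (Face G) :=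
  Finset.univ.filter fun f => ∃ (w : WhiteLeg G) (c : Fin 4), face G w.1 c = f

end ExternalFaces

/-! ### Placements -/

section Placements

variable {n : ℕ} {b : Fin n → Bubble} {G : FeynmanGraph b}

variable (G) in
/-- One step along a strand of colour `c`, through a melonic line with external colour `c`. -/
def Chain (c : Fin 4) (x y : White b) : Prop :=
  ∃ l, IsMelonic G l c ∧ col b c x = l.2 ∧ l.1 = y

lemma Chain.face_eq {c : Fin 4} {x y : White b} (h : Chain G c x y) :
    face G x c = face G y c := by
  obtain ⟨l, hl, h1, rfl⟩ := h
  exact face_of_col_eq hl.mem h1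

lemma Chain.right_unique {c : Fin 4} {x y y' : White b} (h : Chain G c x y)
    (h' : Chain G c x y') : y = y' := by
  obtain ⟨l, hl, h1, rfl⟩ := h
  obtain ⟨l', hl', h1', rfl⟩ := h'
  rw [line_eq_of_black hl.mem hl'.mem (h1.symm.trans h1')]

lemma Chain.left_unique {c : Fin 4} {x x' y : White b} (h : Chain G c x y)
    (h' : Chain G c x' y) : x = x' := by
  obtain ⟨l, hl, h1, rfl⟩ := h
  obtain ⟨l', hl', h1', h2⟩ := h'
  rw [line_eq_of_white hl'.mem hl.mem h2] at h1'
  exact (col b c).injective (h1.trans h1'.symm)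

lemma face_eq_of_chain {c : Fin 4} {x y : White b} (h : Relation.ReflTransGen (Chain G c) x y) :
    face G x c = face G y c := by
  induction h with
  | refl => rfl
  | tail _ h ih => exact ih.trans h.face_eq

variable (G) in
/-- The effect of the localization operators of the trees of the melonic lines in `A`: a strand
entering such a line by its external face is followed to the other end of this face. -/
structure IsPlacement (A : Set (Line b)) (s : White b → Fin 4 → White b) : Prop where
  /-- A strand which does not enter a line of `A` by its external face is unchanged. -/
  eq_self : ∀ x c, (∀ l ∈ A, IsMelonic G l c → col b c x ≠ l.2) → s x c = x
  /-- A strand which enters a line of `A` by its external face is continued behind it. -/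
  eq_next : ∀ x c l, l ∈ A → IsMelonic G l c → col b c x = l.2 → s x c = s l.1 c

lemma faceStep_of_mem {H : Finset (Line b)} (hH : H ⊆ G.lines) (s : White b → Fin 4 → White b)
    {c : Fin 4} {x : White b} {l : Line b} (hl : l ∈ H) (h : col b c x = l.2) :
    faceStep H s c x = s l.1 c := by
  have hex : ∃ l ∈ H, col b c x = l.2 := ⟨l, hl, h⟩
  have : hex.choose = l := line_eq_of_black (hH hex.choose_spec.1) (hH hl)
    (hex.choose_spec.2.symm.trans h)
  simp only [faceStep, dif_pos hex, this]

lemma faceStep_of_notMem {H : Finset (Line b)} (s : White b → Fin 4 → White b)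
    {c : Fin 4} {x : White b} (h : ∀ l ∈ H, col b c x ≠ l.2) : faceStep H s c x = x := by
  have : ¬ ∃ l ∈ H, col b c x = l.2 := by push Not; exact h
  simp only [faceStep, dif_neg this]

section Connected

variable (hG : G.Connected) (hv : G.NonVacuum)

include hG hv

lemma not_transGen_chain (c : Fin 4) (x : White b) : ¬ Relation.TransGen (Chain G c) x x := by
  intro hx
  obtain ⟨y, hy, hy'⟩ := exists_not_isMelonic hG hv x c
  have hmem : y ∈ {y | Relation.TransGen (Chain G c) y y} := by
    refine mem_of_face_eq _ (fun l hl z hz => ⟨fun h => ?_, fun h => ?_⟩) hy hx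
    · obtain ⟨z', h1, h2⟩ := Relation.TransGen.head'_iff.1 h
      obtain ⟨l', hl', h3, rfl⟩ := id h1
      obtain rfl := line_eq_of_black hl hl'.mem (hz.symm.trans h3)
      exact Relation.TransGen.tail'_iff.2 ⟨z, h2, h1⟩
    · obtain ⟨z', h1, h2⟩ := Relation.TransGen.tail'_iff.1 h
      obtain ⟨l', hl', h3, h4⟩ := id h2
      obtain rfl := line_eq_of_white hl'.mem hl h4
      obtain rfl : z' = z := (col b c).injective (h3.trans hz.symm)
      exact Relation.TransGen.head'_iff.2 ⟨_, h2, h1⟩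
  obtain ⟨z, -, l, hl, -, h⟩ := Relation.TransGen.tail'_iff.1 hmem
  exact hy' l hl.mem h hl

lemma wellFounded_chain (c : Fin 4) : WellFounded (Function.swap (Chain G c)) := by
  have : Std.Irrefl (Function.swap (Relation.TransGen (Chain G c))) :=
    ⟨fun a h => not_transGen_chain hG hv c a h⟩
  have : IsTrans _ (Function.swap (Relation.TransGen (Chain G c))) :=
    ⟨fun a b c h h' => Relation.TransGen.trans h' h⟩
  have hwf := Finite.wellFounded_of_trans_of_irrefl
    (Function.swap (Relation.TransGen (Chain G c)))
  have hsub : Subrelation (Function.swap (Chain G c))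
      (Function.swap (Relation.TransGen (Chain G c))) := fun h => .single h
  exact hsub.wf hwf

namespace IsPlacement

variable {A : Set (Line b)} {s : White b → Fin 4 → White b}

lemma reflTransGen (h : IsPlacement G A s) (x : White b) (c : Fin 4) :
    Relation.ReflTransGen (Chain G c) x (s x c) := by
  induction x using (wellFounded_chain hG hv c).induction with
  | _ x ih =>
    by_cases hx : ∃ l ∈ A, IsMelonic G l c ∧ col b c x = l.2
    · obtain ⟨l, h1, h2, h3⟩ := hx
      have hc : Chain G c x l.1 := ⟨l, h2, h3, rfl⟩
      rw [h.eq_next x c l h1 h2 h3]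
      exact .head hc (ih l.1 hc)
    · push Not at hx
      rw [h.eq_self x c hx]

lemma face_eq (h : IsPlacement G A s) (x : White b) (c : Fin 4) :
    face G (s x c) c = face G x c :=
  (face_eq_of_chain (h.reflTransGen hG hv x c)).symm

lemma col_ne (h : IsPlacement G A s) (x : White b) (c : Fin 4) :
    ∀ l ∈ A, IsMelonic G l c → col b c (s x c) ≠ l.2 := by
  induction x using (wellFounded_chain hG hv c).induction with
  | _ x ih =>
    by_cases hx : ∃ l ∈ A, IsMelonic G l c ∧ col b c x = l.2
    · obtain ⟨l, h1, h2, h3⟩ := hx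
      rw [h.eq_next x c l h1 h2 h3]
      exact ih l.1 ⟨l, h2, h3, rfl⟩
    · push Not at hx
      rwa [h.eq_self x c hx]

/-- Two strands which do not begin at a line of `A` are sent to different places. -/
lemma injective (h : IsPlacement G A s) {c : Fin 4} {x y : White b} (hxy : s x c = s y c)
    (hx : ∀ l ∈ A, IsMelonic G l c → l.1 ≠ x) (hy : ∀ l ∈ A, IsMelonic G l c → l.1 ≠ y) :
    x = y := by
  have key : ∀ x z, (∀ l ∈ A, IsMelonic G l c → l.1 ≠ x) → s z c = s x c →
      Relation.ReflTransGen (Chain G c) z x → z = x := by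
    intro x z hx hz hzx
    induction z using (wellFounded_chain hG hv c).induction with
    | _ z ih =>
      by_cases hzA : ∃ l ∈ A, IsMelonic G l c ∧ col b c z = l.2
      · obtain ⟨l, h1, h2, h3⟩ := hzA
        rcases Relation.ReflTransGen.cases_head hzx with rfl | ⟨z', h4, h5⟩
        · rfl
        · have h6 : Chain G c z l.1 := ⟨l, h2, h3, rfl⟩
          obtain rfl := h6.right_unique h4
          exact absurd (ih l.1 h6 (by rw [← h.eq_next z c l h1 h2 h3, hz]) h5) (hx l h1 h2)
      · push Not at hzA
        rw [h.eq_self z c hzA] at hz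
        have h1 := h.reflTransGen hG hv x c
        rw [← hz] at h1
        by_contra hne
        have h2 := (Relation.reflTransGen_iff_eq_or_transGen.1 hzx).resolve_left (Ne.symm hne)
        exact not_transGen_chain hG hv c z (h2.trans_left h1)
  have h1 := h.reflTransGen hG hv x c
  have h2 := h.reflTransGen hG hv y c
  rw [← hxy] at h2
  have hu : Relator.RightUnique (Function.swap (Chain G c)) := fun _ _ _ h h' => h.left_unique h'
  rcases Relation.ReflTransGen.total_of_right_unique hu h1.swap h2.swap with h3 | h3
  · exact (key x y hx hxy.symm h3.swap).symm
  · exact key y x hy hxy h3.swap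

end IsPlacement

/-- The operators can be applied one by one, in any order: the localization operator of the tree of
`l₀` only has an effect on the strands which enter the tree by the external face of `l₀`. -/
lemma IsPlacement.tau {A : Set (Line b)} {s : White b → Fin 4 → White b} (h : IsPlacement G A s)
    {l₀ : Line b} {d₀ : Fin 4} (hl₀ : IsMelonic G l₀ d₀) (hA : l₀ ∉ A) :
    IsPlacement G (insert l₀ A) (tau (melonTree G l₀) s) := by
  set H := melonTree G l₀ with hH
  have hHG : H ⊆ G.lines := melonTree_subset l₀
  have h0 : l₀ ∈ H := self_mem_melonTree hl₀.mem
  have hd₀ : ∀ c, IsMelonic G l₀ c → c = d₀ := fun c hc => hc.colour_unique hG hv hl₀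
  -- a strand outside the tree enters it only at the external face of its root
  have hroot : ∀ w c y, (¬ ∃ l ∈ H, l.1 = w) → face G y c = face G w c →
      ∀ l ∈ H, col b c y = l.2 → l = l₀ ∧ c = d₀ := by
    intro w c y hw e l hl hy
    by_contra hcon
    exact hw (exists_mem_melonTree hl₀ hl (fun e1 e2 => hcon ⟨e1, e2⟩)
      (e.symm.trans (face_of_col_eq (hHG hl) hy)))
  have hin : ∀ w c, (∃ l ∈ H, l.1 = w) → TGFT.tau H s w c = s w c := by
    intro w c hw; simp only [TGFT.tau, if_pos hw]
  have hout1 : ∀ w c, (¬ ∃ l ∈ H, l.1 = w) → ¬ (c = d₀ ∧ col b c (s w c) = l₀.2) →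
      TGFT.tau H s w c = s w c := by
    intro w c hw hne
    simp only [TGFT.tau, if_neg hw]
    refine Function.iterate_fixed (faceStep_of_notMem s fun l hl e => hne ?_) _
    obtain ⟨rfl, rfl⟩ := hroot w c _ hw (h.face_eq hG hv w c) l hl e
    exact ⟨rfl, e⟩
  have hout2 : ∀ w, (¬ ∃ l ∈ H, l.1 = w) → col b d₀ (s w d₀) = l₀.2 →
      TGFT.tau H s w d₀ = s l₀.1 d₀ := by
    intro w hw he
    simp only [TGFT.tau, if_neg hw]
    obtain ⟨N, hN⟩ : ∃ N, H.card = N + 1 := ⟨H.card - 1, by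
      have := Finset.card_pos.2 ⟨l₀, h0⟩; omega⟩
    have h1 : faceStep H s d₀ (s w d₀) = s l₀.1 d₀ := faceStep_of_mem hHG s h0 he
    rw [hN, Function.iterate_succ_apply, h1]
    refine Function.iterate_fixed ?_ _
    by_cases h2 : ∃ l ∈ H, col b d₀ (s l₀.1 d₀) = l.2
    · obtain ⟨l, hl, h3⟩ := h2
      have e : face G (s l₀.1 d₀) d₀ = face G w d₀ := by
        rw [h.face_eq hG hv, ← face_of_col_eq hl₀.mem he, h.face_eq hG hv]
      obtain ⟨rfl, -⟩ := hroot w d₀ _ hw e l hl h3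
      exact faceStep_of_mem hHG s hl h3
    · push Not at h2
      exact faceStep_of_notMem s h2
  constructor
  · intro x c hx
    have hx' : s x c = x := h.eq_self x c fun l hl => hx l (Set.mem_insert_of_mem _ hl)
    by_cases hw : ∃ l ∈ H, l.1 = x
    · rw [hin x c hw, hx']
    · rw [hout1 x c hw, hx']
      rintro ⟨rfl, he⟩
      rw [hx'] at he
      exact hx l₀ (Set.mem_insert _ _) hl₀ he
  · intro x c l hl hm hx
    rcases Set.mem_insert_iff.1 hl with rfl | hlA
    · obtain rfl := hd₀ c hm
      have hxs : s x c = x := h.eq_self x c fun k hk hkm e => hA <|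
        (line_eq_of_black hkm.mem hm.mem (e.symm.trans hx)) ▸ hk
      have hw : ¬ ∃ k ∈ H, k.1 = x := by
        rintro ⟨k, hk, rfl⟩
        obtain ⟨y, hy, hy'⟩ := exists_notMem_melonTree hG hv hm
        by_cases hkl : k = l
        · rw [hkl] at hx
          obtain ⟨k', hk', rfl⟩ := exists_line_of_face_eq (G := G) (f := {l}) (c := c) (l := l)
            (by simpa using hm.mem) (by simpa using hx) (by simp) hy
          rw [Finset.mem_singleton] at hk'
          exact hy' k' (by rw [hk']; exact h0) rfl
        · obtain ⟨k', hk', h1⟩ := exists_mem_melonTree hl₀ hk (fun e => absurd e hkl)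
            (hy.trans (face_of_col_eq hm.mem hx).symm)
          exact hy' k' hk' h1
      rw [hout2 x hw (by rw [hxs, hx]), hin _ _ ⟨l, h0, rfl⟩]
    · have hs : s x c = s l.1 c := h.eq_next x c l hlA hm hx
      have hll : l ≠ l₀ := fun e => hA (e ▸ hlA)
      have e : face G x c = face G l.1 c := face_of_col_eq hm.mem hx
      by_cases h1 : ∃ k ∈ H, k.1 = x <;> by_cases h2 : ∃ k ∈ H, k.1 = l.1
      · rw [hin _ _ h1, hin _ _ h2, hs]
      · rw [hin _ _ h1, hout1 _ _ h2, hs]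
        rintro ⟨rfl, he⟩
        obtain ⟨k, hk, rfl⟩ := h1
        by_cases hkl : k = l₀
        · rw [hkl] at hx
          -- the strand would return to the root through melonic lines
          have h3 : Chain G c l₀.1 l.1 := ⟨l, hm, hx, rfl⟩
          have h4 : Chain G c (s l.1 c) l₀.1 := ⟨l₀, hl₀, he, rfl⟩
          exact not_transGen_chain hG hv c _
            (Relation.TransGen.head'_iff.2 ⟨_, h3, (h.reflTransGen hG hv l.1 c).tail h4⟩)
        · exact h2 (exists_mem_melonTree hl₀ hk (fun e => absurd e hkl) e.symm)
      · obtain ⟨k, hk, h3⟩ := h2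
        obtain rfl := line_eq_of_white (hHG hk) hm.mem h3
        exact absurd (exists_mem_melonTree hl₀ hk (fun e => absurd e hll) e) h1
      · by_cases h3 : c = d₀ ∧ col b c (s x c) = l₀.2
        · obtain ⟨rfl, h3⟩ := h3
          rw [hout2 _ h1 h3, hout2 _ h2 (hs ▸ h3)]
        · rw [hout1 _ _ h1 h3, hout1 _ _ h2 (hs ▸ h3), hs]

/-- The product of the localization operators of a meloforest, in any order. -/
theorem isPlacement_tauProd {A : Finset (Line b)} (hA : A ⊆ melonicLines G) :
    IsPlacement G (A : Set (Line b)) (tauProd (A.image (melonTree G))) := by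
  classical
  have key : ∀ Ls : List (Finset (Line b)), Ls.Nodup → (∀ H ∈ Ls, ∃ l ∈ A, melonTree G l = H) →
      IsPlacement G {l | l ∈ A ∧ melonTree G l ∈ Ls} (Ls.foldr TGFT.tau fun w _ => w) := by
    intro Ls
    induction Ls with
    | nil => intro _ _; exact ⟨fun _ _ _ => rfl, fun x c l hl => by simp at hl⟩
    | cons H Ls ih =>
      intro hnd hLs
      obtain ⟨l, hl, rfl⟩ := hLs H (by simp)
      obtain ⟨d, hd⟩ := mem_melonicLines.1 (hA hl)
      have hnd' := List.nodup_cons.1 hnd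
      have := (ih hnd'.2 fun H hH => hLs H (List.mem_cons_of_mem _ hH)).tau hG hv hd
        fun h => hnd'.1 h.2
      convert this using 1
      swap
      · rfl
      ext k
      simp only [List.mem_cons, Set.mem_ofPred_eq, Set.mem_insert_iff]
      constructor
      · rintro ⟨h1, h2 | h2⟩
        · obtain ⟨d', hd'⟩ := mem_melonicLines.1 (hA h1)
          exact Or.inl (melonTree_injective hG hv hd' hd h2)
        · exact Or.inr ⟨h1, h2⟩
      · rintro (rfl | ⟨h1, h2⟩)
        · exact ⟨hl, Or.inl rfl⟩
        · exact ⟨h1, Or.inr h2⟩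
  have h := key (A.image (melonTree G)).toList (Finset.nodup_toList _) (by simp)
  convert h using 1
  swap
  · rfl
  ext l
  simp only [Finset.mem_toList, Finset.mem_image, Set.mem_ofPred_eq, Finset.mem_coe]
  exact ⟨fun h => ⟨h, l, h, rfl⟩, fun h => h.1⟩

end Connected

end Placements

/-! ### Products of absolutely convergent series -/

section Products

lemma hasSum_pi_fin {R κ : Type*} [NormedField R] [CompleteSpace R] (N : ℕ) (f : Fin N → κ → R)
    (hf : ∀ i, Summable fun k => ‖f i k‖) :
    Summable (fun P : Fin N → κ => ‖∏ i, f i (P i)‖) ∧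
      HasSum (fun P : Fin N → κ => ∏ i, f i (P i)) (∏ i, ∑' k, f i k) := by
  induction N with
  | zero =>
    refine ⟨(hasSum_fintype _).summable, ?_⟩
    convert hasSum_fintype (fun P : Fin 0 → κ => ∏ i, f i (P i)) using 1
    simp
  | succ N ih =>
    obtain ⟨h1, h2⟩ := ih (fun i => f i.succ) fun i => hf i.succ
    let e : κ × (Fin N → κ) ≃ (Fin (N + 1) → κ) := Fin.consEquiv fun _ => κ
    have he : ∀ q : κ × (Fin N → κ), ∏ i, f i (e q i) = f 0 q.1 * ∏ i, f (Fin.succ i) (q.2 i) := by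
      intro q; simp [e, Fin.prod_univ_succ, Fin.consEquiv]
    have h3 := Summable.mul_norm (hf 0) h1
    constructor
    · rw [← e.summable_iff]
      exact h3.congr fun q => by simp only [Function.comp_apply, he]
    · rw [← e.hasSum_iff, Fin.prod_univ_succ]
      have h4 := (hf 0).of_norm.hasSum.mul h2 h3.of_norm
      exact h4.congr_fun fun q => by simp only [Function.comp_apply, he]

/-- A finite product of absolutely convergent series. -/
lemma hasSum_pi {R κ ι : Type*} [NormedField R] [CompleteSpace R] [Fintype ι] (f : ι → κ → R)
    (hf : ∀ i, Summable fun k => ‖f i k‖) :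
    Summable (fun P : ι → κ => ‖∏ i, f i (P i)‖) ∧
      HasSum (fun P : ι → κ => ∏ i, f i (P i)) (∏ i, ∑' k, f i k) := by
  let e := Fintype.equivFin ι
  obtain ⟨h1, h2⟩ := hasSum_pi_fin (Fintype.card ι) (fun i => f (e.symm i)) fun i => hf _
  have he : ∀ P : Fin (Fintype.card ι) → κ,
      ∏ i, f i (e.symm.arrowCongr (Equiv.refl κ) P i) = ∏ i, f (e.symm i) (P i) := by
    intro P
    rw [← e.symm.prod_comp]; simp
  constructor
  · rw [← (e.symm.arrowCongr (Equiv.refl κ)).summable_iff]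
    exact h1.congr fun P => by simp only [Function.comp_apply, he]
  · rw [← (e.symm.arrowCongr (Equiv.refl κ)).hasSum_iff, ← e.symm.prod_comp]
    exact h2.congr_fun fun P => by simp only [Function.comp_apply, he]

end Products

/-! ### Fourier expansion of the propagator -/

section Propagator

/-- The fundamental character of `U(1)`. -/
def chr (x : U1) : ℂ := AddCircle.toCircle x

lemma chr_zero : chr 0 = 1 := by simp [chr]

lemma chr_add (x y : U1) : chr (x + y) = chr x * chr y := by simp [chr, AddCircle.toCircle_add]

lemma chr_sum {ι : Type*} (s : Finset ι) (f : ι → U1) :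
    chr (∑ i ∈ s, f i) = ∏ i ∈ s, chr (f i) := by
  classical
  induction s using Finset.induction_on with
  | empty => simp [chr_zero]
  | insert a s ha ih => rw [Finset.sum_insert ha, Finset.prod_insert ha, chr_add, ih]

lemma norm_chr (x : U1) : ‖chr x‖ = 1 := Circle.norm_coe _

lemma chr_neg (x : U1) : chr (-x) = starRingEnd ℂ (chr x) := by
  rw [chr, AddCircle.toCircle_neg]; exact Circle.coe_inv_eq_conj _

lemma fourier_eq_chr (p : ℤ) (x : U1) : fourier p x = chr (p • x) := fourier_apply

lemma continuous_chr : Continuous chr := by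
  have h : chr = fourier (T := 2 * π) 1 := by ext x; rw [fourier_eq_chr, one_smul]
  rw [h]; exact (fourier 1).continuous

lemma eq_zero_of_chr_eq_one {x : U1} (h : chr x = 1) : x = 0 := by
  have : AddCircle.toCircle x = AddCircle.toCircle (0 : U1) := by
    rw [AddCircle.toCircle_zero]; exact Circle.ext h
  exact AddCircle.injective_toCircle Real.two_pi_pos.ne' this

/-- Orthogonality of the characters. -/
lemma integral_chr {V : Type*} [AddCommGroup V] [MeasurableSpace V] [MeasurableAdd V]
    (μ : Measure V) [IsProbabilityMeasure μ] [μ.IsAddRightInvariant] (L : V →+ U1)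
    [Decidable (∀ θ, L θ = 0)] :
    ∫ θ, chr (L θ) ∂μ = if ∀ θ, L θ = 0 then 1 else 0 := by
  split_ifs with h
  · simp [h, chr_zero]
  · push Not at h
    obtain ⟨θ₀, h0⟩ := h
    have h1 := integral_add_right_eq_self (μ := μ) (fun θ => chr (L θ)) θ₀
    simp only [map_add, chr_add, integral_mul_const] at h1
    have h2 : chr (L θ₀) - 1 ≠ 0 := fun e => h0 (eq_zero_of_chr_eq_one (sub_eq_zero.1 e))
    have h3 : (∫ θ, chr (L θ) ∂μ) * (chr (L θ₀) - 1) = 0 := by rw [mul_sub, h1, mul_one, sub_self]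
    exact (mul_eq_zero.1 h3).resolve_right h2

lemma summable_exp_neg_mul_sq {α : ℝ} (hα : 0 < α) :
    Summable fun p : ℤ => Real.exp (-α * (p : ℝ) ^ 2) := by
  have h := HasSum.summable (hasSum_jacobiTheta₂_term 0 (τ := Complex.I * (α / π : ℝ))
    (by simp; positivity))
  refine h.norm.congr fun p => ?_
  rw [norm_jacobiTheta₂_term]
  congr 1
  simp
  field_simp

lemma hasSum_heatKernel {α : ℝ} (hα : 0 < α) (θ : U1) :
    HasSum (fun p : ℤ => (Real.exp (-α * (p : ℝ) ^ 2) : ℂ) * chr (p • θ)) (heatKernel α θ) := by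
  have hs : Summable fun p : ℤ => (Real.exp (-α * (p : ℝ) ^ 2) : ℂ) * chr (p • θ) := by
    refine Summable.of_norm ((summable_exp_neg_mul_sq hα).congr fun p => ?_)
    rw [norm_mul, norm_chr, mul_one, Complex.norm_real, Real.norm_of_nonneg (Real.exp_nonneg _)]
  convert hs.hasSum using 1
  apply Complex.ext
  · rw [Complex.ofReal_re, Complex.re_tsum hs, heatKernel]
    exact tsum_congr fun p => by rw [Complex.re_ofReal_mul, fourier_eq_chr]
  · rw [Complex.ofReal_im]
    symm
    rw [← Complex.conj_eq_iff_im, Complex.conj_tsum, ← (Equiv.neg ℤ).tsum_eq]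
    exact tsum_congr fun p => by
      rw [map_mul, Complex.conj_ofReal, ← chr_neg]; simp

/-- The Fourier coefficients of the propagator. Gauge invariance restricts them to the momenta of
sum zero. -/
def propCoeff (m a : ℝ) (P : Fin 4 → ℤ) : ℝ :=
  if ∑ c, P c = 0 then
    Real.exp (-a * (m ^ 2 + ∑ c, (P c : ℝ) ^ 2)) / (m ^ 2 + ∑ c, (P c : ℝ) ^ 2)
  else 0

lemma propCoeff_nonneg (m a : ℝ) (P : Fin 4 → ℤ) : 0 ≤ propCoeff m a P := by
  unfold propCoeff; split_ifs <;> positivity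

variable {m : ℝ} (hm : 0 < m)

include hm

lemma propCoeff_le {a : ℝ} (ha : 0 < a) (P : Fin 4 → ℤ) :
    propCoeff m a P ≤ (m ^ 2)⁻¹ * ∏ c, Real.exp (-a * (P c : ℝ) ^ 2) := by
  have h0 : (0 : ℝ) ≤ ∑ c, (P c : ℝ) ^ 2 := Finset.sum_nonneg fun c _ => sq_nonneg _
  have hm2 : 0 < m ^ 2 := by positivity
  unfold propCoeff
  split_ifs with h
  · rw [← Real.exp_sum, ← Finset.mul_sum, div_eq_inv_mul]
    refine mul_le_mul (inv_anti₀ hm2 (by linarith)) (Real.exp_le_exp.2 ?_) (Real.exp_nonneg _)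
      (by positivity)
    nlinarith
  · positivity

lemma summable_propCoeff {a : ℝ} (ha : 0 < a) : Summable (propCoeff m a) := by
  have h := (hasSum_pi (ι := Fin 4) (fun _ (p : ℤ) => Real.exp (-a * (p : ℝ) ^ 2))
    fun _ => (summable_exp_neg_mul_sq ha).norm).2.summable
  exact Summable.of_nonneg_of_le (propCoeff_nonneg m a) (propCoeff_le hm ha) (h.mul_left _)

omit hm in
lemma integral_heatKernel_prod {α : ℝ} (hα : 0 < α) (g g' : Fin 4 → U1) :
    HasSum (fun P : Fin 4 → ℤ => if ∑ c, P c = 0 then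
        (Real.exp (-α * ∑ c, (P c : ℝ) ^ 2) : ℂ) * chr (∑ c, P c • (g c - g' c)) else 0)
      (∫ h : U1, ∏ c, heatKernel α (g c + h - g' c) ∂haar : ℝ) := by
  have hs := hasSum_pi (ι := Fin 4) (fun _ (p : ℤ) => Real.exp (-α * (p : ℝ) ^ 2))
    fun _ => (summable_exp_neg_mul_sq hα).norm
  have h1 : ∀ h : U1, HasSum (fun P : Fin 4 → ℤ =>
      (Real.exp (-α * ∑ c, (P c : ℝ) ^ 2) : ℂ) * chr (∑ c, P c • (g c - g' c)) *
        chr ((∑ c, P c) • h)) ((∏ c, heatKernel α (g c + h - g' c) : ℝ) : ℂ) := by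
    intro h
    have h2 := (hasSum_pi (ι := Fin 4)
      (fun c (p : ℤ) => (Real.exp (-α * (p : ℝ) ^ 2) : ℂ) * chr (p • (g c + h - g' c)))
      fun c => by
        refine (summable_exp_neg_mul_sq hα).congr fun p => ?_
        rw [norm_mul, norm_chr, mul_one, Complex.norm_real,
          Real.norm_of_nonneg (Real.exp_nonneg _)]).2
    simp only [(hasSum_heatKernel hα _).tsum_eq] at h2
    push_cast
    refine h2.congr_fun fun P => ?_
    rw [Finset.prod_mul_distrib, ← chr_sum, mul_assoc, ← chr_add, Finset.mul_sum, Finset.sum_smul,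
      ← Finset.sum_add_distrib]
    congr 1
    · push_cast; rw [Complex.exp_sum]
    · congr 1
      refine Finset.sum_congr rfl fun c _ => ?_
      rw [← smul_add]; congr 1; abel
  rw [← integral_complex_ofReal]
  simp_rw [← fun h => (h1 h).tsum_eq]
  have h3 := hasSum_integral_of_summable_integral_norm (μ := haar) (F := fun (P : Fin 4 → ℤ) h =>
    (Real.exp (-α * ∑ c, (P c : ℝ) ^ 2) : ℂ) * chr (∑ c, P c • (g c - g' c)) *
        chr ((∑ c, P c) • h))
    (fun P => by
      refine Integrable.const_mul ?_ _
      refine (ContinuousMap.mk (fun h : U1 => chr ((∑ c, P c) • h)) ?_).continuous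
        |>.integrable_of_hasCompactSupport (HasCompactSupport.of_compactSpace _)
      exact continuous_chr.comp (continuous_zsmul _))
    (by
      refine hs.2.summable.congr fun P => ?_
      simp only [norm_mul, norm_chr, mul_one, Complex.norm_real,
          Real.norm_of_nonneg (Real.exp_nonneg _), integral_const, probReal_univ, one_smul]
      rw [Finset.mul_sum, Real.exp_sum])
  refine h3.congr_fun fun P => ?_
  rw [integral_const_mul]
  classical
  have h4 := integral_chr haar (zsmulAddGroupHom (∑ c, P c) : U1 →+ U1)
  simp only [zsmulAddGroupHom_apply] at h4
  rw [h4]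
  by_cases h5 : ∑ c, P c = 0
  · simp [h5]
  · have h6 : ¬ ∀ θ : U1, (∑ c, P c) • θ = 0 := by
      intro h7
      have := fourier_add_half_inv_index (T := 2 * π) h5 Real.two_pi_pos 0
      simp [h7] at this
      norm_num at this
    simp [h5, h6]

/-- The Fourier expansion of the propagator. -/
theorem hasSum_propagator {a : ℝ} (ha : 0 < a) (g g' : Fin 4 → U1) :
    HasSum (fun P : Fin 4 → ℤ => (propCoeff m a P : ℂ) * chr (∑ c, P c • (g c - g' c)))
      (propagator m a g g' : ℂ) := by
  have hpos : ∀ P : Fin 4 → ℤ, 0 < m ^ 2 + ∑ c, (P c : ℝ) ^ 2 := fun P => by positivity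
  have hint : ∀ P : Fin 4 → ℤ, IntegrableOn
      (fun α => Real.exp (-(m ^ 2 + ∑ c, (P c : ℝ) ^ 2) * α)) (Set.Ioi a) := fun P =>
    integrableOn_exp_mul_Ioi (by linarith [hpos P]) a
  let F : (Fin 4 → ℤ) → ℝ → ℂ := fun P α => (if ∑ c, P c = 0 then chr (∑ c, P c • (g c - g' c))
    else 0) * (Real.exp (-(m ^ 2 + ∑ c, (P c : ℝ) ^ 2) * α) : ℝ)
  have hval : ∀ P : Fin 4 → ℤ,
      ∫ α in Set.Ioi a, Real.exp (-(m ^ 2 + ∑ c, (P c : ℝ) ^ 2) * α) =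
        Real.exp (-a * (m ^ 2 + ∑ c, (P c : ℝ) ^ 2)) / (m ^ 2 + ∑ c, (P c : ℝ) ^ 2) := by
    intro P
    rw [integral_exp_mul_Ioi (by linarith [hpos P]), neg_div_neg_eq]
    congr 2; ring
  have h := hasSum_integral_of_summable_integral_norm (μ := volume.restrict (Set.Ioi a)) (F := F)
    (fun P => (hint P).ofReal.const_mul _) (by
      refine (summable_propCoeff hm ha).congr fun P => ?_
      simp only [F, norm_mul, Complex.norm_real, Real.norm_of_nonneg (Real.exp_nonneg _),
        integral_const_mul, hval, propCoeff]
      split_ifs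
      · rw [norm_chr, one_mul]
      · simp)
  have h1 : ∫ α in Set.Ioi a, ∑' P, F P α = (propagator m a g g' : ℂ) := by
    rw [propagator, ← integral_complex_ofReal]
    refine setIntegral_congr_fun measurableSet_Ioi fun α hα => ?_
    have h2 := ((integral_heatKernel_prod (ha.trans hα) g g').mul_left
      (Real.exp (-α * m ^ 2) : ℂ)).tsum_eq
    simp only [Complex.ofReal_mul]
    rw [← h2]
    refine tsum_congr fun P => ?_
    simp only [F]
    split_ifs
    · rw [mul_comm, ← mul_assoc]
      congr 1
      rw [← Complex.ofReal_mul, ← Real.exp_add]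
      congr 2; ring
    · simp
  rw [h1] at h
  refine h.congr_fun fun P => ?_
  simp only [F]
  rw [integral_const_mul, integral_complex_ofReal, hval, propCoeff]
  split_ifs
  · rw [mul_comm]
  · simp

end Propagator

/-! ### Feynman integrals in momentum space -/

section Momentum

variable {n : ℕ} {b : Fin n → Bubble} {G : FeynmanGraph b}

variable (G) in
/-- Momenta of the external legs. -/
abbrev LegMom : Type := (WhiteLeg G → Fin 4 → ℤ) × (BlackLeg G → Fin 4 → ℤ)

/-- The phase of a plane wave on the external legs. Black legs carry the opposite sign, so that a
momentum is conserved along its face. -/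
def legPhase (k : LegMom G) (gw : WhiteLeg G → Fin 4 → U1) (gb : BlackLeg G → Fin 4 → U1) : U1 :=
  (∑ w, ∑ c, k.1 w c • gw w c) - ∑ u, ∑ c, k.2 u c • gb u c

/-- The momenta of the legs for given momenta of the faces. -/
def legMom (p : Face G → ℤ) : LegMom G :=
  (fun w c => p (face G w.1 c), fun u c => p (face G ((col b c).symm u.1) c))

open Classical in
/-- The momenta of a line for given momenta of the faces, where the external face of each line of
`A` gets momentum zero: this is the effect of the localization operators. -/
def lineMom (A : Set (Line b)) (p : Face G → ℤ) (l : Line b) (c : Fin 4) : ℤ :=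
  if l ∈ A ∧ IsMelonic G l c then 0 else p (face G l.1 c)

lemma sum_white {E : Type*} [AddCommMonoid E] (F : White b → E) :
    ∑ w, F w = ∑ l : G.lines, F l.1.1 + ∑ w : WhiteLeg G, F w.1 := by
  classical
  rw [← Finset.sum_filter_add_sum_filter_not Finset.univ (fun w => ∃ l ∈ G.lines, l.1 = w)]
  congr 1
  · rw [Finset.sum_coe_sort G.lines fun l => F l.1]
    symm
    refine Finset.sum_bij (fun l _ => l.1)
      (fun l hl => Finset.mem_filter.2 ⟨Finset.mem_univ _, l, hl, rfl⟩)
      (fun l hl l' hl' h => line_eq_of_white hl hl' h) (fun w hw => ?_) (fun _ _ => rfl)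
    obtain ⟨l, hl, h⟩ := (Finset.mem_filter.1 hw).2
    exact ⟨l, hl, h⟩
  · refine Finset.sum_subtype _ (fun w => ?_) F
    simp only [Finset.mem_filter, Finset.mem_univ, true_and, not_exists, not_and, ne_eq]

lemma sum_black {E : Type*} [AddCommMonoid E] (F : Black b → E) :
    ∑ u, F u = ∑ l : G.lines, F l.1.2 + ∑ u : BlackLeg G, F u.1 := by
  classical
  rw [← Finset.sum_filter_add_sum_filter_not Finset.univ (fun w => ∃ l ∈ G.lines, l.2 = w)]
  congr 1
  · rw [Finset.sum_coe_sort G.lines fun l => F l.2]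
    symm
    refine Finset.sum_bij (fun l _ => l.2)
      (fun l hl => Finset.mem_filter.2 ⟨Finset.mem_univ _, l, hl, rfl⟩)
      (fun l hl l' hl' h => line_eq_of_black hl hl' h) (fun w hw => ?_) (fun _ _ => rfl)
    obtain ⟨l, hl, h⟩ := (Finset.mem_filter.1 hw).2
    exact ⟨l, hl, h⟩
  · refine Finset.sum_subtype _ (fun w => ?_) F
    simp only [Finset.mem_filter, Finset.mem_univ, true_and, not_exists, not_and, ne_eq]

lemma sum_ite_image {α β E : Type*} [Fintype β] [AddCommMonoid E] (S : Finset α) (ι : α → β)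
    (hι : Set.InjOn ι S) (f : β → E) [∀ x, Decidable (∃ l ∈ S, ι l = x)] :
    (∑ x, if ∃ l ∈ S, ι l = x then 0 else f x) + ∑ l ∈ S, f (ι l) = ∑ x, f x := by
  classical
  rw [← Finset.sum_image hι (f := f), ← Finset.sum_filter_add_sum_filter_not Finset.univ
    (fun x => ∃ l ∈ S, ι l = x) f, Finset.sum_ite, Finset.sum_const_zero, zero_add, add_comm]
  congr 1
  refine Finset.sum_congr ?_ fun _ _ => rfl
  ext x; simp

lemma exists_zsmul_ne_zero {N : ℤ} (hN : N ≠ 0) : ∃ t : U1, N • t ≠ 0 := by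
  by_contra! h
  have := fourier_add_half_inv_index (T := 2 * π) hN Real.two_pi_pos 0
  simp [h] at this
  norm_num at this

/-- The momentum at the white node `w`. -/
def whiteMom (x : (G.lines → Fin 4 → ℤ) × LegMom G) (w : White b) (c : Fin 4) : ℤ :=
  open Classical in
  if h : ∃ l ∈ G.lines, l.1 = w then x.1 ⟨h.choose, h.choose_spec.1⟩ c
  else x.2.1 ⟨w, by push Not at h; exact h⟩ c

/-- The momentum at the black node `u`. -/
def blackMom (x : (G.lines → Fin 4 → ℤ) × LegMom G) (u : Black b) (c : Fin 4) : ℤ :=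
  open Classical in
  if h : ∃ l ∈ G.lines, l.2 = u then x.1 ⟨h.choose, h.choose_spec.1⟩ c
  else x.2.2 ⟨u, by push Not at h; exact h⟩ c

variable (x : (G.lines → Fin 4 → ℤ) × LegMom G)

lemma whiteMom_line {l : Line b} (hl : l ∈ G.lines) (c : Fin 4) :
    whiteMom x l.1 c = x.1 ⟨l, hl⟩ c := by
  have h : ∃ k ∈ G.lines, k.1 = l.1 := ⟨l, hl, rfl⟩
  have e : h.choose = l := line_eq_of_white h.choose_spec.1 hl h.choose_spec.2
  simp only [whiteMom, dif_pos h, e]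

lemma whiteMom_leg (w : WhiteLeg G) (c : Fin 4) : whiteMom x w.1 c = x.2.1 w c := by
  have h : ¬ ∃ k ∈ G.lines, k.1 = w.1 := by push Not; exact w.2
  simp only [whiteMom, dif_neg h]

lemma blackMom_line {l : Line b} (hl : l ∈ G.lines) (c : Fin 4) :
    blackMom x l.2 c = x.1 ⟨l, hl⟩ c := by
  have h : ∃ k ∈ G.lines, k.2 = l.2 := ⟨l, hl, rfl⟩
  have e : h.choose = l := line_eq_of_black h.choose_spec.1 hl h.choose_spec.2
  simp only [blackMom, dif_pos h, e]

lemma blackMom_leg (u : BlackLeg G) (c : Fin 4) : blackMom x u.1 c = x.2.2 u c := by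
  have h : ¬ ∃ k ∈ G.lines, k.2 = u.1 := by push Not; exact u.2
  simp only [blackMom, dif_neg h]

/-- The total phase of the plane waves with momenta `x`, with placement `s`. -/
def totalPhase (s : White b → Fin 4 → White b) (x : (G.lines → Fin 4 → ℤ) × LegMom G) :
    (White b × Fin 4 → U1) →+ U1 :=
  AddMonoidHom.mk' (fun θ => ∑ c, ((∑ w, whiteMom x w c • θ (s w c, c)) -
    ∑ w, blackMom x (col b c w) c • θ (w, c))) fun θ θ' => by
      rw [← Finset.sum_add_distrib]
      refine Finset.sum_congr rfl fun c _ => ?_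
      simp only [Pi.add_apply, smul_add, Finset.sum_add_distrib]
      abel

lemma totalPhase_apply (s : White b → Fin 4 → White b) (θ : White b × Fin 4 → U1) :
    totalPhase s x θ = ∑ c, ((∑ w, whiteMom x w c • θ (s w c, c)) -
      ∑ w, blackMom x (col b c w) c • θ (w, c)) := rfl

lemma continuous_zsmul_apply {V : Type*} (N : ℤ) (v : V) : Continuous fun θ : V → U1 => N • θ v :=
  (continuous_zsmul N).comp (continuous_apply v)

lemma continuous_totalPhase (s : White b → Fin 4 → White b) : Continuous (totalPhase s x) := by
  rw [funext (totalPhase_apply x s)]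
  exact continuous_finsetSum (M := U1) Finset.univ fun c _ => Continuous.sub
    (continuous_finsetSum (M := U1) Finset.univ fun w _ => continuous_zsmul_apply _ _)
    (continuous_finsetSum (M := U1) Finset.univ fun w _ => continuous_zsmul_apply _ _)

lemma totalPhase_eq (s : White b → Fin 4 → White b) (θ : White b × Fin 4 → U1) :
    totalPhase s x θ = (∑ l : G.lines, ∑ c, x.1 l c • (θ (s l.1.1 c, c) -
        θ ((col b c).symm l.1.2, c))) +
      legPhase x.2 (fun w c => θ (s w.1 c, c)) (fun u c => θ ((col b c).symm u.1, c)) := by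
  have h1 : ∀ c, ∑ w, blackMom x (col b c w) c • θ (w, c) =
      ∑ l : G.lines, x.1 l c • θ ((col b c).symm l.1.2, c) +
        ∑ u : BlackLeg G, x.2.2 u c • θ ((col b c).symm u.1, c) := fun c => by
    rw [← (col b c).symm.sum_comp, sum_black (G := G)]
    simp only [Equiv.apply_symm_apply, blackMom_line x (Subtype.prop _), blackMom_leg]
  have h2 : ∀ c, ∑ w, whiteMom x w c • θ (s w c, c) =
      ∑ l : G.lines, x.1 l c • θ (s l.1.1 c, c) + ∑ w : WhiteLeg G, x.2.1 w c • θ (s w.1 c, c) :=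
    fun c => by
      rw [sum_white (G := G)]
      simp only [whiteMom_line x (Subtype.prop _), whiteMom_leg]
  simp only [totalPhase_apply, h1, h2, legPhase, smul_sub, Finset.sum_sub_distrib,
    Finset.sum_add_distrib]
  rw [Finset.sum_comm (s := Finset.univ (α := G.lines)),
    Finset.sum_comm (s := Finset.univ (α := G.lines)),
    Finset.sum_comm (s := Finset.univ (α := WhiteLeg G)),
    Finset.sum_comm (s := Finset.univ (α := BlackLeg G))]
  abel

section Connected

variable (hG : G.Connected) (hv : G.NonVacuum)

include hG hv

omit hG hv in
/-- Momentum conservation at all the coloured lines. -/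
lemma sum_whiteMom {s : White b → Fin 4 → White b} (h : ∀ θ, totalPhase s x θ = 0)
    (y : White b) (c : Fin 4) :
    (∑ w, if s w c = y then whiteMom x w c else 0) = blackMom x (col b c y) c := by
  classical
  by_contra hne
  obtain ⟨t, ht⟩ := exists_zsmul_ne_zero (sub_ne_zero.2 hne)
  apply ht
  rw [← h (Pi.single (y, c) t), totalPhase_apply, Finset.sum_eq_single c]
  · rw [sub_smul, Finset.sum_smul]
    congr 1
    · refine Finset.sum_congr rfl fun w _ => ?_
      by_cases hw : s w c = y
      · simp [hw]
      · rw [if_neg hw, Pi.single_eq_of_ne (by simpa using hw)]; simp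
    · rw [Finset.sum_eq_single y]
      · simp
      · intro w _ hw; rw [Pi.single_eq_of_ne (by simpa using hw)]; simp
      · simp
  · intro c' _ hc
    rw [Finset.sum_eq_zero, Finset.sum_eq_zero, sub_zero]
    · intro w _; rw [Pi.single_eq_of_ne (by simp [hc])]; simp
    · intro w _; rw [Pi.single_eq_of_ne (by simp [hc])]; simp
  · simp

variable {A : Finset (Line b)} {s : White b → Fin 4 → White b}

omit hG hv in
lemma totalPhase_lineMom (hs : IsPlacement G (A : Set (Line b)) s) (p : Face G → ℤ)
    (θ : White b × Fin 4 → U1) :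
    totalPhase s (fun l : G.lines => lineMom (A : Set (Line b)) p l.1, legMom p) θ = 0 := by
  classical
  rw [totalPhase_apply]
  refine Finset.sum_eq_zero fun c _ => ?_
  set x : (G.lines → Fin 4 → ℤ) × LegMom G :=
    (fun l => lineMom (A : Set (Line b)) p l.1, legMom p)
  set S : Finset (Line b) := A.filter fun l => IsMelonic G l c with hS
  have hSG : ∀ l ∈ S, l ∈ A ∧ IsMelonic G l c := fun l hl => Finset.mem_filter.1 hl
  have hw : ∀ w, whiteMom x w c = if ∃ l ∈ S, l.1 = w then 0 else p (face G w c) := by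
    intro w
    by_cases h : ∃ l ∈ G.lines, l.1 = w
    · obtain ⟨l, hl, rfl⟩ := h
      rw [whiteMom_line x hl]
      have : (∃ k ∈ S, k.1 = l.1) ↔ l ∈ (A : Set (Line b)) ∧ IsMelonic G l c := by
        constructor
        · rintro ⟨k, hk, e⟩
          have := hSG k hk
          rw [line_eq_of_white this.2.mem hl e] at this; simpa using this
        · intro h; exact ⟨l, by simpa [hS] using h, rfl⟩
      simp only [x, lineMom, this]
    · have h' : ¬ ∃ l ∈ S, l.1 = w := fun ⟨l, hl, e⟩ => h ⟨l, (hSG l hl).2.mem, e⟩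
      push Not at h
      rw [if_neg h', whiteMom_leg x ⟨w, h⟩]; rfl
  have hb : ∀ w, blackMom x (col b c w) c =
      if ∃ l ∈ S, (col b c).symm l.2 = w then 0 else p (face G w c) := by
    intro w
    by_cases h : ∃ l ∈ G.lines, l.2 = col b c w
    · obtain ⟨l, hl, e⟩ := h
      rw [← e, blackMom_line x hl]
      have : (∃ k ∈ S, (col b c).symm k.2 = w) ↔ l ∈ (A : Set (Line b)) ∧ IsMelonic G l c := by
        constructor
        · rintro ⟨k, hk, e'⟩
          have := hSG k hk
          rw [Equiv.symm_apply_eq, ← e] at e'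
          rw [line_eq_of_black this.2.mem hl e'] at this; simpa using this
        · intro h; exact ⟨l, by simpa [hS] using h, by rw [e, Equiv.symm_apply_apply]⟩
      simp only [x, lineMom, this, face_of_col_eq hl e.symm]
    · have h' : ¬ ∃ l ∈ S, (col b c).symm l.2 = w := fun ⟨l, hl, e⟩ =>
        h ⟨l, (hSG l hl).2.mem, by rw [← e, Equiv.apply_symm_apply]⟩
      push Not at h
      rw [if_neg h', blackMom_leg x ⟨_, h⟩]
      simp [x, legMom]
  simp only [hw, hb, ite_smul, zero_smul]
  have h1 := sum_ite_image S (fun l => l.1)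
    (fun l hl l' hl' e => line_eq_of_white (hSG l hl).2.mem (hSG l' hl').2.mem e)
    fun w => p (face G w c) • θ (s w c, c)
  have h2 := sum_ite_image S (fun l => (col b c).symm l.2)
    (fun l hl l' hl' e => line_eq_of_black (hSG l hl).2.mem (hSG l' hl').2.mem
      ((col b c).symm.injective e))
    fun w => p (face G w c) • θ (s w c, c)
  have h3 : ∑ l ∈ S, p (face G ((col b c).symm l.2) c) • θ (s ((col b c).symm l.2) c, c) =
      ∑ l ∈ S, p (face G l.1 c) • θ (s l.1 c, c) := by
    refine Finset.sum_congr rfl fun l hl => ?_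
    rw [face_pred (hSG l hl).2.mem, hs.eq_next _ c l (hSG l hl).1 (hSG l hl).2 (by simp)]
  have h4 : (∑ w, if ∃ l ∈ S, (col b c).symm l.2 = w then 0 else p (face G w c) • θ (s w c, c)) =
      ∑ w, if ∃ l ∈ S, (col b c).symm l.2 = w then 0 else p (face G w c) • θ (w, c) := by
    refine Finset.sum_congr rfl fun w _ => ?_
    split_ifs with h
    · rfl
    · rw [hs.eq_self w c]
      intro l hl hm e
      exact h ⟨l, Finset.mem_filter.2 ⟨hl, hm⟩, by rw [← e, Equiv.symm_apply_apply]⟩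
  rw [h3] at h2
  rw [← h4, sub_eq_zero]
  exact add_right_cancel (h1.trans h2.symm)

/-- The momenta for which the total phase vanishes are those given by momenta of the faces. -/
lemma exists_faceMom (hs : IsPlacement G (A : Set (Line b)) s) (hA : A ⊆ G.lines)
    (h : ∀ θ, totalPhase s x θ = 0) :
    ∃ p : Face G → ℤ, (fun l : G.lines => lineMom (A : Set (Line b)) p l.1, legMom p) = x := by
  classical
  have hsum := sum_whiteMom x h
  have hzero : ∀ l (hl : l ∈ A) c, IsMelonic G l c → x.1 ⟨l, hA hl⟩ c = 0 := by
    intro l hl c hm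
    rw [← blackMom_line x (hA hl), ← (col b c).apply_symm_apply l.2, ← hsum]
    refine Finset.sum_eq_zero fun w _ => if_neg fun e => ?_
    exact hs.col_ne hG hv w c l hl hm (by rw [e, Equiv.apply_symm_apply])
  have hout : ∀ w c, (∀ l ∈ A, IsMelonic G l c → l.1 ≠ w) →
      whiteMom x w c = blackMom x (col b c (s w c)) c := by
    intro w c hw
    rw [← hsum, Finset.sum_eq_single w]
    · simp
    · intro w' _ hne
      split_ifs with e
      · by_contra h0
        refine hne (hs.injective hG hv e (fun l hl hm e' => h0 ?_) hw)
        rw [← e', whiteMom_line x (hA hl), hzero l hl c hm]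
      · rfl
    · simp
  let p : Face G → ℤ := Quot.lift
    (fun y : White b × Fin 4 => blackMom x (col b y.2 (s y.1 y.2)) y.2) (by
      rintro ⟨y, c⟩ ⟨y', c'⟩ ⟨h1, l, hl, h2, h3⟩
      simp only at h1 h2 h3
      subst h1; subst h3
      simp only
      by_cases hlA : l ∈ A ∧ IsMelonic G l c
      · rw [hs.eq_next y c l hlA.1 hlA.2 h2]
      · rw [hs.eq_self y c fun k hk hm e => hlA ?_, h2, blackMom_line x hl, ← hout,
          whiteMom_line x hl]
        · intro k hk hm e
          rw [line_eq_of_white hm.mem hl e] at hk hm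
          exact hlA ⟨hk, hm⟩
        · rw [line_eq_of_black hm.mem hl (e.symm.trans h2)] at hk hm
          exact ⟨hk, hm⟩)
  have hp : ∀ y c, p (face G y c) = blackMom x (col b c (s y c)) c := fun _ _ => rfl
  refine ⟨p, Prod.ext ?_ (Prod.ext ?_ ?_)⟩
  · funext l c
    simp only [lineMom, Finset.mem_coe]
    split_ifs with hl
    · exact (hzero l.1 hl.1 c hl.2).symm
    · rw [hp, ← hout, whiteMom_line x l.2]
      intro k hk hm e
      rw [line_eq_of_white hm.mem l.2 e] at hk hm
      exact hl ⟨hk, hm⟩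
  · funext w c
    simp only [legMom]
    rw [hp, ← hout, whiteMom_leg]
    exact fun l _ hm => w.2 l hm.mem
  · funext u c
    simp only [legMom]
    rw [hp, hs.eq_self, Equiv.apply_symm_apply, blackMom_leg]
    intro l _ hm e
    rw [Equiv.apply_symm_apply] at e
    exact u.2 l hm.mem e.symm

lemma faceMom_injective (A : Finset (Line b)) : Function.Injective fun p : Face G → ℤ =>
    ((fun l : G.lines => lineMom (A : Set (Line b)) p l.1, legMom p) :
      (G.lines → Fin 4 → ℤ) × LegMom G) := by
  intro p p' h
  obtain ⟨h1, h2⟩ := Prod.ext_iff.1 h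
  funext f
  obtain ⟨w, c, rfl⟩ := face_surjective f
  obtain ⟨y, hy, hy'⟩ := exists_not_isMelonic hG hv w c
  rw [← hy]
  by_cases hl : ∃ l ∈ G.lines, l.1 = y
  · obtain ⟨l, hl, rfl⟩ := hl
    have := congrFun (congrFun h1 ⟨l, hl⟩) c
    simpa only [lineMom, hy' l hl rfl, and_false, if_false] using this
  · push Not at hl
    exact congrFun (congrFun (congrArg Prod.fst h2) ⟨y, hl⟩) c

omit hG hv in
lemma integrable_chr_totalPhase (s : White b → Fin 4 → White b) :
    Integrable (fun θ => chr (totalPhase s x θ)) (Measure.pi fun _ : White b × Fin 4 => haar) :=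
  (continuous_chr.comp (continuous_totalPhase x s)).integrable_of_hasCompactSupport
    (HasCompactSupport.of_compactSpace _)

omit hG hv in
lemma hasSum_mul_of_summable_norm {ι κ : Type*} {f : ι → ℂ} {g : κ → ℂ} {z w : ℂ}
    (hf : HasSum f z) (hg : HasSum g w) (hf' : Summable fun i => ‖f i‖)
    (hg' : Summable fun i => ‖g i‖) : HasSum (fun x : ι × κ => f x.1 * g x.2) (z * w) :=
  hf.mul hg (summable_mul_of_summable_norm hf' hg')

omit hG hv in
lemma hasSum_prod_propagator {ι : Type*} [Fintype ι] {m : ℝ} (hm : 0 < m) {a : ℝ} (ha : 0 < a)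
    (g g' : ι → Fin 4 → U1) :
    Summable (fun P : ι → Fin 4 → ℤ => ‖(∏ l, (propCoeff m a (P l) : ℂ)) *
      chr (∑ l, ∑ c, P l c • (g l c - g' l c))‖) ∧
    HasSum (fun P : ι → Fin 4 → ℤ => (∏ l, (propCoeff m a (P l) : ℂ)) *
      chr (∑ l, ∑ c, P l c • (g l c - g' l c))) (∏ l, (propagator m a (g l) (g' l) : ℂ)) := by
  have h1 := hasSum_pi (ι := ι) (fun l P => (propCoeff m a P : ℂ) *
    chr (∑ c, P c • (g l c - g' l c))) fun l => by
      simpa only [norm_mul, norm_chr, mul_one, Complex.norm_real] using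
        (summable_propCoeff hm ha).norm
  refine ⟨h1.1.congr fun P => by rw [chr_sum, Finset.prod_mul_distrib], ?_⟩
  have h2 := h1.2
  simp only [(hasSum_propagator hm ha _ _).tsum_eq] at h2
  refine h2.congr_fun fun P => ?_
  rw [chr_sum, Finset.prod_mul_distrib]

/-- The amputated Feynman integral with localization operators, as a sum over the momenta of the
faces. -/
theorem hasSum_feynmanIntegral {m : ℝ} (hm : 0 < m) {a : ℝ} (ha : 0 < a)
    (hs : IsPlacement G (A : Set (Line b)) s) (hA : A ⊆ G.lines) {Φ : LegFunction G}
    {β : LegMom G → ℂ} (hβ : Summable fun k => ‖β k‖)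
    (hΦ : ∀ gw gb, HasSum (fun k => β k * chr (legPhase k gw gb)) (Φ gw gb)) :
    HasSum (fun p : Face G → ℤ =>
        ((∏ l ∈ G.lines, propCoeff m a (lineMom (A : Set (Line b)) p l) : ℝ) : ℂ) * β (legMom p))
      (feynmanIntegral m a G s Φ) := by
  classical
  let C : (G.lines → Fin 4 → ℤ) × LegMom G → ℂ := fun x =>
    (∏ l : G.lines, (propCoeff m a (x.1 l) : ℂ)) * β x.2
  have hP : Summable fun P : G.lines → Fin 4 → ℤ => ‖∏ l, (propCoeff m a (P l) : ℂ)‖ :=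
    (hasSum_prod_propagator hm ha (fun _ _ => 0) (fun _ _ => 0)).1.congr fun P => by
      rw [norm_mul, norm_chr, mul_one]
  have hC : Summable fun x => ‖C x‖ := Summable.mul_norm
    (f := fun P : G.lines → Fin 4 → ℤ => ∏ l, (propCoeff m a (P l) : ℂ)) (g := β) hP hβ
  have hint : ∀ θ : White b × Fin 4 → U1, HasSum (fun x => C x * chr (totalPhase s x θ))
      (((∏ l ∈ G.lines, propagator m a (fun c => θ (s l.1 c, c))
        (fun c => θ ((col b c).symm l.2, c)) : ℝ) : ℂ) *
      Φ (fun w c => θ (s w.1 c, c)) (fun u c => θ ((col b c).symm u.1, c))) := by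
    intro θ
    have h1 := hasSum_prod_propagator (ι := G.lines) hm ha (fun l c => θ (s l.1.1 c, c))
      (fun l c => θ ((col b c).symm l.1.2, c))
    have h2 := hΦ (fun w c => θ (s w.1 c, c)) (fun u c => θ ((col b c).symm u.1, c))
    have h3 := hasSum_mul_of_summable_norm h1.2 h2 h1.1
      (hβ.congr fun k => by rw [norm_mul, norm_chr, mul_one])
    have h4 : ((∏ l ∈ G.lines, propagator m a (fun c => θ (s l.1 c, c))
        (fun c => θ ((col b c).symm l.2, c)) : ℝ) : ℂ) = ∏ l : G.lines,
        (propagator m a (fun c => θ (s l.1.1 c, c))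
          (fun c => θ ((col b c).symm l.1.2, c)) : ℂ) := by
      rw [Complex.ofReal_prod]
      exact (Finset.prod_coe_sort G.lines fun l => (propagator m a (fun c => θ (s l.1 c, c))
        (fun c => θ ((col b c).symm l.2, c)) : ℂ)).symm
    rw [h4]
    refine h3.congr_fun fun x => ?_
    rw [totalPhase_eq, chr_add]
    simp only [C]
    ring
  have h4 := hasSum_integral_of_summable_integral_norm
    (μ := Measure.pi fun _ : White b × Fin 4 => haar) (F := fun x θ => C x * chr (totalPhase s x θ))
    (fun x => (integrable_chr_totalPhase x s).const_mul _)
    (by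
      simpa only [norm_mul, norm_chr, mul_one, integral_const, probReal_univ, one_smul] using hC)
  have h5 : ∫ θ : White b × Fin 4 → U1, ∑' x, C x * chr (totalPhase s x θ)
      ∂(Measure.pi fun _ : White b × Fin 4 => haar) = feynmanIntegral m a G s Φ :=
    integral_congr_ae (Eventually.of_forall fun θ => (hint θ).tsum_eq)
  rw [h5, ← (faceMom_injective hG hv A).hasSum_iff] at h4
  · refine h4.congr_fun fun p => ?_
    simp only [Function.comp_apply]
    rw [integral_const_mul, integral_chr, if_pos (totalPhase_lineMom hs p), mul_one,
      Complex.ofReal_prod, ← Finset.prod_coe_sort]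
  · intro x hx
    rw [integral_const_mul, integral_chr, if_neg, mul_zero]
    intro h
    exact hx (exists_faceMom x hG hv hs hA h)

end Connected

end Momentum

/-! ### Slowly varying functions of a momentum -/

section Mild

/-- The weight `1 + |q|` of a momentum. -/
def br (q : ℤ) : ℝ := 1 + |(q : ℝ)|

lemma one_le_br (q : ℤ) : 1 ≤ br q := le_add_of_nonneg_right (abs_nonneg _)

lemma br_pos (q : ℤ) : 0 < br q := zero_lt_one.trans_le (one_le_br q)

lemma br_neg (q : ℤ) : br (-q) = br q := by simp [br]

lemma br_add_one_le (q : ℤ) : br (q + 1) ≤ 2 * br q := by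
  have := abs_add_le (q : ℝ) 1
  simp only [br, abs_one] at *
  push_cast
  linarith [abs_nonneg (q : ℝ)]

lemma br_le_add_one (q : ℤ) : br q ≤ 2 * br (q + 1) := by
  have := abs_sub (q + 1 : ℝ) 1
  simp only [br, abs_one, add_sub_cancel_right] at *
  push_cast
  linarith [abs_nonneg (q + 1 : ℝ)]

lemma rpow_le_rpow_of_neg {x y z : ℝ} (hx : 0 < x) (hxy : x ≤ y) (hz : z ≤ 0) : y ^ z ≤ x ^ z :=
  Real.rpow_le_rpow_of_nonpos hx hxy hz

lemma summable_br {s : ℝ} (hs : s < -1) : Summable fun q : ℤ => br q ^ s := by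
  have h : Summable fun n : ℕ => ((n + 1 : ℕ) : ℝ) ^ s :=
    (summable_nat_add_iff 1).2 (Real.summable_nat_rpow.2 hs)
  refine Summable.of_nat_of_neg (h.congr fun n => ?_) (h.congr fun n => ?_)
  · simp only [br]; push_cast; rw [abs_of_nonneg (Nat.cast_nonneg n), add_comm]
  · rw [br_neg]; simp only [br]; push_cast; rw [abs_of_nonneg (Nat.cast_nonneg n), add_comm]

/-- A family of functions of a momentum, depending on a cutoff `ρ`, which grows more slowly than any
power, whose increments decay almost like the inverse of the momentum, both uniformly in the cutoff,
and which converges pointwise as the cutoff is removed. -/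
structure IsMild (Q : ℕ → ℤ → ℂ) : Prop where
  growth : ∀ ε : ℝ, 0 < ε → ∃ C, 0 ≤ C ∧ ∀ ρ q, ‖Q ρ q‖ ≤ C * br q ^ ε
  increment : ∀ ε : ℝ, 0 < ε → ∃ C, 0 ≤ C ∧ ∀ ρ q, ‖Q ρ (q + 1) - Q ρ q‖ ≤ C * br q ^ (-1 + ε)
  limit : ∀ q, ∃ z, Tendsto (fun ρ => Q ρ q) atTop (𝓝 z)

lemma isMild_one : IsMild fun _ _ => 1 where
  growth ε hε := ⟨1, zero_le_one, fun ρ q => by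
    rw [norm_one, one_mul]; exact Real.one_le_rpow (one_le_br q) hε.le⟩
  increment ε hε := ⟨0, le_rfl, fun ρ q => by simp⟩
  limit q := ⟨1, tendsto_const_nhds⟩

lemma IsMild.mul {Q R : ℕ → ℤ → ℂ} (hQ : IsMild Q) (hR : IsMild R) :
    IsMild fun ρ q => Q ρ q * R ρ q where
  growth ε hε := by
    obtain ⟨C, hC, h⟩ := hQ.growth (ε / 2) (half_pos hε)
    obtain ⟨C', hC', h'⟩ := hR.growth (ε / 2) (half_pos hε)
    refine ⟨C * C', mul_nonneg hC hC', fun ρ q => ?_⟩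
    rw [norm_mul]
    refine (mul_le_mul (h ρ q) (h' ρ q) (norm_nonneg _)
      (mul_nonneg hC (Real.rpow_nonneg (br_pos q).le _))).trans_eq ?_
    rw [mul_mul_mul_comm, ← Real.rpow_add (br_pos q), add_halves]
  increment ε hε := by
    obtain ⟨C, hC, h⟩ := hQ.growth (ε / 2) (half_pos hε)
    obtain ⟨C', hC', h'⟩ := hR.growth (ε / 2) (half_pos hε)
    obtain ⟨D, hD, k⟩ := hQ.increment (ε / 2) (half_pos hε)
    obtain ⟨D', hD', k'⟩ := hR.increment (ε / 2) (half_pos hε)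
    refine ⟨C * 2 ^ (ε / 2) * D' + D * C', by positivity, fun ρ q => ?_⟩
    have hb := br_pos q
    have e : Q ρ (q + 1) * R ρ (q + 1) - Q ρ q * R ρ q =
      Q ρ (q + 1) * (R ρ (q + 1) - R ρ q) + (Q ρ (q + 1) - Q ρ q) * R ρ q := by ring
    have h1 : ‖Q ρ (q + 1)‖ ≤ C * 2 ^ (ε / 2) * br q ^ (ε / 2) := by
      refine (h ρ (q + 1)).trans ?_
      rw [mul_assoc, ← Real.mul_rpow zero_le_two hb.le]
      gcongr
      · exact (br_pos _).le
      · exact br_add_one_le q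
    have e2 : br q ^ (-1 + ε) = br q ^ (ε / 2) * br q ^ (-1 + ε / 2) := by
      rw [← Real.rpow_add hb]; congr 1; ring
    rw [e]
    refine (norm_add_le _ _).trans ?_
    rw [norm_mul, norm_mul, add_mul, e2]
    refine add_le_add ?_ ?_
    · refine (mul_le_mul h1 (k' ρ q) (norm_nonneg _) (by positivity)).trans_eq ?_
      ring
    · refine (mul_le_mul (k ρ q) (h' ρ q) (norm_nonneg _) (by positivity)).trans_eq ?_
      ring
  limit q := by
    obtain ⟨z, hz⟩ := hQ.limit q
    obtain ⟨w, hw⟩ := hR.limit q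
    exact ⟨z * w, hz.mul hw⟩

lemma sum_br_le {ε : ℝ} (hε : 0 < ε) : ∃ C, 0 ≤ C ∧ ∀ N : ℕ,
    ∑ j ∈ Finset.range N, br j ^ (-1 + ε / 2) ≤ C * br N ^ ε := by
  have hs : Summable fun q : ℤ => br q ^ (-1 - ε / 2) := summable_br (by linarith)
  have hs' : Summable fun j : ℕ => br j ^ (-1 - ε / 2) := hs.comp_injective Nat.cast_injective
  have hnn : ∀ j : ℕ, 0 ≤ br j ^ (-1 - ε / 2) := fun j => Real.rpow_nonneg (br_pos _).le _
  refine ⟨∑' j : ℕ, br j ^ (-1 - ε / 2), tsum_nonneg hnn, fun N => ?_⟩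
  calc ∑ j ∈ Finset.range N, br j ^ (-1 + ε / 2)
      ≤ ∑ j ∈ Finset.range N, br j ^ (-1 - ε / 2) * br N ^ ε := by
        refine Finset.sum_le_sum fun j hj => ?_
        rw [show (-1 + ε / 2 : ℝ) = (-1 - ε / 2) + ε by ring, Real.rpow_add (br_pos _)]
        gcongr
        · exact hnn j
        · exact (br_pos _).le
        · simp only [br, Int.cast_natCast, Nat.abs_cast]
          have : (j : ℝ) ≤ N := Nat.cast_le.2 (Finset.mem_range.1 hj).le
          linarith
    _ ≤ _ := by
        rw [← Finset.sum_mul]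
        gcongr
        · exact Real.rpow_nonneg (br_pos _).le _
        · exact hs'.sum_le_tsum _ fun j _ => hnn j

/-- A function vanishing at zero momentum is mild as soon as its increments are under control. -/
lemma isMild_of_increment {R : ℕ → ℤ → ℂ} (h0 : ∀ ρ, R ρ 0 = 0)
    (hi : ∀ ε : ℝ, 0 < ε → ∃ C, 0 ≤ C ∧ ∀ ρ q, ‖R ρ (q + 1) - R ρ q‖ ≤ C * br q ^ (-1 + ε))
    (hl : ∀ q, ∃ z, Tendsto (fun ρ => R ρ (q + 1) - R ρ q) atTop (𝓝 z)) : IsMild R where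
  growth ε hε := by
    obtain ⟨C, hC, h⟩ := hi (ε / 2) (half_pos hε)
    obtain ⟨B, hB, h'⟩ := sum_br_le hε
    have hK : (1 : ℝ) ≤ 2 ^ (ε / 2) := Real.one_le_rpow one_le_two (half_pos hε).le
    refine ⟨2 ^ (ε / 2) * C * B, by positivity, fun ρ q => ?_⟩
    have hpos : ∀ N : ℕ, ‖R ρ N‖ ≤ ∑ j ∈ Finset.range N, C * br j ^ (-1 + ε / 2) := by
      intro N
      induction N with
      | zero => simp [h0]
      | succ N ih =>
        rw [Finset.sum_range_succ]
        have := h ρ N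
        push_cast
        calc ‖R ρ (N + 1)‖ = ‖R ρ N + (R ρ (N + 1) - R ρ N)‖ := by congr 1; ring
          _ ≤ _ := (norm_add_le _ _).trans (add_le_add ih this)
    have hneg : ∀ N : ℕ, ‖R ρ (-N)‖ ≤
        ∑ j ∈ Finset.range N, 2 ^ (ε / 2) * (C * br j ^ (-1 + ε / 2)) := by
      intro N
      induction N with
      | zero => simp [h0]
      | succ N ih =>
        rw [Finset.sum_range_succ]
        have h1 := h ρ (-(N + 1 : ℕ))
        have e : (-((N + 1 : ℕ) : ℤ) + 1) = -(N : ℤ) := by push_cast; ring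
        rw [e, br_neg] at h1
        have h3 : br ((N + 1 : ℕ) : ℤ) ^ (-1 + ε / 2) ≤ 2 ^ (ε / 2) * br N ^ (-1 + ε / 2) := by
          have hb := Real.rpow_nonneg (br_pos N).le (-1 + ε / 2)
          by_cases hc : -1 + ε / 2 ≤ 0
          · refine (rpow_le_rpow_of_neg (br_pos N) ?_ hc).trans ?_
            · simp only [br]; push_cast
              rw [abs_of_nonneg (by positivity), abs_of_nonneg (by positivity)]; linarith
            · nlinarith
          · refine (Real.rpow_le_rpow (br_pos _).le (br_add_one_le N) (not_le.1 hc).le).trans ?_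
            rw [Real.mul_rpow zero_le_two (br_pos _).le]
            gcongr
            · exact one_le_two
            · linarith
        have h2 : C * br ((N + 1 : ℕ) : ℤ) ^ (-1 + ε / 2) ≤
            2 ^ (ε / 2) * (C * br N ^ (-1 + ε / 2)) :=
          (mul_le_mul_of_nonneg_left h3 hC).trans_eq (by ring)
        calc ‖R ρ (-((N + 1 : ℕ) : ℤ))‖
            = ‖R ρ (-N) - (R ρ (-N) - R ρ (-((N + 1 : ℕ) : ℤ)))‖ := by congr 1; ring
          _ ≤ _ := (norm_sub_le _ _).trans (add_le_add ih (h1.trans h2))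
    have hall : ∀ N : ℕ, ∑ j ∈ Finset.range N, 2 ^ (ε / 2) * (C * br j ^ (-1 + ε / 2)) ≤
        2 ^ (ε / 2) * C * B * br N ^ ε := by
      intro N
      rw [← Finset.mul_sum, ← Finset.mul_sum, mul_assoc, mul_assoc]
      exact mul_le_mul_of_nonneg_left (mul_le_mul_of_nonneg_left (h' N) hC) (by positivity)
    obtain ⟨N, rfl | rfl⟩ := q.eq_nat_or_neg
    · refine (hpos N).trans ((Finset.sum_le_sum fun j _ => ?_).trans (hall N))
      exact le_mul_of_one_le_left (mul_nonneg hC (Real.rpow_nonneg (br_pos _).le _)) hK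
    · rw [br_neg]; exact (hneg N).trans (hall N)
  increment := hi
  limit q := by
    induction q using Int.induction_on with
    | zero => exact ⟨0, by simp [h0]⟩
    | succ i ih =>
      obtain ⟨z, hz⟩ := ih
      obtain ⟨w, hw⟩ := hl i
      exact ⟨z + w, (hz.add hw).congr fun ρ => by ring⟩
    | pred i ih =>
      obtain ⟨z, hz⟩ := ih
      obtain ⟨w, hw⟩ := hl (-i - 1)
      exact ⟨z - w, (hz.sub hw).congr fun ρ => by
        rw [show (-(i : ℤ) - 1 + 1) = -i by ring]; ring⟩

end Mild

/-! ### Melonic loops -/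

section Loop

/-- The radial profile of the regularized propagator in momentum space. -/
def decay (a x : ℝ) : ℝ := Real.exp (-a * x) / x

lemma decay_nonneg (a : ℝ) {x : ℝ} (hx : 0 < x) : 0 ≤ decay a x := by unfold decay; positivity

lemma decay_le {a x : ℝ} (ha : 0 ≤ a) (hx : 0 < x) : decay a x ≤ x⁻¹ := by
  rw [decay, ← one_div]
  gcongr
  exact Real.exp_le_one_iff.2 (by nlinarith)

lemma decay_sub_le {a x y : ℝ} (ha : 0 ≤ a) (hx : 0 < x) (hxy : x ≤ y) :
    |decay a x - decay a y| ≤ 2 * |x - y| / (x * y) := by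
  have hy := hx.trans_le hxy
  set e := Real.exp (-a * x)
  set e' := Real.exp (-a * y)
  have h1 : e' ≤ e := Real.exp_le_exp.2 (by nlinarith)
  have h2 : e ≤ 1 := Real.exp_le_one_iff.2 (by nlinarith)
  have h3 : e * (a * x) ≤ 1 := by
    have := Real.add_one_le_exp (a * x)
    have h : e * Real.exp (a * x) = 1 := by rw [← Real.exp_add]; simp
    nlinarith [Real.exp_pos (-a * x)]
  have h4 : e - e' ≤ e * (a * (y - x)) := by
    have := Real.add_one_le_exp (-(a * (y - x)))
    have h : e' = e * Real.exp (-(a * (y - x))) := by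
      rw [← Real.exp_add]; simp only [e']; congr 1; ring
    rw [h]; nlinarith [Real.exp_pos (-a * x)]
  have h5 : (e - e') * x ≤ y - x := by
    nlinarith [mul_le_mul_of_nonneg_right h3 (sub_nonneg.2 hxy)]
  have e1 : decay a x - decay a y = (e * (y - x) + (e - e') * x) / (x * y) := by
    change e / x - e' / y = _
    field_simp; ring
  have h0 : 0 ≤ e := (Real.exp_pos _).le
  rw [e1, abs_div, abs_of_pos (mul_pos hx hy), abs_of_nonneg
    (add_nonneg (mul_nonneg h0 (sub_nonneg.2 hxy)) (mul_nonneg (sub_nonneg.2 h1) hx.le)),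
    abs_sub_comm, abs_of_nonneg (sub_nonneg.2 hxy)]
  gcongr
  nlinarith

lemma abs_decay_sub_le {a x y : ℝ} (ha : 0 ≤ a) (hx : 0 < x) (hy : 0 < y) :
    |decay a x - decay a y| ≤ 2 * |x - y| / (x * y) := by
  rcases le_total x y with h | h
  · exact decay_sub_le ha hx h
  · rw [abs_sub_comm, abs_sub_comm x, mul_comm x]; exact decay_sub_le ha hy h

lemma decay_le_pow {a x : ℝ} (ha : 0 < a) (hx : 0 < x) : decay a x ≤ 6 / a ^ 3 * (x ^ 4)⁻¹ := by
  have h := Real.pow_div_factorial_le_exp (a * x) (by positivity) 3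
  rw [decay, neg_mul, Real.exp_neg, div_eq_mul_inv, ← mul_inv, ← div_eq_mul_inv,
    show 6 / a ^ 3 / x ^ 4 = ((a * x) ^ 3 / (Nat.factorial 3 : ℝ) * x)⁻¹ by
      simp [Nat.factorial]; field_simp]
  exact inv_anti₀ (by positivity) (by gcongr)

lemma tendsto_decay {a : ℕ → ℝ} (ha : Tendsto a atTop (𝓝 0)) (x : ℝ) :
    Tendsto (fun ρ => decay (a ρ) x) atTop (𝓝 x⁻¹) := by
  have h := ((ha.neg.mul_const x).rexp.div_const x)
  simpa [decay] using h

variable (m : ℝ)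

/-- The denominator of the propagator, when the two summed momenta are `i` and `j`. -/
def sqMass (q i j : ℤ) : ℝ := m ^ 2 + (q ^ 2 + (q + i + j) ^ 2 + i ^ 2 + j ^ 2)

/-- The size of the four momenta of a line. -/
def lineSize (q i j : ℤ) : ℝ := br q + br (q + i + j) + br i + br j

lemma sqMass_ge {m : ℝ} (hm : 0 < m) :
    ∃ c, 0 < c ∧ ∀ q i j, c * lineSize q i j ^ 2 ≤ sqMass m q i j := by
  refine ⟨min (m ^ 2) 1 / 32, by positivity, fun q i j => ?_⟩
  have h1 := min_le_left (m ^ 2) 1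
  have h2 := min_le_right (m ^ 2) 1
  have h3 : 0 < min (m ^ 2) 1 := by positivity
  have hb : ∀ t : ℤ, br t ^ 2 ≤ 2 * (1 + t ^ 2) := fun t => by
    have := sq_nonneg (|(t : ℝ)| - 1)
    have h := sq_abs (t : ℝ)
    unfold br; nlinarith
  have k1 := hb q
  have k2 := hb (q + i + j)
  have k3 := hb i
  have k4 := hb j
  push_cast at k2
  have h4 : lineSize q i j ^ 2 ≤
      32 + 8 * ((q : ℝ) ^ 2 + (q + i + j) ^ 2 + i ^ 2 + j ^ 2) := by
    have : lineSize q i j ^ 2 ≤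
        4 * (br q ^ 2 + br (q + i + j) ^ 2 + br i ^ 2 + br j ^ 2) := by
      unfold lineSize
      nlinarith [sq_nonneg (br q - br (q + i + j)), sq_nonneg (br q - br i),
        sq_nonneg (br q - br j), sq_nonneg (br (q + i + j) - br i),
        sq_nonneg (br (q + i + j) - br j), sq_nonneg (br i - br j)]
    linarith
  have h5 : 0 ≤ ((q : ℝ) ^ 2 + (q + i + j) ^ 2 + i ^ 2 + j ^ 2) := by positivity
  unfold sqMass
  nlinarith [mul_le_mul_of_nonneg_left h4 h3.le, mul_le_mul_of_nonneg_right h2 h5]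

lemma one_le_lineSize (q i j : ℤ) : 1 ≤ lineSize q i j := by
  unfold lineSize
  linarith [one_le_br q, br_pos (q + i + j), br_pos i, br_pos j]

lemma lineSize_pos (q i j : ℤ) : 0 < lineSize q i j := zero_lt_one.trans_le (one_le_lineSize q i j)

lemma br_le_lineSize (q i j : ℤ) : br q ≤ lineSize q i j ∧ br (q + i + j) ≤ lineSize q i j ∧
    br i ≤ lineSize q i j ∧ br j ≤ lineSize q i j := by
  unfold lineSize
  have := br_pos q
  have := br_pos (q + i + j)
  have := br_pos i
  have := br_pos j
  refine ⟨?_, ?_, ?_, ?_⟩ <;> linarith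

lemma lineSize_le_succ (q i j : ℤ) : lineSize q i j ≤ 2 * lineSize (q + 1) i j := by
  have h1 := br_le_add_one q
  have h2 := br_le_add_one (q + i + j)
  have h3 := br_pos i
  have h4 := br_pos j
  unfold lineSize
  rw [show q + 1 + i + j = q + i + j + 1 by ring]
  linarith

variable {m}

/-- The summand of the loop, after the momentum conservation has been solved. -/
def loopTerm (m a : ℝ) (Q₀ Q₁ Q₂ : ℤ → ℂ) (q : ℤ) (z : ℤ × ℤ) : ℂ :=
  decay a (sqMass m q z.1 z.2) * (Q₀ (-(q + z.1 + z.2)) * Q₁ z.1 * Q₂ z.2)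

/-- The integrable weight which dominates the increments of the loop. -/
def loopWeight (δ : ℝ) (q : ℤ) (z : ℤ × ℤ) : ℝ := br z.1 ^ (-1 - δ) * br (q + z.1 + z.2) ^ (-1 - δ)

lemma hasSum_loopWeight {δ : ℝ} (hδ : 0 < δ) (q : ℤ) :
    HasSum (loopWeight δ q) ((∑' i, br i ^ (-1 - δ)) * ∑' i, br i ^ (-1 - δ)) := by
  have hs : Summable fun i : ℤ => br i ^ (-1 - δ) := summable_br (by linarith)
  have hnn : (0 : ℤ → ℝ) ≤ fun i : ℤ => br i ^ (-1 - δ) := fun i => Real.rpow_nonneg (br_pos i).le _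
  have h := hs.hasSum.mul hs.hasSum (hs.mul_of_nonneg hs hnn hnn)
  have := (Equiv.hasSum_iff (Equiv.prodCongrRight fun i : ℤ => Equiv.addLeft (q + i))).2 h
  exact this

/-- The increments of the loop. A shift of the external momentum changes the propagator or the first
insertion, and both gain almost one power of the momenta. -/
lemma loopTerm_increment {m : ℝ} (hm : 0 < m) {Q : Fin 3 → ℕ → ℤ → ℂ} (hQ : ∀ j, IsMild (Q j))
    {δ : ℝ} (hδ : 0 < δ) (hδ' : δ ≤ 1 / 5) :
    ∃ C, 0 ≤ C ∧ ∀ ρ a, 0 ≤ a → ∀ q z,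
      ‖loopTerm m a (Q 0 ρ) (Q 1 ρ) (Q 2 ρ) (q + 1) z -
        loopTerm m a (Q 0 ρ) (Q 1 ρ) (Q 2 ρ) q z‖ ≤
        C * br q ^ (-1 + 5 * δ) * loopWeight δ q z := by
  obtain ⟨c, hc, hcx⟩ := sqMass_ge hm
  obtain ⟨C₀, hC₀, h0⟩ := (hQ 0).growth δ hδ
  obtain ⟨C₁, hC₁, h1⟩ := (hQ 1).growth δ hδ
  obtain ⟨C₂, hC₂, h2⟩ := (hQ 2).growth δ hδ
  obtain ⟨D₀, hD₀, k0⟩ := (hQ 0).increment δ hδ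
  refine ⟨(2 * 2 / (c / 4 * c) * (2 * C₀) + c⁻¹ * (2 * D₀)) * C₁ * C₂, by positivity,
    fun ρ a ha q z => ?_⟩
  obtain ⟨i, j⟩ := z
  set Y := lineSize q i j with hY
  set r := q + i + j with hr
  have hY1 : 1 ≤ Y := one_le_lineSize q i j
  have hY0 : 0 < Y := lineSize_pos q i j
  obtain ⟨bq, brr, bi, bj⟩ := br_le_lineSize q i j
  have hx0 : c * Y ^ 2 ≤ sqMass m q i j := hcx q i j
  have hx1 : c / 4 * Y ^ 2 ≤ sqMass m (q + 1) i j := by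
    refine le_trans ?_ (hcx (q + 1) i j)
    have := lineSize_le_succ q i j
    rw [← hY] at this
    have h' : Y ^ 2 ≤ (2 * lineSize (q + 1) i j) ^ 2 := by gcongr
    nlinarith
  have hxp0 : 0 < sqMass m q i j := lt_of_lt_of_le (by positivity) hx0
  have hxp1 : 0 < sqMass m (q + 1) i j := lt_of_lt_of_le (by positivity) hx1
  have hdiff : |sqMass m (q + 1) i j - sqMass m q i j| ≤ 2 * Y := by
    have e : sqMass m (q + 1) i j - sqMass m q i j = (2 * q + 1) + (2 * (r : ℤ) + 1) := by
      simp only [sqMass, hr]; push_cast; ring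
    rw [e]
    have e1 : |(2 * (q : ℝ) + 1)| ≤ 2 * br q := by
      refine (abs_add_le _ _).trans ?_
      rw [abs_mul]; simp only [br]; norm_num; linarith [abs_nonneg (q : ℝ)]
    have e2 : |(2 * (r : ℝ) + 1)| ≤ 2 * br r := by
      refine (abs_add_le _ _).trans ?_
      rw [abs_mul]; simp only [br]; norm_num; linarith [abs_nonneg (r : ℝ)]
    refine (abs_add_le _ _).trans ((add_le_add e1 e2).trans ?_)
    have := br_pos i
    have := br_pos j
    simp only [hY, lineSize]; linarith
  have hK : |decay a (sqMass m (q + 1) i j) - decay a (sqMass m q i j)| ≤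
      2 * 2 / (c / 4 * c) * Y ^ (-3 : ℝ) := by
    refine (abs_decay_sub_le ha hxp1 hxp0).trans ?_
    have e : 2 * 2 / (c / 4 * c) * Y ^ (-3 : ℝ) = 2 * (2 * Y) / (c / 4 * Y ^ 2 * (c * Y ^ 2)) := by
      rw [Real.rpow_neg hY0.le, show (3 : ℝ) = (3 : ℕ) by norm_num, Real.rpow_natCast]
      field_simp
    rw [e]
    gcongr
  have hK0 : decay a (sqMass m q i j) ≤ c⁻¹ * Y ^ (-2 : ℝ) := by
    refine (decay_le ha hxp0).trans ?_
    have e : c⁻¹ * Y ^ (-2 : ℝ) = (c * Y ^ 2)⁻¹ := by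
      rw [Real.rpow_neg hY0.le, show (2 : ℝ) = (2 : ℕ) by norm_num, Real.rpow_natCast, mul_inv]
    rw [e]
    exact inv_anti₀ (by positivity) hx0
  have pδ : ∀ t : ℤ, br t ≤ Y → br t ^ δ ≤ Y ^ δ := fun t ht =>
    Real.rpow_le_rpow (br_pos t).le ht hδ.le
  have two_pow : ∀ s : ℝ, s ≤ 1 → (2 : ℝ) ^ s ≤ 2 := fun s hs =>
    (Real.rpow_le_rpow_of_exponent_le one_le_two hs).trans_eq (Real.rpow_one 2)
  have b1 : ‖Q 1 ρ i‖ ≤ C₁ * Y ^ δ := (h1 ρ i).trans (mul_le_mul_of_nonneg_left (pδ i bi) hC₁)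
  have b2 : ‖Q 2 ρ j‖ ≤ C₂ * Y ^ δ := (h2 ρ j).trans (mul_le_mul_of_nonneg_left (pδ j bj) hC₂)
  have b0 : ‖Q 0 ρ (-(r + 1))‖ ≤ 2 * C₀ * Y ^ δ := by
    refine (h0 ρ _).trans ?_
    rw [br_neg]
    have : br (r + 1) ^ δ ≤ 2 * Y ^ δ := by
      refine (Real.rpow_le_rpow (br_pos _).le (br_add_one_le r) hδ.le).trans ?_
      rw [Real.mul_rpow zero_le_two (br_pos r).le]
      exact mul_le_mul (two_pow _ (by linarith)) (pδ r brr) (Real.rpow_nonneg (br_pos r).le _)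
        zero_le_two
    nlinarith
  have b0' : ‖Q 0 ρ (-(r + 1)) - Q 0 ρ (-r)‖ ≤ 2 * D₀ * br r ^ (-1 + δ) := by
    have h := k0 ρ (-(r + 1))
    rw [show -(r + 1) + 1 = -r by ring, norm_sub_rev, br_neg] at h
    refine h.trans ?_
    have : br (r + 1) ^ (-1 + δ) ≤ 2 * br r ^ (-1 + δ) := by
      have e : br (r + 1) ^ (-1 + δ) ≤ (br r / 2) ^ (-1 + δ) :=
        rpow_le_rpow_of_neg (half_pos (br_pos r)) (by linarith [br_le_add_one r]) (by linarith)
      refine e.trans ?_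
      rw [div_eq_mul_inv, Real.mul_rpow (br_pos r).le (by norm_num), Real.inv_rpow zero_le_two,
        ← Real.rpow_neg zero_le_two, mul_comm]
      exact mul_le_mul_of_nonneg_right (two_pow _ (by linarith))
        (Real.rpow_nonneg (br_pos r).le _)
    nlinarith
  have hYr : Y ^ (-1 + δ) ≤ br r ^ (-1 + δ) := rpow_le_rpow_of_neg (br_pos r) brr (by linarith)
  -- the powers of the size are distributed over the momenta
  have hfin : Y ^ (-2 + 2 * δ) * br r ^ (-1 + δ) ≤ br q ^ (-1 + 5 * δ) * loopWeight δ q (i, j) := by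
    have e : Y ^ (-2 + 2 * δ) = Y ^ (-1 + 5 * δ) * (Y ^ (-1 - δ) * Y ^ (-2 * δ)) := by
      rw [← Real.rpow_add hY0, ← Real.rpow_add hY0]; congr 1; ring
    have e' : loopWeight δ q (i, j) = br i ^ (-1 - δ) * (br r ^ (-2 * δ) * br r ^ (-1 + δ)) := by
      rw [loopWeight, ← Real.rpow_add (br_pos r)]; congr 2; ring
    have pos : ∀ t (s : ℝ), 0 ≤ br t ^ s := fun t s => Real.rpow_nonneg (br_pos t).le s
    have posY : ∀ s : ℝ, 0 ≤ Y ^ s := fun s => Real.rpow_nonneg hY0.le s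
    rw [e, e', mul_assoc, mul_assoc]
    exact mul_le_mul (rpow_le_rpow_of_neg (br_pos q) bq (by linarith))
      (mul_le_mul (rpow_le_rpow_of_neg (br_pos i) bi (by linarith))
        (mul_le_mul_of_nonneg_right (rpow_le_rpow_of_neg (br_pos r) brr (by linarith)) (pos _ _))
        (mul_nonneg (posY _) (pos _ _)) (pos _ _)) (by
          exact mul_nonneg (posY _) (mul_nonneg (posY _) (pos _ _))) (pos _ _)
  have hdec : loopTerm m a (Q 0 ρ) (Q 1 ρ) (Q 2 ρ) (q + 1) (i, j) -
        loopTerm m a (Q 0 ρ) (Q 1 ρ) (Q 2 ρ) q (i, j) =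
      (((decay a (sqMass m (q + 1) i j) - decay a (sqMass m q i j) : ℝ) : ℂ) * Q 0 ρ (-(r + 1)) +
        (decay a (sqMass m q i j) : ℂ) * (Q 0 ρ (-(r + 1)) - Q 0 ρ (-r))) * Q 1 ρ i * Q 2 ρ j := by
    simp only [loopTerm]
    rw [show q + 1 + i + j = r + 1 by rw [hr]; ring]
    push_cast; ring
  have pr := Real.rpow_nonneg (br_pos r).le (-1 + δ)
  have pY : ∀ s : ℝ, 0 ≤ Y ^ s := fun s => Real.rpow_nonneg hY0.le s
  rw [hdec, norm_mul, norm_mul]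
  have hsum : ‖((decay a (sqMass m (q + 1) i j) - decay a (sqMass m q i j) : ℝ) : ℂ) *
        Q 0 ρ (-(r + 1)) + (decay a (sqMass m q i j) : ℂ) * (Q 0 ρ (-(r + 1)) - Q 0 ρ (-r))‖ ≤
      (2 * 2 / (c / 4 * c) * (2 * C₀) + c⁻¹ * (2 * D₀)) * (Y ^ (-2 : ℝ) * br r ^ (-1 + δ)) := by
    refine (norm_add_le _ _).trans ?_
    rw [norm_mul, norm_mul, Complex.norm_real, Complex.norm_real, Real.norm_eq_abs,
      Real.norm_eq_abs, abs_of_nonneg (decay_nonneg a hxp0), add_mul]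
    refine add_le_add ?_ ?_
    · refine (mul_le_mul hK b0 (norm_nonneg _) (mul_nonneg (by positivity) (pY _))).trans ?_
      have e : Y ^ (-3 : ℝ) * Y ^ δ = Y ^ (-2 : ℝ) * Y ^ (-1 + δ) := by
        rw [← Real.rpow_add hY0, ← Real.rpow_add hY0]; congr 1; ring
      calc _ = 2 * 2 / (c / 4 * c) * (2 * C₀) * (Y ^ (-3 : ℝ) * Y ^ δ) := by ring
        _ ≤ _ := by rw [e]; gcongr
    · refine (mul_le_mul hK0 b0' (norm_nonneg _) (mul_nonneg (by positivity) (pY _))).trans_eq ?_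
      ring
  refine (mul_le_mul (mul_le_mul hsum b1 (norm_nonneg _) (by positivity)) b2 (norm_nonneg _)
    (by positivity)).trans ?_
  have e : Y ^ (-2 : ℝ) * Y ^ δ * Y ^ δ = Y ^ (-2 + 2 * δ) := by
    rw [← Real.rpow_add hY0, ← Real.rpow_add hY0]; congr 1; ring
  calc _ = (2 * 2 / (c / 4 * c) * (2 * C₀) + c⁻¹ * (2 * D₀)) * C₁ * C₂ *
        (Y ^ (-2 : ℝ) * Y ^ δ * Y ^ δ * br r ^ (-1 + δ)) := by ring
    _ ≤ _ := by
      rw [e, mul_assoc _ (br q ^ _)]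
      gcongr

lemma summable_loopTerm {m : ℝ} (hm : 0 < m) {a : ℝ} (ha : 0 < a) {Q : Fin 3 → ℕ → ℤ → ℂ}
    (hQ : ∀ j, IsMild (Q j)) (ρ : ℕ) (q : ℤ) :
    Summable (loopTerm m a (Q 0 ρ) (Q 1 ρ) (Q 2 ρ) q) := by
  obtain ⟨c, hc, hcx⟩ := sqMass_ge hm
  obtain ⟨C₀, hC₀, h0⟩ := (hQ 0).growth 1 one_pos
  obtain ⟨C₁, hC₁, h1⟩ := (hQ 1).growth 1 one_pos
  obtain ⟨C₂, hC₂, h2⟩ := (hQ 2).growth 1 one_pos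
  have hs : Summable fun i : ℤ => br i ^ (-2 : ℝ) := summable_br (by norm_num)
  have hnn : (0 : ℤ → ℝ) ≤ fun i : ℤ => br i ^ (-2 : ℝ) := fun i =>
    Real.rpow_nonneg (br_pos i).le _
  refine Summable.of_norm_bounded
    (((hs.mul_of_nonneg hs hnn hnn)).mul_left (6 / a ^ 3 / c ^ 4 * (C₀ * C₁ * C₂))) ?_
  rintro ⟨i, j⟩
  set Y := lineSize q i j with hY
  have hY1 : 1 ≤ Y := one_le_lineSize q i j
  have hY0 : 0 < Y := lineSize_pos q i j
  obtain ⟨-, b0, b1, b2⟩ := br_le_lineSize q i j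
  have hx : c * Y ^ 2 ≤ sqMass m q i j := hcx q i j
  have hxp : 0 < sqMass m q i j := lt_of_lt_of_le (by positivity) hx
  simp only [Real.rpow_one] at h0 h1 h2
  have g0 : ‖Q 0 ρ (-(q + i + j))‖ ≤ C₀ * Y :=
    (h0 ρ _).trans (mul_le_mul_of_nonneg_left (by rwa [br_neg]) hC₀)
  have g1 : ‖Q 1 ρ i‖ ≤ C₁ * Y := (h1 ρ _).trans (mul_le_mul_of_nonneg_left b1 hC₁)
  have g2 : ‖Q 2 ρ j‖ ≤ C₂ * Y := (h2 ρ _).trans (mul_le_mul_of_nonneg_left b2 hC₂)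
  have gK : decay a (sqMass m q i j) ≤ 6 / a ^ 3 * ((c * Y ^ 2) ^ 4)⁻¹ := by
    refine (decay_le_pow ha hxp).trans ?_
    gcongr
  rw [loopTerm, norm_mul, norm_mul, norm_mul, Complex.norm_real, Real.norm_eq_abs,
    abs_of_nonneg (decay_nonneg a hxp)]
  refine (mul_le_mul gK (mul_le_mul (mul_le_mul g0 g1 (norm_nonneg _) (by positivity)) g2
    (norm_nonneg _) (by positivity)) (by positivity) (by positivity)).trans ?_
  have e : 6 / a ^ 3 * ((c * Y ^ 2) ^ 4)⁻¹ * (C₀ * Y * (C₁ * Y) * (C₂ * Y)) =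
      6 / a ^ 3 / c ^ 4 * (C₀ * C₁ * C₂) * (Y ^ 5)⁻¹ := by field_simp
  have e2 : ∀ t : ℤ, br t ^ (-2 : ℝ) = (br t ^ 2)⁻¹ := fun t => by
    rw [Real.rpow_neg (br_pos t).le, show (2 : ℝ) = (2 : ℕ) by norm_num, Real.rpow_natCast]
  rw [e]
  refine mul_le_mul_of_nonneg_left ?_ (by positivity)
  simp only [e2]
  have := br_pos i
  have := br_pos j
  rw [← mul_inv]
  refine inv_anti₀ (by positivity) ?_
  calc br i ^ 2 * br j ^ 2 ≤ Y ^ 2 * Y ^ 2 := by gcongr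
    _ = Y ^ 4 := by ring
    _ ≤ Y ^ 5 := pow_le_pow_right₀ hY1 (by norm_num)

/-- The melonic loop: the sum over the three internal momenta of a line, with insertions `Q`, after
the subtraction of the value at zero external momentum. -/
def loop (m a : ℝ) (d : Fin 4) (Q : Fin 3 → ℤ → ℂ) (q : ℤ) : ℂ :=
  ∑' u : Fin 3 → ℤ, ((propCoeff m a (d.insertNth q u) : ℂ) - propCoeff m a (d.insertNth 0 u)) *
    ∏ j, Q j (u j)

/-- Momentum conservation determines the first loop momentum from the two other ones. -/
lemma hasSum_loopTerm_iff (m a : ℝ) (d : Fin 4) (Q : Fin 3 → ℤ → ℂ) (q : ℤ) (s : ℂ) :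
    HasSum (fun u : Fin 3 → ℤ => (propCoeff m a (d.insertNth q u) : ℂ) * ∏ j, Q j (u j)) s ↔
      HasSum (loopTerm m a (Q 0) (Q 1) (Q 2) q) s := by
  set e : ℤ × ℤ → Fin 3 → ℤ := fun z => ![-(q + z.1 + z.2), z.1, z.2] with he
  have hinj : Function.Injective e := fun z z' h => by
    have h1 := congrFun h 1
    have h2 := congrFun h 2
    simp only [he, Matrix.cons_val] at h1 h2
    exact Prod.ext h1 h2
  rw [← hinj.hasSum_iff]
  · refine iff_of_eq (congrArg (HasSum · s) (funext fun z => ?_))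
    have hz : ∑ c, (d.insertNth q (e z) : Fin 4 → ℤ) c = 0 := by
      simp only [Fin.sum_univ_succAbove _ d, Fin.insertNth_apply_same,
        Fin.insertNth_apply_succAbove, Fin.sum_univ_three, he, Matrix.cons_val]
      ring
    rw [Function.comp_apply, propCoeff, if_pos hz]
    simp only [Fin.sum_univ_succAbove _ d, Fin.insertNth_apply_same,
      Fin.insertNth_apply_succAbove, Fin.sum_univ_three, Fin.prod_univ_three, loopTerm, decay, he,
      Matrix.cons_val]
    have h : m ^ 2 + ((q : ℝ) ^ 2 + (((-(q + z.1 + z.2) : ℤ) : ℝ) ^ 2 + (z.1 : ℝ) ^ 2 +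
      (z.2 : ℝ) ^ 2)) = sqMass m q z.1 z.2 := by
      simp only [sqMass]; push_cast; ring
    rw [h]
  · intro u hu
    have : propCoeff m a (d.insertNth q u) = 0 := by
      rw [propCoeff, if_neg]
      intro h
      rw [Fin.sum_univ_succAbove _ d, Fin.insertNth_apply_same] at h
      simp only [Fin.insertNth_apply_succAbove, Fin.sum_univ_three] at h
      refine hu ⟨(u 1, u 2), ?_⟩
      funext j
      fin_cases j
      · simp [he]; linarith
      · rfl
      · rfl
    rw [this]; simp

/-- The subtracted loop is mild: a subtraction makes the sum over the two independent loop momenta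
diverge only logarithmically in the external momentum. -/
lemma isMild_loop {m : ℝ} (hm : 0 < m) {a : ℕ → ℝ} (ha : ∀ ρ, 0 < a ρ)
    (ha' : Tendsto a atTop (𝓝 0)) (d : Fin 4) {Q : Fin 3 → ℕ → ℤ → ℂ} (hQ : ∀ j, IsMild (Q j)) :
    IsMild fun ρ => loop m (a ρ) d fun j => Q j ρ := by
  set t : ℕ → ℤ → ℤ × ℤ → ℂ := fun ρ q => loopTerm m (a ρ) (Q 0 ρ) (Q 1 ρ) (Q 2 ρ) q with ht
  have hsum : ∀ ρ q, Summable (t ρ q) := fun ρ q => summable_loopTerm hm (ha ρ) hQ ρ q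
  have hloop : ∀ ρ q, loop m (a ρ) d (fun j => Q j ρ) q = ∑' z, t ρ q z - ∑' z, t ρ 0 z := by
    intro ρ q
    have h1 := (hasSum_loopTerm_iff m (a ρ) d (fun j => Q j ρ) q _).2 (hsum ρ q).hasSum
    have h2 := (hasSum_loopTerm_iff m (a ρ) d (fun j => Q j ρ) 0 _).2 (hsum ρ 0).hasSum
    rw [← (h1.sub h2).tsum_eq]
    simp only [loop, sub_mul]
  have hinc : ∀ ρ q, loop m (a ρ) d (fun j => Q j ρ) (q + 1) - loop m (a ρ) d (fun j => Q j ρ) q =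
      ∑' z, (t ρ (q + 1) z - t ρ q z) := by
    intro ρ q
    rw [hloop, hloop, (hsum ρ (q + 1)).tsum_sub (hsum ρ q)]; ring
  refine isMild_of_increment (fun ρ => by rw [hloop]; exact sub_self _) (fun ε hε => ?_) fun q => ?_
  · obtain ⟨C, hC, h⟩ := loopTerm_increment hm hQ (δ := min ε 1 / 5) (by positivity)
      (by linarith [min_le_right ε 1])
    have hw := hasSum_loopWeight (δ := min ε 1 / 5) (by positivity)
    set W := (∑' i, br i ^ (-1 - min ε 1 / 5)) * ∑' i, br i ^ (-1 - min ε 1 / 5)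
    have hW : 0 ≤ W := mul_self_nonneg _
    refine ⟨C * W, by positivity, fun ρ q => ?_⟩
    rw [hinc]
    refine (tsum_of_norm_bounded ((hw q).mul_left (C * br q ^ (-1 + 5 * (min ε 1 / 5))))
      (h ρ (a ρ) (ha ρ).le q)).trans ?_
    rw [mul_right_comm]
    refine mul_le_mul_of_nonneg_left ?_ (mul_nonneg hC hW)
    exact Real.rpow_le_rpow_of_exponent_le (one_le_br q) (by linarith [min_le_left ε 1])
  · obtain ⟨C, hC, h⟩ := loopTerm_increment hm hQ (δ := 1 / 5) (by norm_num) le_rfl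
    have hw := (hasSum_loopWeight (δ := 1 / 5) (by norm_num) q).summable
    simp only [hinc]
    choose L hL using fun j => (hQ j).limit
    have hlim : ∀ q z, Tendsto (fun ρ => t ρ q z) atTop
        (𝓝 (((sqMass m q z.1 z.2)⁻¹ : ℝ) * (L 0 (-(q + z.1 + z.2)) * L 1 z.1 * L 2 z.2))) := by
      intro q z
      exact ((Complex.continuous_ofReal.tendsto _).comp (tendsto_decay ha' _)).mul
        (((hL 0 _).mul (hL 1 _)).mul (hL 2 _))
    exact ⟨_, tendsto_tsum_of_dominated_convergence (hw.mul_left _)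
      (fun z => (hlim (q + 1) z).sub (hlim q z))
      (Eventually.of_forall fun ρ z => h ρ (a ρ) (ha ρ).le q z)⟩

end Loop

/-! ### The renormalized amplitude in momentum space -/

section Subtraction

variable {n : ℕ} {b : Fin n → Bubble} {G : FeynmanGraph b}

/-- The momenta of a line for given momenta of the faces. -/
def faceMom (p : Face G → ℤ) (l : Line b) (c : Fin 4) : ℤ := p (face G l.1 c)

/-- The factor of a melonic line in the renormalized amplitude: its propagator minus the value at
zero momentum of the external face. -/
def meloFactor (m a : ℝ) (p : Face G → ℤ) (l : Line b) : ℂ :=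
  open Classical in
  (propCoeff m a (faceMom p l) : ℂ) -
    propCoeff m a fun c => if IsMelonic G l c then 0 else faceMom p l c

/-- The renormalized amplitude as a sum over the momenta of the faces: the sum over the meloforests
turns the propagator of each melonic line into a difference. -/
theorem hasSum_smearedRenormalizedAmplitude (hG : G.Connected) (hv : G.NonVacuum) {m : ℝ}
    (hm : 0 < m) {a : ℝ} (ha : 0 < a) {Φ : LegFunction G} {β : LegMom G → ℂ}
    (hβ : Summable fun k => ‖β k‖)
    (hΦ : ∀ gw gb, HasSum (fun k => β k * chr (legPhase k gw gb)) (Φ gw gb)) :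
    HasSum (fun p : Face G → ℤ => (∏ l ∈ melonicLines G, meloFactor m a p l) *
        ((∏ l ∈ G.lines \ melonicLines G, (propCoeff m a (faceMom p l) : ℂ)) * β (legMom p)))
      (smearedRenormalizedAmplitude m a G Φ) := by
  classical
  have hsum : smearedRenormalizedAmplitude m a G Φ = ∑ A ∈ (melonicLines G).powerset,
      (-1 : ℂ) ^ A.card * feynmanIntegral m a G (tauProd (A.image (melonTree G))) Φ := by
    rw [smearedRenormalizedAmplitude, sum_meloforests hG hv]
    refine Finset.sum_congr rfl fun A hA => ?_
    rw [Finset.card_image_of_injOn]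
    intro l hl l' hl' h
    obtain ⟨d, hd⟩ := mem_melonicLines.1 (Finset.mem_powerset.1 hA hl)
    obtain ⟨d', hd'⟩ := mem_melonicLines.1 (Finset.mem_powerset.1 hA hl')
    exact melonTree_injective hG hv hd hd' h
  have hmem : ∀ (A : Set (Line b)) (p : Face G → ℤ), ∀ l ∈ A,
      lineMom A p l = fun c => if IsMelonic G l c then 0 else faceMom p l c := fun A p l hl => by
    funext c; simp [lineMom, faceMom, hl]
  have hnot : ∀ (A : Set (Line b)) (p : Face G → ℤ), ∀ l ∉ A, lineMom A p l = faceMom p l :=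
    fun A p l hl => by funext c; simp [lineMom, faceMom, hl]
  rw [hsum]
  have h := hasSum_sum fun A (hA : A ∈ (melonicLines G).powerset) =>
    (hasSum_feynmanIntegral hG hv hm ha
      (isPlacement_tauProd hG hv (Finset.mem_powerset.1 hA))
      ((Finset.mem_powerset.1 hA).trans melonicLines_subset) hβ hΦ).mul_left ((-1 : ℂ) ^ A.card)
  refine h.congr_fun fun p => ?_
  simp only [meloFactor]
  rw [Finset.prod_sub, Finset.sum_mul]
  refine Finset.sum_congr rfl fun A hA => ?_
  have hA := Finset.mem_powerset.1 hA
  have e1 : ∏ l ∈ G.lines, (propCoeff m a (lineMom (A : Set (Line b)) p l) : ℂ) =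
      (∏ l ∈ A, (propCoeff m a fun c => if IsMelonic G l c then 0 else faceMom p l c : ℂ)) *
        ((∏ l ∈ melonicLines G \ A, (propCoeff m a (faceMom p l) : ℂ)) *
          ∏ l ∈ G.lines \ melonicLines G, (propCoeff m a (faceMom p l) : ℂ)) := by
    rw [← Finset.prod_sdiff (hA.trans melonicLines_subset), mul_comm,
      ← Finset.sdiff_union_sdiff_cancel melonicLines_subset hA, Finset.prod_union,
      mul_comm (∏ l ∈ G.lines \ _, _)]
    · congr 1
      · exact Finset.prod_congr rfl fun l hl => by rw [hmem A p l (Finset.mem_coe.2 hl)]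
      · congr 1
        · refine Finset.prod_congr rfl fun l hl => ?_
          rw [hnot A p l fun h => (Finset.mem_sdiff.1 hl).2 (Finset.mem_coe.1 h)]
        · refine Finset.prod_congr rfl fun l hl => ?_
          rw [hnot A p l fun h => (Finset.mem_sdiff.1 hl).2 (hA (Finset.mem_coe.1 h))]
    · exact Finset.disjoint_left.2 fun l h h' => (Finset.mem_sdiff.1 h).2 (Finset.mem_sdiff.1 h').1
  push_cast
  rw [e1]
  ring

end Subtraction

section PartialSum

variable {F : Type*} [DecidableEq F]

/-- The sum over the variables indexed by `S`, the other ones being kept fixed. -/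
def partialSum {R : Type*} [AddCommMonoid R] [TopologicalSpace R] (S : Finset F)
    (W : (F → ℤ) → R) (p : F → ℤ) : R :=
  ∑' u : S → ℤ, W (Function.updateFinset p S u)

lemma updateFinset_eq_off {S : Finset F} (p : F → ℤ) (u : S → ℤ) {f : F} (hf : f ∉ S) :
    Function.updateFinset p S u f = p f := by simp [Function.updateFinset, hf]

lemma updateFinset_injective (p : F → ℤ) (S : Finset F) :
    Function.Injective fun u : S → ℤ => Function.updateFinset p S u := fun u u' h => by
  funext i
  have := congrFun h i.1
  simpa [Function.updateFinset] using this

section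

variable {R : Type*} [AddCommMonoid R] [TopologicalSpace R] {W : (F → ℤ) → R}

lemma partialSum_empty [T2Space R] (p : F → ℤ) : partialSum ∅ W p = W p := by
  rw [partialSum, tsum_eq_single default fun u hu => absurd (Subsingleton.elim u _) hu]
  simp

lemma partialSum_univ [Fintype F] (p : F → ℤ) : partialSum Finset.univ W p = ∑' q, W q := by
  rw [partialSum, ← (Equiv.arrowCongr (Equiv.subtypeUnivEquiv (Finset.mem_univ (α := F)))
    (Equiv.refl ℤ)).tsum_eq]
  refine tsum_congr fun u => congrArg W ?_
  rw [Function.updateFinset_univ]; rfl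

lemma partialSum_union_eq {S T : Finset F} (h : Disjoint S T) (p : F → ℤ) :
    partialSum (S ∪ T) W p = ∑' z : (S → ℤ) × (T → ℤ),
      W (Function.updateFinset (Function.updateFinset p S z.1) T z.2) := by
  rw [partialSum, ← (Equiv.piFinsetUnion (fun _ => ℤ) h).tsum_eq]
  refine tsum_congr fun z => ?_
  rw [Function.updateFinset_updateFinset h]

end

lemma partialSum_union_ennreal {S T : Finset F} (h : Disjoint S T) (W : (F → ℤ) → ENNReal)
    (p : F → ℤ) : partialSum (S ∪ T) W p = partialSum S (partialSum T W) p := by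
  rw [partialSum_union_eq h]
  exact ENNReal.tsum_prod (f := fun u v =>
    W (Function.updateFinset (Function.updateFinset p S u) T v))

lemma partialSum_mono {S : Finset F} {W W' : (F → ℤ) → ENNReal} (p : F → ℤ)
    (h : ∀ q, (∀ f ∉ S, q f = p f) → W q ≤ W' q) : partialSum S W p ≤ partialSum S W' p :=
  ENNReal.tsum_le_tsum fun _ => h _ fun _ hf => updateFinset_eq_off _ _ hf

lemma partialSum_mul_right_ennreal {S : Finset F} (W c : (F → ℤ) → ENNReal) (p : F → ℤ)
    (h : ∀ q, (∀ f ∉ S, q f = p f) → c q = c p) :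
    partialSum S (fun q => W q * c q) p = partialSum S W p * c p := by
  rw [partialSum, partialSum, ← ENNReal.tsum_mul_right]
  exact tsum_congr fun u => by rw [h _ fun f hf => updateFinset_eq_off _ _ hf]

lemma partialSum_mul_right {S : Finset F} (W c : (F → ℤ) → ℂ) (p : F → ℤ)
    (h : ∀ q, (∀ f ∉ S, q f = p f) → c q = c p) :
    partialSum S (fun q => W q * c q) p = partialSum S W p * c p := by
  rw [partialSum, partialSum, ← tsum_mul_right]
  exact tsum_congr fun u => by rw [h _ fun f hf => updateFinset_eq_off _ _ hf]

lemma partialSum_union {S T : Finset F} (h : Disjoint S T) {W : (F → ℤ) → ℂ} (hW : Summable W)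
    (p : F → ℤ) : partialSum (S ∪ T) W p = partialSum S (partialSum T W) p := by
  rw [partialSum_union_eq h, Summable.tsum_prod]; rfl
  refine hW.comp_injective (i := fun z : (S → ℤ) × (T → ℤ) =>
    Function.updateFinset (Function.updateFinset p S z.1) T z.2) fun z z' e => ?_
  simp only [Function.updateFinset_updateFinset h] at e
  exact (Equiv.piFinsetUnion (fun _ => ℤ) h).injective (updateFinset_injective _ _ e)

end PartialSum

/-! ### Summation over the faces of the melonic lines -/

section Elimination

variable {n : ℕ} {b : Fin n → Bubble} {G : FeynmanGraph b}

instance : DecidableEq (Face G) := Classical.decEq _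

instance : Fintype (Face G) := Fintype.ofFinite _

lemma isMild_prod {ι : Type*} (s : Finset ι) {Q : ι → ℕ → ℤ → ℂ} (h : ∀ i ∈ s, IsMild (Q i)) :
    IsMild fun ρ q => ∏ i ∈ s, Q i ρ q := by
  classical
  induction s using Finset.induction_on with
  | empty => simpa using isMild_one
  | insert i s hi ih =>
    simp only [Finset.prod_insert hi]
    exact (h i (Finset.mem_insert_self i s)).mul
      (ih fun j hj => h j (Finset.mem_insert_of_mem hj))

variable (G) in
open Classical in
/-- The colour of the external face of a melonic line. -/
def melonColour (l : Line b) : Fin 4 := if h : ∃ d, IsMelonic G l d then h.choose else 0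

lemma isMelonic_melonColour {l : Line b} (hl : l ∈ melonicLines G) :
    IsMelonic G l (melonColour G l) := by
  have h := mem_melonicLines.1 hl
  rw [melonColour, dif_pos h]
  exact h.choose_spec

lemma IsMelonic.mem_melonicLines {l : Line b} {d : Fin 4} (h : IsMelonic G l d) :
    l ∈ melonicLines G := TGFT.mem_melonicLines.2 ⟨d, h⟩

variable (hG : G.Connected) (hv : G.NonVacuum)

include hG hv in
lemma IsMelonic.melonColour_eq {l : Line b} {d : Fin 4} (h : IsMelonic G l d) :
    melonColour G l = d :=
  (isMelonic_melonColour h.mem_melonicLines).colour_unique hG hv h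

variable (G) in
/-- The closed faces of the melonic lines of the set `E`. -/
def innerFaces (E : Finset (Line b)) : Finset (Face G) :=
  E.biUnion fun l => Finset.univ.image fun j => face G l.1 ((melonColour G l).succAbove j)

lemma mem_innerFaces {E : Finset (Line b)} {f : Face G} :
    f ∈ innerFaces G E ↔ ∃ l ∈ E, ∃ c, c ≠ melonColour G l ∧ face G l.1 c = f := by
  simp only [innerFaces, Finset.mem_biUnion, Finset.mem_image, Finset.mem_univ, true_and]
  refine exists_congr fun l => and_congr_right fun _ => ⟨?_, ?_⟩
  · rintro ⟨j, h⟩; exact ⟨_, Fin.succAbove_ne _ _, h⟩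
  · rintro ⟨c, hc, h⟩
    obtain ⟨j, rfl⟩ := Fin.exists_succAbove_eq hc
    exact ⟨j, h⟩

lemma isChild_of_face_eq {l k : Line b} (hl : l ∈ melonicLines G) (hk : k ∈ G.lines) {c : Fin 4}
    (hc : c ≠ melonColour G l) (hne : k ≠ l) (h : face G k.1 c = face G l.1 c) : IsChild G k l :=
  ⟨_, c, isMelonic_melonColour hl, hc, hk, hne, h⟩

include hG hv in
lemma IsChild.face_eq {k l : Line b} (h : IsChild G k l) :
    face G k.1 (melonColour G k) = face G l.1 (melonColour G k) ∧
      melonColour G k ≠ melonColour G l := by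
  obtain ⟨d, c, h1, h2, h3, h4, h5⟩ := h
  rw [(h1.child h2 k h3 h5 h4).melonColour_eq hG hv, h1.melonColour_eq hG hv]
  exact ⟨h5, h2⟩

include hG hv in
lemma exists_no_parent {E : Finset (Line b)} (hE : E.Nonempty) :
    ∃ l ∈ E, ∀ l' ∈ E, ¬ IsChild G l l' := by
  have hwf : WellFounded (Relation.TransGen (IsChild G)) := (wellFounded_isChild hG hv).transGen
  have : Std.Irrefl (flip (Relation.TransGen (IsChild G))) :=
    ⟨fun l h => hwf.irrefl.irrefl l h⟩
  have : IsTrans (Line b) (flip (Relation.TransGen (IsChild G))) :=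
    ⟨fun l l' l'' h h' => Relation.TransGen.trans h' h⟩
  have hwf' : WellFounded (flip (Relation.TransGen (IsChild G))) :=
    Finite.wellFounded_of_trans_of_irrefl _
  obtain ⟨l, hl, h⟩ := hwf'.has_min (E : Set (Line b)) hE
  exact ⟨l, hl, fun l' hl' hc => h l' hl' (.single hc)⟩

include hG hv in
/-- The sum over the three closed faces of a melonic line. -/
lemma partialSum_meloFactor (m : ℝ) (a : ℝ) {l : Line b} (hl : l ∈ melonicLines G)
    (C : Finset (Line b)) (hC : ∀ k ∈ C, IsChild G k l) (R : Line b → ℤ → ℂ) (p : Face G → ℤ) :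
    partialSum (innerFaces G {l})
        (fun q => (∏ k ∈ C, R k (q (face G k.1 (melonColour G k)))) * meloFactor m a q l) p =
      loop m a (melonColour G l) (fun j q => ∏ k ∈ C.filter fun k =>
        melonColour G k = (melonColour G l).succAbove j, R k q)
          (p (face G l.1 (melonColour G l))) := by
  classical
  set d := melonColour G l with hd
  have hN : ∀ j : Fin 3, face G l.1 (d.succAbove j) ∈ innerFaces G {l} := fun j =>
    mem_innerFaces.2 ⟨l, Finset.mem_singleton_self l, _, Fin.succAbove_ne _ _, rfl⟩
  let e : Fin 3 ≃ innerFaces G {l} := Equiv.ofBijective (fun j => ⟨_, hN j⟩) <| by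
    refine ⟨fun j j' h => ?_, fun f => ?_⟩
    · exact Fin.succAbove_right_injective (face_colour (Subtype.ext_iff.1 h))
    · obtain ⟨l', hl', c, hc, hf⟩ := mem_innerFaces.1 f.2
      obtain rfl := Finset.mem_singleton.1 hl'
      obtain ⟨j, rfl⟩ := Fin.exists_succAbove_eq hc
      exact ⟨j, Subtype.ext hf⟩
  rw [partialSum, ← (Equiv.arrowCongr e (Equiv.refl ℤ)).tsum_eq, loop]
  refine tsum_congr fun v => ?_
  set q := Function.updateFinset p (innerFaces G {l}) (Equiv.arrowCongr e (Equiv.refl ℤ) v)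
  have hq : ∀ j, q (face G l.1 (d.succAbove j)) = v j := fun j => by
    simp only [q, Function.updateFinset, hN, dif_pos]
    change v (e.symm (e j)) = _
    rw [Equiv.symm_apply_apply]
  have hqd : q (face G l.1 d) = p (face G l.1 d) := by
    refine updateFinset_eq_off _ _ fun h => ?_
    obtain ⟨l', hl', c, hc, hf⟩ := mem_innerFaces.1 h
    obtain rfl := Finset.mem_singleton.1 hl'
    exact hc (face_colour hf)
  have h1 : faceMom q l = d.insertNth (p (face G l.1 d)) v := by
    funext c
    rcases Fin.eq_self_or_eq_succAbove d c with rfl | ⟨j, rfl⟩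
    · rw [Fin.insertNth_apply_same]; exact hqd
    · rw [Fin.insertNth_apply_succAbove]; exact hq j
  have h2 : (fun c => if IsMelonic G l c then 0 else faceMom q l c) = d.insertNth 0 v := by
    funext c
    rcases Fin.eq_self_or_eq_succAbove d c with rfl | ⟨j, rfl⟩
    · rw [Fin.insertNth_apply_same, if_pos (isMelonic_melonColour hl)]
    · rw [Fin.insertNth_apply_succAbove, if_neg]
      · exact hq j
      · intro h
        exact Fin.succAbove_ne d j (h.melonColour_eq hG hv).symm
  have h3 : ∏ k ∈ C, R k (q (face G k.1 (melonColour G k))) =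
      ∏ j, ∏ k ∈ C.filter fun k => melonColour G k = d.succAbove j, R k (v j) := by
    rw [← Finset.prod_fiberwise C (melonColour G), Fin.prod_univ_succAbove _ d,
      Finset.prod_eq_one, one_mul]
    · refine Finset.prod_congr rfl fun j _ => Finset.prod_congr rfl fun k hk => ?_
      obtain ⟨hkC, hkj⟩ := Finset.mem_filter.1 hk
      rw [((hC k hkC).face_eq hG hv).1, hkj, hq]
    · intro k hk
      obtain ⟨hkC, hkj⟩ := Finset.mem_filter.1 hk
      exact absurd hkj ((hC k hkC).face_eq hG hv).2
  rw [h3, mul_comm, meloFactor, h1]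
  congr 3
  rw [← h1, ← h2]

/-- The functions of the momenta of the faces which do not depend on the faces of `S`. -/
def IndepOf {α : Type*} (S : Finset (Face G)) (W : (Face G → ℤ) → α) : Prop :=
  ∀ p q, (∀ f ∉ S, p f = q f) → W p = W q

include hG hv in
/-- Summing over the closed faces of a set of melonic lines, which is closed under insertions,
leaves a mild function of the momentum of the external face of each of its outermost lines. -/
theorem exists_mild_factors {m : ℝ} (hm : 0 < m) {a : ℕ → ℝ} (ha : ∀ ρ, 0 < a ρ)
    (ha' : Tendsto a atTop (𝓝 0)) (E : Finset (Line b)) :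
    E ⊆ melonicLines G → (∀ l ∈ E, ∀ k, IsChild G k l → k ∈ E) →
    ∃ R : Line b → ℕ → ℤ → ℂ, (∀ k, IsMild (R k)) ∧ ∀ ρ (W : (Face G → ℤ) → ℂ),
      IndepOf (innerFaces G E) W →
      Summable (fun p => (∏ l ∈ E, meloFactor m (a ρ) p l) * W p) → ∀ p,
        partialSum (innerFaces G E) (fun q => (∏ l ∈ E, meloFactor m (a ρ) q l) * W q) p =
          (open Classical in ∏ k ∈ E.filter fun k => ∀ l ∈ E, ¬ IsChild G k l,
            R k ρ (p (face G k.1 (melonColour G k)))) * W p := by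
  classical
  induction E using Finset.strongInduction with
  | H E ih =>
    intro hE hclosed
    rcases E.eq_empty_or_nonempty with rfl | hne
    · refine ⟨fun _ _ _ => 1, fun _ => isMild_one, fun ρ W _ _ p => ?_⟩
      simp only [innerFaces, Finset.biUnion_empty, partialSum_empty]
      simp
    obtain ⟨l, hl, hmax⟩ := exists_no_parent hG hv hne
    set E₀ := E.erase l with hE₀
    have hE₀E : E₀ ⊆ E := Finset.erase_subset _ _
    have hlE₀ : l ∉ E₀ := Finset.notMem_erase l E
    have hlD := hE hl
    obtain ⟨R₀, hR₀, h₀⟩ := ih E₀ (Finset.erase_ssubset hl) (hE₀E.trans hE) fun l' hl' k hk =>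
      Finset.mem_erase.2 ⟨fun e => hmax l' (hE₀E hl') (e ▸ hk), hclosed l' (hE₀E hl') k hk⟩
    set C := E₀.filter fun k => IsChild G k l with hC
    set Q : Fin 3 → ℕ → ℤ → ℂ := fun j ρ q =>
      ∏ k ∈ C.filter fun k => melonColour G k = (melonColour G l).succAbove j, R₀ k ρ q with hQ
    refine ⟨Function.update R₀ l fun ρ => loop m (a ρ) (melonColour G l) fun j => Q j ρ,
      fun k => ?_, fun ρ W hW hs p => ?_⟩
    · by_cases hk : k = l
      · subst hk
        rw [Function.update_self]
        exact isMild_loop hm ha ha' _ fun j => isMild_prod _ fun k _ => hR₀ k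
      · rw [Function.update_of_ne hk]; exact hR₀ k
    have hunion : innerFaces G E = innerFaces G {l} ∪ innerFaces G E₀ := by
      rw [innerFaces, innerFaces, innerFaces, ← Finset.insert_erase hl, Finset.biUnion_insert,
        Finset.singleton_biUnion]
    -- no face of `l` is an inner face of another line, since `l` is outermost
    have hout : ∀ c, face G l.1 c ∉ innerFaces G E₀ := by
      intro c h
      obtain ⟨k, hk, c', hc', e⟩ := mem_innerFaces.1 h
      obtain rfl := face_colour e
      refine hmax k (hE₀E hk) (isChild_of_face_eq (hE (hE₀E hk)) (melonicLines_subset hlD) hc' ?_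
        e.symm)
      exact fun h => hlE₀ (h ▸ hk)
    have hdisj : Disjoint (innerFaces G {l}) (innerFaces G E₀) := by
      refine Finset.disjoint_left.2 fun f hf hf' => ?_
      obtain ⟨l', hl', c, -, rfl⟩ := mem_innerFaces.1 hf
      obtain rfl := Finset.mem_singleton.1 hl'
      exact hout c hf'
    have hW' : IndepOf (innerFaces G E₀) fun p => meloFactor m (a ρ) p l * W p := by
      intro p q h
      have h1 : faceMom p l = faceMom q l := funext fun c => h _ (hout c)
      simp only [meloFactor, h1]
      rw [hW p q fun f hf => h f fun hf' => hf (hunion ▸ Finset.mem_union_right _ hf')]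
    have hprod : (fun p => (∏ l ∈ E, meloFactor m (a ρ) p l) * W p) =
        fun p => (∏ l ∈ E₀, meloFactor m (a ρ) p l) * (meloFactor m (a ρ) p l * W p) := by
      funext p
      rw [← Finset.mul_prod_erase E _ hl]; ring
    rw [hunion, partialSum_union hdisj hs, hprod]
    rw [hprod] at hs
    rw [funext (h₀ ρ _ hW' hs)]
    -- the outermost lines of `E₀` are those of `E` and the lines inserted on `l`
    set O := (E₀.filter fun k => ∀ l' ∈ E₀, ¬ IsChild G k l').filter fun k => ¬ IsChild G k l
    have hsplit : ∀ q : Face G → ℤ, ∏ k ∈ E₀.filter fun k => ∀ l' ∈ E₀, ¬ IsChild G k l',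
          R₀ k ρ (q (face G k.1 (melonColour G k))) =
        (∏ k ∈ C, R₀ k ρ (q (face G k.1 (melonColour G k)))) *
          ∏ k ∈ O, R₀ k ρ (q (face G k.1 (melonColour G k))) := by
      intro q
      rw [← Finset.prod_filter_mul_prod_filter_not _ fun k => IsChild G k l]
      congr 1
      refine Finset.prod_congr ?_ fun _ _ => rfl
      ext k
      simp only [hC, Finset.mem_filter]
      refine ⟨fun h => ⟨h.1.1, h.2⟩, fun h => ⟨⟨h.1, fun l' hl' hk => hlE₀ ?_⟩, h.2⟩⟩
      rwa [h.2.parent_unique hG hv hk]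
    have hroots : (E.filter fun k => ∀ l ∈ E, ¬ IsChild G k l) = insert l O := by
      ext k
      simp only [O, Finset.mem_filter, Finset.mem_insert, hE₀, Finset.mem_erase]
      constructor
      · rintro ⟨hk, h⟩
        by_cases e : k = l
        · exact Or.inl e
        · exact Or.inr ⟨⟨⟨e, hk⟩, fun l' hl' => h l' hl'.2⟩, h l hl⟩
      · rintro (rfl | ⟨⟨⟨h1, h2⟩, h3⟩, h4⟩)
        · exact ⟨hl, hmax⟩
        · refine ⟨h2, fun l' hl' => ?_⟩
          by_cases e : l' = l
          · rwa [e]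
          · exact h3 l' ⟨e, hl'⟩
    have hlO : l ∉ O := fun h => hlE₀ (Finset.mem_filter.1 (Finset.mem_filter.1 h).1).1
    have hre : (fun q : Face G → ℤ =>
        (∏ k ∈ E₀.filter fun k => ∀ l' ∈ E₀, ¬ IsChild G k l',
          R₀ k ρ (q (face G k.1 (melonColour G k)))) * (meloFactor m (a ρ) q l * W q)) =
        fun q => ((∏ k ∈ C, R₀ k ρ (q (face G k.1 (melonColour G k)))) * meloFactor m (a ρ) q l) *
          ((∏ k ∈ O, R₀ k ρ (q (face G k.1 (melonColour G k)))) * W q) := by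
      funext q
      rw [hsplit]; ring
    rw [hre, partialSum_mul_right, partialSum_meloFactor hG hv m (a ρ) hlD C
      (fun k hk => (Finset.mem_filter.1 hk).2) (fun k => R₀ k ρ) p, hroots,
      Finset.prod_insert hlO, Function.update_self, ← mul_assoc]
    · congr 2
      refine Finset.prod_congr rfl fun k hk => ?_
      rw [Function.update_of_ne]
      rintro rfl; exact hlO hk
    · intro q hq
      congr 1
      · refine Finset.prod_congr rfl fun k hk => ?_
        obtain ⟨hk1, hk2⟩ := Finset.mem_filter.1 hk
        have hk3 := (Finset.mem_filter.1 hk1).1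
        rw [hq]
        intro hf
        obtain ⟨l', hl', c, hc, e⟩ := mem_innerFaces.1 hf
        obtain rfl := Finset.mem_singleton.1 hl'
        obtain rfl := face_colour e
        exact hk2 (isChild_of_face_eq hlD (melonicLines_subset (hE (hE₀E hk3))) hc
          (fun h => hlE₀ (h ▸ hk3)) e.symm)
      · exact hW q p fun f hf => hq f fun hf' => hf (hunion ▸ Finset.mem_union_left _ hf')

end Elimination

/-! ### The order in which the other lines are summed -/

section Old

variable {n : ℕ} {b : Fin n → Bubble} {G : FeynmanGraph b}

lemma mem_externalFaces {f : Face G} :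
    f ∈ externalFaces G ↔ ∃ (w : WhiteLeg G) (c : Fin 4), face G w.1 c = f := by
  simp [externalFaces]

variable (G) in
/-- Faces whose momentum is fixed while the lines of `E` are summed: the external faces, and the
faces running through another non-melonic line. -/
def IsOld (E : Finset (Line b)) (f : Face G) : Prop :=
  f ∈ externalFaces G ∨ ∃ k ∈ G.lines \ melonicLines G, k ∉ E ∧ ∃ c, face G k.1 c = f

lemma exists_line_of_not_isOld {E : Finset (Line b)} {w y : White b} {c : Fin 4}
    (h : ¬ IsOld G E (face G w c)) (hy : face G y c = face G w c) :
    ∃ k ∈ G.lines, k.1 = y ∧ (k ∈ E ∨ k ∈ melonicLines G) := by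
  by_cases hk : ∃ k ∈ G.lines, k.1 = y
  · obtain ⟨k, hk, rfl⟩ := hk
    refine ⟨k, hk, rfl, ?_⟩
    by_contra! hcon
    exact h (Or.inr ⟨k, Finset.mem_sdiff.2 ⟨hk, hcon.2⟩, hcon.1, c, hy⟩)
  · push Not at hk
    exact absurd (Or.inl (mem_externalFaces.2 ⟨⟨y, hk⟩, c, hy⟩)) h

/-- A closed face of a melonic line only runs through melonic lines, hence is never old. -/
lemma not_isOld_of_isMelonic {E : Finset (Line b)} {l : Line b} {d c : Fin 4}
    (h : IsMelonic G l d) (hc : c ≠ d) : ¬ IsOld G E (face G l.1 c) := by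
  rintro (hf | ⟨k, hk, -, c', e⟩)
  · obtain ⟨w, c', e⟩ := mem_externalFaces.1 hf
    obtain rfl := face_colour e
    obtain ⟨k, hk, hkw⟩ := h.closed hc _ e
    exact w.2 k hk hkw
  · obtain rfl := face_colour e
    obtain ⟨hk1, hk2⟩ := Finset.mem_sdiff.1 hk
    by_cases hkl : k = l
    · exact hk2 (hkl ▸ h.mem_melonicLines)
    · exact hk2 (h.child hc k hk1 e hkl).mem_melonicLines

/-- If three of the four faces of a non-melonic line are new, then one of them runs through another
line which remains to be summed: otherwise the line would be melonic. -/
lemma exists_common_face {E : Finset (Line b)} {l : Line b} (hl : l ∈ G.lines \ melonicLines G)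
    {d : Fin 4} (h : ∀ c, c ≠ d → ¬ IsOld G E (face G l.1 c)) :
    ∃ c, c ≠ d ∧ ∃ k ∈ E, k ≠ l ∧ face G k.1 c = face G l.1 c := by
  obtain ⟨hl1, hl2⟩ := Finset.mem_sdiff.1 hl
  by_contra! hcon
  refine hl2 (IsMelonic.mem_melonicLines (d := d) (.mk hl1 (fun c hc y hy => ?_)
    fun c hc k hk hf hkl => ?_))
  · obtain ⟨k, hk, e, -⟩ := exists_line_of_not_isOld (h c hc) hy
    exact ⟨k, hk, e⟩
  · obtain ⟨k', hk', e, hE | hD⟩ := exists_line_of_not_isOld (h c hc) hf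
    · obtain rfl := line_eq_of_white hk' hk e
      exact absurd hf (hcon c hc k' hE hkl)
    · obtain rfl := line_eq_of_white hk' hk e
      obtain ⟨d', hd'⟩ := mem_melonicLines.1 hD
      by_cases hcd : c = d'
      · rwa [hcd]
      · exact absurd (hd'.child hcd l hl1 hf.symm (Ne.symm hkl)).mem_melonicLines hl2

variable (hG : G.Connected) (hv : G.NonVacuum)

include hG hv in
/-- Among the lines which remain to be summed, there is one with an old face. -/
lemma exists_isOld {E : Finset (Line b)} (hE : E ⊆ G.lines \ melonicLines G) (hne : E.Nonempty) :
    ∃ l ∈ E, ∃ c, IsOld G E (face G l.1 c) := by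
  classical
  by_contra! hcon
  -- add to `E` the melonic lines whose outermost ancestor is inserted on a face which is not old
  set D := (melonicLines G).filter fun k => ∀ r c, Relation.ReflTransGen (IsChild G) k r →
    IsMelonic G r c → ¬ IsOld G E (face G r.1 c) with hD
  have hEl : ∀ l ∈ E, l ∈ G.lines ∧ l ∉ melonicLines G := fun l hl => Finset.mem_sdiff.1 (hE hl)
  have hmemD : ∀ {k}, k ∈ D ↔ k ∈ melonicLines G ∧ ∀ r c, Relation.ReflTransGen (IsChild G) k r →
      IsMelonic G r c → ¬ IsOld G E (face G r.1 c) := Finset.mem_filter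
  have hnot : ∀ {k}, k ∈ melonicLines G → k ∉ D → ∃ r c, Relation.ReflTransGen (IsChild G) k r ∧
      IsMelonic G r c ∧ IsOld G E (face G r.1 c) := by
    intro k hk hkD
    by_contra! h
    exact hkD (hmemD.2 ⟨hk, h⟩)
  have hup : ∀ {l k}, IsChild G l k → l ∈ D → k ∈ melonicLines G → k ∈ D := fun hlk hl hk =>
    hmemD.2 ⟨hk, fun r c hr => (hmemD.1 hl).2 r c (.head hlk hr)⟩
  have hdown : ∀ {l k}, IsChild G k l → l ∈ D → k ∈ D := by
    intro l k hkl hl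
    obtain ⟨c, hc⟩ := hkl.isMelonic
    refine hmemD.2 ⟨hc.mem_melonicLines, fun r c' hr hm => ?_⟩
    rcases Relation.ReflTransGen.cases_head hr with rfl | ⟨k₁, hk₁, h⟩
    · obtain ⟨d, c₁, h1, h2, h3, h4, h5⟩ := hkl
      obtain rfl := hm.colour_unique hG hv (h1.child h2 k h3 h5 h4)
      rw [h5]
      exact not_isOld_of_isMelonic h1 h2
    · obtain rfl := hk₁.parent_unique hG hv hkl
      exact (hmemD.1 hl).2 r c' h hm
  -- a melonic line outside of `D` cannot lie on a face which is not old, together with a line which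
  -- is in `D` or not melonic
  have key : ∀ l c k, l ∈ G.lines → (l ∈ melonicLines G → l ∈ D ∧ IsMelonic G l c) →
      ¬ IsOld G E (face G l.1 c) → k ∈ melonicLines G → k ∉ D → face G k.1 c = face G l.1 c →
      False := by
    intro l c k hl hlD hold hk hkD hf
    have hne : l ≠ k := fun h => hkD (h ▸ (hlD (h ▸ hk)).1)
    obtain ⟨d, hd⟩ := mem_melonicLines.1 hk
    by_cases hcd : c = d
    · subst hcd
      obtain ⟨r, c', hr, hm, ho⟩ := hnot hk hkD
      rcases Relation.ReflTransGen.cases_head hr with rfl | ⟨k₁, hk₁, h⟩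
      · obtain rfl := hm.colour_unique hG hv hd
        exact hold (hf ▸ ho)
      · obtain ⟨d₁, c₁, h1, h2, h3, h4, h5⟩ := hk₁
        obtain rfl := hd.colour_unique hG hv (h1.child h2 k h3 h5 h4)
        have hlk : l ≠ k₁ := fun e => by
          subst e
          exact h2 ((hlD h1.mem_melonicLines).2.colour_unique hG hv h1)
        have hlch : IsChild G l k₁ := ⟨d₁, c, h1, h2, hl, hlk, hf.symm.trans h5⟩
        obtain ⟨d', hd'⟩ := hlch.isMelonic
        exact (hmemD.1 (hlD hd'.mem_melonicLines).1).2 r c' (.head hlch h) hm ho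
    · have hlch : IsChild G l k := ⟨d, c, hd, hcd, hl, hne, hf.symm⟩
      obtain ⟨d', hd'⟩ := hlch.isMelonic
      exact hkD (hup hlch (hlD hd'.mem_melonicLines).1 hk)
  obtain ⟨l, hl, c, y, hy, hyH⟩ := exists_open_face hG hv (H := E ∪ D)
    (hne.mono Finset.subset_union_left)
    (Finset.union_subset (fun l hl => (hEl l hl).1)
      ((Finset.filter_subset _ _).trans melonicLines_subset))
  have fin : ∀ (_ : l ∈ G.lines) (_ : l ∈ melonicLines G → l ∈ D ∧ IsMelonic G l c),
      ¬ IsOld G E (face G l.1 c) → False := by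
    intro h1 h2 h3
    obtain ⟨k, hk, rfl, hkE | hkD⟩ := exists_line_of_not_isOld h3 hy
    · exact hyH k (Finset.mem_union_left _ hkE) rfl
    · by_cases hkD' : k ∈ D
      · exact hyH k (Finset.mem_union_right _ hkD') rfl
      · exact key l c k h1 h2 h3 hkD hkD' hy
  rcases Finset.mem_union.1 hl with hlE | hlD
  · exact fin (hEl l hlE).1 (fun h => absurd h (hEl l hlE).2) (hcon l hlE c)
  · have hlm := (hmemD.1 hlD).1
    have hd := isMelonic_melonColour hlm
    by_cases hc : c = melonColour G l
    · rw [← hc] at hd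
      exact fin hd.mem (fun _ => ⟨hlD, hd⟩) ((hmemD.1 hlD).2 l c .refl hd)
    · obtain ⟨k, hk, rfl⟩ := hd.closed hc y hy
      by_cases hkl : k = l
      · exact hyH k (hkl ▸ hl) rfl
      · exact hyH k (Finset.mem_union_right _
          (hdown (isChild_of_face_eq hlm hk hc hkl hy) hlD)) rfl

end Old

/-! ### Power counting for the other lines -/

section OneLine

variable {F : Type*} [DecidableEq F]

lemma partialSum_singleton (f : F) (W : (F → ℤ) → ENNReal) (p : F → ℤ) :
    partialSum {f} W p = ∑' z : ℤ, W (Function.update p f z) := by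
  rw [partialSum, ← (Equiv.funUnique ({f} : Finset F) ℤ).symm.tsum_eq]
  refine tsum_congr fun z => congrArg W ?_
  rw [Function.updateFinset_singleton]; rfl

lemma partialSum_prod (S : Finset F) (g : ℤ → ENNReal) (p : F → ℤ) :
    partialSum S (fun q => ∏ f ∈ S, g (q f)) p = (∑' z, g z) ^ S.card := by
  induction S using Finset.induction_on generalizing p with
  | empty => rw [partialSum_empty]; simp
  | insert f S hf ih =>
    have hd : Disjoint S {f} := Finset.disjoint_singleton_right.2 hf
    rw [Finset.insert_eq, Finset.union_comm, partialSum_union_ennreal hd]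
    have : partialSum {f} (fun q => ∏ i ∈ S ∪ {f}, g (q i)) =
        fun q => (∏ i ∈ S, g (q i)) * ∑' z, g z := by
      funext q
      rw [partialSum_singleton, ← ENNReal.tsum_mul_left]
      refine tsum_congr fun z => ?_
      rw [Finset.prod_union hd, Finset.prod_singleton, Function.update_self]
      congr 1
      refine Finset.prod_congr rfl fun i hi => ?_
      rw [Function.update_of_ne fun h : i = f => hf (h ▸ hi)]
    rw [this, partialSum_mul_right_ennreal _ _ _ fun _ _ => rfl, ih,
      Finset.card_union_of_disjoint hd,
      Finset.card_singleton, pow_succ]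

/-- A negative power of the weight of a momentum, with values in the extended non-negative reals. -/
def brPow (s : ℝ) (q : ℤ) : ENNReal := ENNReal.ofReal (br q ^ s)

lemma tsum_brPow_ne_top {s : ℝ} (hs : s < -1) : ∑' q, brPow s q ≠ ⊤ :=
  (summable_br hs).tsum_ofReal_ne_top

lemma br_rpow_nonneg (q : ℤ) (s : ℝ) : 0 ≤ br q ^ s := Real.rpow_nonneg (br_pos q).le s

lemma br_rpow_le_one (q : ℤ) {s : ℝ} (hs : s ≤ 0) : br q ^ s ≤ 1 :=
  Real.rpow_le_one_of_one_le_of_nonpos (one_le_br q) hs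

/-- The size of the momenta of a line whose faces are `φ c`. -/
def totalSize (φ : Fin 4 → F) (p : F → ℤ) : ℝ := ∑ c, br (p (φ c))

omit [DecidableEq F] in
lemma br_le_totalSize (φ : Fin 4 → F) (p : F → ℤ) (c : Fin 4) : br (p (φ c)) ≤ totalSize φ p :=
  Finset.single_le_sum (f := fun c => br (p (φ c))) (fun _ _ => (br_pos _).le) (Finset.mem_univ c)

omit [DecidableEq F] in
lemma one_le_totalSize (φ : Fin 4 → F) (p : F → ℤ) : 1 ≤ totalSize φ p :=
  (one_le_br _).trans (br_le_totalSize φ p 0)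

omit [DecidableEq F] in
lemma totalSize_pos (φ : Fin 4 → F) (p : F → ℤ) : 0 < totalSize φ p :=
  zero_lt_one.trans_le (one_le_totalSize φ p)

/-- The decay of a propagator is shared between the momenta `T` which are summed, each of which
needs slightly more than one power, and the old momenta, which receive a small power. If there are
two of them, then one must already be damped by the lines summed before. -/
lemma totalSize_rpow_mul_le {φ : Fin 4 → F} {T N U : Finset F} (hTN : T ⊆ N)
    (hN : N ⊆ Finset.univ.image φ) (hT : T.card ≤ 1 ∨ T.card = 2 ∧ (T ∩ U).Nonempty) {ε : ℝ}
    (hε : 0 < ε) (hε' : ε ≤ 1) (p : F → ℤ) :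
    totalSize φ p ^ (-2 + ε / 16) * ∏ f ∈ U, br (p f) ^ (-ε) ≤
      (∏ f ∈ T, br (p f) ^ (-1 - ε / 16)) *
        ∏ f ∈ (U ∪ Finset.univ.image φ) \ N, br (p f) ^ (-(ε / 16)) := by
  set X := totalSize φ p
  set Φ := Finset.univ.image φ with hΦ
  have hX1 : 1 ≤ X := one_le_totalSize φ p
  have hX0 : 0 < X := totalSize_pos φ p
  have hbX : ∀ f ∈ Φ, br (p f) ≤ X := by
    intro f hf
    obtain ⟨c, -, rfl⟩ := Finset.mem_image.1 hf
    exact br_le_totalSize φ p c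
  have nn : ∀ (S : Finset F) (s : ℝ), 0 ≤ ∏ f ∈ S, br (p f) ^ s := fun S s =>
    Finset.prod_nonneg fun f _ => br_rpow_nonneg _ _
  have le1 : ∀ (S : Finset F) {s : ℝ}, s ≤ 0 → ∏ f ∈ S, br (p f) ^ s ≤ 1 := fun S s hs =>
    Finset.prod_le_one (fun f _ => br_rpow_nonneg _ _) fun f _ => br_rpow_le_one _ hs
  have anti : ∀ {S S' : Finset F} {s : ℝ}, S ⊆ S' → s ≤ 0 →
      ∏ f ∈ S', br (p f) ^ s ≤ ∏ f ∈ S, br (p f) ^ s := fun {S S' s} h hs => by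
    rw [← Finset.prod_sdiff h]
    exact mul_le_of_le_one_left (nn _ _) (le1 _ hs)
  have hΦX : X ^ (-(ε / 4)) ≤ ∏ f ∈ Φ, br (p f) ^ (-(ε / 16)) := by
    have hcard : Φ.card ≤ 4 := by simpa using Finset.card_image_le (s := Finset.univ) (f := φ)
    have h1 : ∏ _f ∈ Φ, X ^ (-(ε / 16)) ≤ ∏ f ∈ Φ, br (p f) ^ (-(ε / 16)) :=
      Finset.prod_le_prod (fun _ _ => Real.rpow_nonneg hX0.le _) fun f hf =>
        rpow_le_rpow_of_neg (br_pos _) (hbX f hf) (by linarith)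
    refine le_trans ?_ h1
    rw [Finset.prod_const, ← Real.rpow_natCast, ← Real.rpow_mul hX0.le]
    refine Real.rpow_le_rpow_of_exponent_le hX1 ?_
    have : (Φ.card : ℝ) ≤ 4 := by exact_mod_cast hcard
    nlinarith
  have hold : X ^ (-(ε / 4)) * ∏ f ∈ U \ N, br (p f) ^ (-ε) ≤
      ∏ f ∈ (U ∪ Φ) \ N, br (p f) ^ (-(ε / 16)) := by
    calc X ^ (-(ε / 4)) * ∏ f ∈ U \ N, br (p f) ^ (-ε)
        ≤ (∏ f ∈ Φ, br (p f) ^ (-(ε / 16))) * ∏ f ∈ U \ N, br (p f) ^ (-(ε / 16)) := by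
          refine mul_le_mul hΦX (Finset.prod_le_prod (fun _ _ => br_rpow_nonneg _ _) fun f _ => ?_)
            (nn _ _) (nn _ _)
          exact Real.rpow_le_rpow_of_exponent_le (one_le_br _) (by linarith)
      _ ≤ ∏ f ∈ Φ ∪ (U \ N), br (p f) ^ (-(ε / 16)) := by
          rw [← Finset.prod_union_inter]
          exact mul_le_of_le_one_right (nn _ _) (le1 _ (by linarith))
      _ ≤ _ := by
          refine anti (fun f hf => ?_) (by linarith)
          obtain ⟨h1, h2⟩ := Finset.mem_sdiff.1 hf
          rcases Finset.mem_union.1 h1 with h | h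
          · exact Finset.mem_union_right _ (Finset.mem_sdiff.2 ⟨h, h2⟩)
          · exact Finset.mem_union_left _ h
  have hsummed : X ^ (-2 + 5 * ε / 16) * ∏ f ∈ U ∩ N, br (p f) ^ (-ε) ≤
      ∏ f ∈ T, br (p f) ^ (-1 - ε / 16) := by
    have hone : ∀ f ∈ T, X ^ (-1 - ε / 16) ≤ br (p f) ^ (-1 - ε / 16) := fun f hf =>
      rpow_le_rpow_of_neg (br_pos _) (hbX f (hN (hTN hf))) (by linarith)
    rcases hT with hT | ⟨hT, f, hf⟩
    · refine (mul_le_of_le_one_right (Real.rpow_nonneg hX0.le _) (le1 _ (by linarith))).trans ?_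
      have h1 : ∏ _f ∈ T, X ^ (-1 - ε / 16) ≤ ∏ f ∈ T, br (p f) ^ (-1 - ε / 16) :=
        Finset.prod_le_prod (fun _ _ => Real.rpow_nonneg hX0.le _) hone
      refine le_trans ?_ h1
      rw [Finset.prod_const, ← Real.rpow_natCast, ← Real.rpow_mul hX0.le]
      refine Real.rpow_le_rpow_of_exponent_le hX1 ?_
      have : (T.card : ℝ) ≤ 1 := by exact_mod_cast hT
      nlinarith
    · obtain ⟨hfT, hfU⟩ := Finset.mem_inter.1 hf
      obtain ⟨g, hg⟩ := Finset.card_eq_one.1 (show (T.erase f).card = 1 by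
        rw [Finset.card_erase_of_mem hfT, hT])
      have hgT : g ∈ T := Finset.mem_of_mem_erase (hg ▸ Finset.mem_singleton_self g)
      rw [← Finset.mul_prod_erase T _ hfT, hg, Finset.prod_singleton]
      have h1 : ∏ f ∈ U ∩ N, br (p f) ^ (-ε) ≤ br (p f) ^ (-ε) := by
        have := anti (S := {f}) (S' := U ∩ N) (s := -ε) (Finset.singleton_subset_iff.2
          (Finset.mem_inter.2 ⟨hfU, hTN hfT⟩)) (by linarith)
        simpa using this
      have h2 : X ^ (-1 + 6 * ε / 16) ≤ br (p f) ^ (-1 + 15 * ε / 16) :=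
        (rpow_le_rpow_of_neg (br_pos _) (hbX f (hN (hTN hfT))) (by linarith)).trans
          (Real.rpow_le_rpow_of_exponent_le (one_le_br _) (by linarith))
      calc X ^ (-2 + 5 * ε / 16) * ∏ f ∈ U ∩ N, br (p f) ^ (-ε)
          ≤ X ^ (-2 + 5 * ε / 16) * br (p f) ^ (-ε) :=
            mul_le_mul_of_nonneg_left h1 (Real.rpow_nonneg hX0.le _)
        _ = X ^ (-1 + 6 * ε / 16) * X ^ (-1 - ε / 16) * br (p f) ^ (-ε) := by
            rw [← Real.rpow_add hX0]; congr 2; ring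
        _ ≤ br (p f) ^ (-1 + 15 * ε / 16) * br (p g) ^ (-1 - ε / 16) * br (p f) ^ (-ε) := by
            refine mul_le_mul_of_nonneg_right (mul_le_mul h2 (hone g hgT)
              (Real.rpow_nonneg hX0.le _) (br_rpow_nonneg _ _)) (br_rpow_nonneg _ _)
        _ = br (p f) ^ (-1 - ε / 16) * br (p g) ^ (-1 - ε / 16) := by
            rw [mul_right_comm, ← Real.rpow_add (br_pos _)]; congr 2; ring
  have hsplit : ∏ f ∈ U, br (p f) ^ (-ε) =
      (∏ f ∈ U ∩ N, br (p f) ^ (-ε)) * ∏ f ∈ U \ N, br (p f) ^ (-ε) :=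
    (Finset.prod_inter_mul_prod_sdiff _ _ _).symm
  calc X ^ (-2 + ε / 16) * ∏ f ∈ U, br (p f) ^ (-ε)
      = (X ^ (-2 + 5 * ε / 16) * ∏ f ∈ U ∩ N, br (p f) ^ (-ε)) *
          (X ^ (-(ε / 4)) * ∏ f ∈ U \ N, br (p f) ^ (-ε)) := by
        rw [hsplit, show -2 + ε / 16 = (-2 + 5 * ε / 16) + (-(ε / 4)) by ring, Real.rpow_add hX0]
        ring
    _ ≤ _ := mul_le_mul hsummed hold
        (mul_nonneg (Real.rpow_nonneg hX0.le _) (nn _ _)) (nn _ _)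

/-- The weight of a line: momentum conservation, and almost the decay of the propagator. -/
def lineWeight (ε : ℝ) (φ : Fin 4 → F) (p : F → ℤ) : ENNReal :=
  if ∑ c, p (φ c) = 0 then ENNReal.ofReal (totalSize φ p ^ (-2 + ε)) else 0

omit [DecidableEq F] in
lemma lineWeight_mono {ε ε' : ℝ} (h : ε ≤ ε') (φ : Fin 4 → F) (p : F → ℤ) :
    lineWeight ε φ p ≤ lineWeight ε' φ p := by
  unfold lineWeight
  split_ifs
  · exact ENNReal.ofReal_le_ofReal
      (Real.rpow_le_rpow_of_exponent_le (one_le_totalSize φ p) (by linarith))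
  · exact le_rfl

/-- The sum over the momenta `N` of a line converges, if there are at most three of them and, when
there are three, one of them is already damped. The other momenta of the line are damped in turn. -/
lemma partialSum_lineWeight_le {φ : Fin 4 → F} (hφ : Function.Injective φ) {N U : Finset F}
    (hN : N ⊆ Finset.univ.image φ) (hN4 : N.card ≤ 3) (hN3 : N.card = 3 → (N ∩ U).Nonempty) {ε : ℝ}
    (hε : 0 < ε) (hε' : ε ≤ 1) : ∃ C : ENNReal, C ≠ ⊤ ∧ ∀ p : F → ℤ,
      partialSum N (fun q => lineWeight (ε / 16) φ q * ∏ f ∈ U, brPow (-ε) (q f)) p ≤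
        C * ∏ f ∈ (U ∪ Finset.univ.image φ) \ N, brPow (-(ε / 16)) (p f) := by
  -- one of the summed momenta is determined by momentum conservation
  obtain ⟨T, hTN, hT, hNT⟩ : ∃ T ⊆ N, (T.card ≤ 1 ∨ T.card = 2 ∧ (T ∩ U).Nonempty) ∧
      (N = T ∨ ∃ f ∈ N, T = N.erase f) := by
    rcases N.eq_empty_or_nonempty with rfl | hne
    · exact ⟨∅, subset_rfl, by simp, Or.inl rfl⟩
    by_cases h3 : N.card = 3
    · obtain ⟨g, hg⟩ := hN3 h3
      obtain ⟨f, hf⟩ : (N.erase g).Nonempty := Finset.card_pos.1 (by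
        rw [Finset.card_erase_of_mem (Finset.mem_inter.1 hg).1, h3]; norm_num)
      obtain ⟨hfg, hfN⟩ := Finset.mem_erase.1 hf
      refine ⟨N.erase f, Finset.erase_subset _ _, Or.inr ⟨?_, g, ?_⟩, Or.inr ⟨f, hfN, rfl⟩⟩
      · rw [Finset.card_erase_of_mem hfN, h3]
      · exact Finset.mem_inter.2 ⟨Finset.mem_erase.2 ⟨hfg.symm, (Finset.mem_inter.1 hg).1⟩,
          (Finset.mem_inter.1 hg).2⟩
    · obtain ⟨f, hf⟩ := hne
      refine ⟨N.erase f, Finset.erase_subset _ _, Or.inl ?_, Or.inr ⟨f, hf, rfl⟩⟩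
      rw [Finset.card_erase_of_mem hf]; omega
  set ind : (F → ℤ) → ENNReal := fun q => if ∑ c, q (φ c) = 0 then 1 else 0 with hind
  refine ⟨(∑' z, brPow (-1 - ε / 16) z) ^ T.card,
    ENNReal.pow_ne_top (tsum_brPow_ne_top (by linarith)), fun p => ?_⟩
  have hpt : ∀ q, (∀ f ∉ N, q f = p f) →
      lineWeight (ε / 16) φ q * ∏ f ∈ U, brPow (-ε) (q f) ≤
        ((∏ f ∈ T, brPow (-1 - ε / 16) (q f)) * ind q) *
          ∏ f ∈ (U ∪ Finset.univ.image φ) \ N, brPow (-(ε / 16)) (q f) := by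
    intro q _
    simp only [lineWeight, hind]
    split_ifs
    · have h := ENNReal.ofReal_le_ofReal (totalSize_rpow_mul_le hTN hN hT hε hε' q)
      rw [ENNReal.ofReal_mul (Real.rpow_nonneg (totalSize_pos φ q).le _), ENNReal.ofReal_mul
        (Finset.prod_nonneg fun _ _ => br_rpow_nonneg _ _),
        ENNReal.ofReal_prod_of_nonneg fun _ _ => br_rpow_nonneg _ _,
        ENNReal.ofReal_prod_of_nonneg fun _ _ => br_rpow_nonneg _ _,
        ENNReal.ofReal_prod_of_nonneg fun _ _ => br_rpow_nonneg _ _] at h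
      rw [mul_one]
      exact h
    · simp
  refine (partialSum_mono p hpt).trans ?_
  rw [partialSum_mul_right_ennreal]
  · refine mul_le_mul_left ?_ _
    rcases hNT with rfl | ⟨f, hf, rfl⟩
    · rw [← partialSum_prod N _ p]
      refine partialSum_mono p fun q _ => mul_le_of_le_one_right' ?_
      simp only [hind]; split_ifs <;> simp
    · have hd : Disjoint (N.erase f) {f} :=
        Finset.disjoint_singleton_right.2 (Finset.notMem_erase f N)
      have hu : N = N.erase f ∪ {f} := by
        rw [Finset.union_comm, ← Finset.insert_eq, Finset.insert_erase hf]
      rw [← partialSum_prod (N.erase f) _ p]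
      conv_lhs => rw [hu]
      rw [partialSum_union_ennreal hd]
      refine partialSum_mono p fun q _ => ?_
      simp only [mul_comm _ (ind _)]
      rw [← hu, partialSum_mul_right_ennreal]
      · refine mul_le_of_le_one_left' ?_
        obtain ⟨c, -, rfl⟩ := Finset.mem_image.1 (hN hf)
        rw [partialSum_singleton]
        have : ∀ z : ℤ, ind (Function.update q (φ c) z) =
            if z = -∑ j, q (φ (c.succAbove j)) then 1 else 0 := by
          intro z
          simp only [hind]
          rw [Fin.sum_univ_succAbove _ c, Function.update_self]
          have : ∀ j, Function.update q (φ c) z (φ (c.succAbove j)) = q (φ (c.succAbove j)) :=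
            fun j => Function.update_of_ne (fun h => Fin.succAbove_ne c j (hφ h)) _ _
          simp only [this, eq_neg_iff_add_eq_zero]
        simp only [this, tsum_ite_eq]
        exact le_rfl
      · intro q' hq'
        refine Finset.prod_congr rfl fun g hg => ?_
        rw [hq' g fun h => Finset.ne_of_mem_erase hg (Finset.mem_singleton.1 h)]
  · intro q hq
    refine Finset.prod_congr rfl fun g hg => ?_
    rw [hq g (Finset.mem_sdiff.1 hg).2]

end OneLine

section PowerCounting

variable {n : ℕ} {b : Fin n → Bubble} {G : FeynmanGraph b}

variable (G) in
/-- The faces running through the lines of `E`. -/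
def facesOf (E : Finset (Line b)) : Finset (Face G) :=
  E.biUnion fun l => Finset.univ.image (face G l.1)

lemma mem_facesOf {E : Finset (Line b)} {f : Face G} :
    f ∈ facesOf G E ↔ ∃ l ∈ E, ∃ c, face G l.1 c = f := by simp [facesOf]

variable (G) in
open Classical in
/-- The faces whose momenta are summed together with the lines of `E`. -/
def newFaces (E : Finset (Line b)) : Finset (Face G) := (facesOf G E).filter fun f => ¬ IsOld G E f

lemma mem_newFaces {E : Finset (Line b)} {f : Face G} :
    f ∈ newFaces G E ↔ (∃ l ∈ E, ∃ c, face G l.1 c = f) ∧ ¬ IsOld G E f := by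
  classical rw [newFaces, Finset.mem_filter, mem_facesOf]

lemma isOld_erase {E : Finset (Line b)} {l : Line b} (hl : l ∈ G.lines \ melonicLines G)
    {f : Face G} :
    IsOld G (E.erase l) f ↔ IsOld G E f ∨ ∃ c, face G l.1 c = f := by
  constructor
  · rintro (h | ⟨k, hk, hkE, h⟩)
    · exact Or.inl (Or.inl h)
    · by_cases hkl : k = l
      · exact Or.inr (hkl ▸ h)
      · exact Or.inl (Or.inr ⟨k, hk, fun h => hkE (Finset.mem_erase.2 ⟨hkl, h⟩), h⟩)
  · rintro ((h | ⟨k, hk, hkE, h⟩) | h)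
    · exact Or.inl h
    · exact Or.inr ⟨k, hk, fun h => hkE (Finset.mem_of_mem_erase h), h⟩
    · exact Or.inr ⟨l, hl, Finset.notMem_erase l E, h⟩

lemma face_injective_colour (w : White b) : Function.Injective (face G w) := fun _ _ h =>
  face_colour h

variable (hG : G.Connected) (hv : G.NonVacuum)

include hG hv in
/-- The sum over the new faces of a set of non-melonic lines converges, uniformly in the momenta of
the old ones, with a small power of decay in the momenta of the old faces running through these
lines. The sum is performed line by line, beginning with the lines which are furthest from the
external faces; the small decay gained is what makes the sum over the three new faces of a line
converge. -/
theorem exists_bound_newFaces (E : Finset (Line b)) (hE : E ⊆ G.lines \ melonicLines G) :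
    ∃ ε : ℝ, 0 < ε ∧ ε ≤ 1 ∧ ∃ C : ENNReal, C ≠ ⊤ ∧ ∀ p : Face G → ℤ,
      partialSum (newFaces G E) (fun q => ∏ l ∈ E, lineWeight ε (face G l.1) q) p ≤
        C * ∏ f ∈ facesOf G E \ newFaces G E, brPow (-ε) (p f) := by
  classical
  induction E using Finset.strongInduction with
  | H E ih =>
    rcases E.eq_empty_or_nonempty with rfl | hne
    · refine ⟨1, one_pos, le_rfl, 1, ENNReal.one_ne_top, fun p => ?_⟩
      have : newFaces G (∅ : Finset (Line b)) = ∅ := by simp [newFaces, facesOf]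
      simp [this, partialSum_empty, facesOf]
    obtain ⟨l, hl, c₀, hc₀⟩ := exists_isOld hG hv hE hne
    have hlL := hE hl
    set E₀ := E.erase l with hE₀
    obtain ⟨ε, hε, hε1, C, hC, h₀⟩ := ih E₀ (Finset.erase_ssubset hl)
      ((Finset.erase_subset _ _).trans hE)
    set Φ := Finset.univ.image (face G l.1) with hΦ
    have hmemΦ : ∀ {f}, f ∈ Φ ↔ ∃ c, face G l.1 c = f := by simp [hΦ]
    set N := Φ.filter fun f => ¬ IsOld G E f with hN
    set U := facesOf G E₀ \ newFaces G E₀ with hU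
    have hunion : newFaces G E = N ∪ newFaces G E₀ := by
      ext f
      simp only [Finset.mem_union, hN, Finset.mem_filter, hmemΦ, mem_newFaces,
        isOld_erase hlL, hE₀, Finset.mem_erase]
      constructor
      · rintro ⟨⟨k, hk, h⟩, ho⟩
        by_cases hf : ∃ c, face G l.1 c = f
        · exact Or.inl ⟨hf, ho⟩
        · refine Or.inr ⟨⟨k, ⟨fun e => hf (e ▸ h), hk⟩, h⟩, fun h' => h'.elim ho hf⟩
      · rintro (⟨hf, ho⟩ | ⟨⟨k, hk, h⟩, ho⟩)
        · exact ⟨⟨l, hl, hf⟩, ho⟩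
        · exact ⟨⟨k, hk.2, h⟩, fun h' => ho (Or.inl h')⟩
    have hlnew : ∀ c, face G l.1 c ∉ newFaces G E₀ := fun c h =>
      (mem_newFaces.1 h).2 ((isOld_erase hlL).2 (Or.inr ⟨c, rfl⟩))
    have hdisj : Disjoint N (newFaces G E₀) := by
      refine Finset.disjoint_left.2 fun f hf hf' => ?_
      obtain ⟨c, rfl⟩ := hmemΦ.1 (Finset.mem_filter.1 hf).1
      exact hlnew c hf'
    have hc₀N : face G l.1 c₀ ∉ N := fun h => (Finset.mem_filter.1 h).2 hc₀
    have hNsub : N ⊆ Φ.erase (face G l.1 c₀) := fun f hf =>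
      Finset.mem_erase.2 ⟨fun e => hc₀N (e ▸ hf), (Finset.mem_filter.1 hf).1⟩
    have hcard : (Φ.erase (face G l.1 c₀)).card = 3 := by
      rw [Finset.card_erase_of_mem (hmemΦ.2 ⟨c₀, rfl⟩), hΦ,
        Finset.card_image_of_injective _ (face_injective_colour l.1)]
      simp
    have hN3 : N.card = 3 → (N ∩ U).Nonempty := by
      intro h3
      have heq : N = Φ.erase (face G l.1 c₀) :=
        Finset.eq_of_subset_of_card_le hNsub (by rw [hcard, h3])
      have hnew : ∀ c, c ≠ c₀ → face G l.1 c ∈ N := fun c hc => by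
        rw [heq]
        exact Finset.mem_erase.2 ⟨fun h => hc (face_colour h), hmemΦ.2 ⟨c, rfl⟩⟩
      obtain ⟨c, hc, k, hk, hkl, hf⟩ := exists_common_face hlL (d := c₀) (E := E)
        fun c hc => (Finset.mem_filter.1 (hnew c hc)).2
      refine ⟨face G l.1 c, Finset.mem_inter.2 ⟨hnew c hc, Finset.mem_sdiff.2 ⟨?_, hlnew c⟩⟩⟩
      exact mem_facesOf.2 ⟨k, Finset.mem_erase.2 ⟨hkl, hk⟩, c, hf⟩
    obtain ⟨C', hC', h'⟩ := partialSum_lineWeight_le (face_injective_colour (G := G) l.1)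
      (N := N) (U := U) (Finset.filter_subset _ _) (hcard ▸ Finset.card_le_card hNsub) hN3 hε hε1
    have hε16 : ε / 16 ≤ ε := by linarith
    refine ⟨ε / 16, by linarith, by linarith, C * C', ENNReal.mul_ne_top hC hC', fun p => ?_⟩
    rw [hunion, partialSum_union_ennreal hdisj]
    have hstep : ∀ q : Face G → ℤ,
        partialSum (newFaces G E₀) (fun q => ∏ l ∈ E, lineWeight (ε / 16) (face G l.1) q) q ≤
          C * (lineWeight (ε / 16) (face G l.1) q * ∏ f ∈ U, brPow (-ε) (q f)) := by
      intro q
      have hprod : (fun q => ∏ l ∈ E, lineWeight (ε / 16) (face G l.1) q) = fun q =>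
          (∏ l ∈ E₀, lineWeight (ε / 16) (face G l.1) q) * lineWeight (ε / 16) (face G l.1) q := by
        funext q
        rw [hE₀, Finset.prod_erase_mul E _ hl]
      rw [hprod, partialSum_mul_right_ennreal]
      · calc _ ≤ (C * ∏ f ∈ U, brPow (-ε) (q f)) * lineWeight (ε / 16) (face G l.1) q := by
              refine mul_le_mul_left ((partialSum_mono q fun q' _ => ?_).trans (h₀ q)) _
              exact Finset.prod_le_prod' fun k _ => lineWeight_mono hε16 _ _
          _ = _ := by ring
      · intro q' hq'
        have : ∀ c, q' (face G l.1 c) = q (face G l.1 c) := fun c => hq' _ (hlnew c)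
        simp only [lineWeight, totalSize, this]
    calc _ ≤ partialSum N (fun q => (lineWeight (ε / 16) (face G l.1) q *
              ∏ f ∈ U, brPow (-ε) (q f)) * C) p :=
          partialSum_mono p fun q _ => (hstep q).trans_eq (mul_comm _ _)
      _ = partialSum N (fun q => lineWeight (ε / 16) (face G l.1) q *
              ∏ f ∈ U, brPow (-ε) (q f)) p * C :=
          partialSum_mul_right_ennreal _ (fun _ => C) p fun _ _ => rfl
      _ ≤ (C' * ∏ f ∈ (U ∪ Φ) \ N, brPow (-(ε / 16)) (p f)) * C := mul_le_mul_left (h' p) _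
      _ ≤ (C' * ∏ f ∈ facesOf G E \ (N ∪ newFaces G E₀), brPow (-(ε / 16)) (p f)) * C := by
          refine mul_le_mul_left (mul_le_mul_right (Finset.prod_le_prod_of_subset_of_le_one' ?_
            fun f _ _ => ?_) _) _
          · intro f hf
            rw [← hunion] at hf
            obtain ⟨h1, h2⟩ := Finset.mem_sdiff.1 hf
            obtain ⟨k, hk, c, rfl⟩ := mem_facesOf.1 h1
            refine Finset.mem_sdiff.2 ⟨Finset.mem_union.2 ?_,
              fun h => h2 (hunion ▸ Finset.mem_union_left _ h)⟩
            by_cases hkl : k = l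
            · exact Or.inr (hmemΦ.2 ⟨c, by rw [hkl]⟩)
            · exact Or.inl (Finset.mem_sdiff.2
                ⟨mem_facesOf.2 ⟨k, Finset.mem_erase.2 ⟨hkl, hk⟩, c, rfl⟩,
                  fun h => h2 (hunion ▸ Finset.mem_union_right _ h)⟩)
          · exact ENNReal.ofReal_le_one.2 (br_rpow_le_one _ (by linarith))
      _ = _ := by ring

end PowerCounting

/-! ### Removal of the cutoff -/

section Limit

variable {n : ℕ} {b : Fin n → Bubble} {G : FeynmanGraph b}

/-- The size of the momenta of the propagator. -/
lemma propCoeff_le_size {m : ℝ} (hm : 0 < m) : ∃ K : ℝ, 0 ≤ K ∧ ∀ a : ℝ, 0 ≤ a → ∀ P : Fin 4 → ℤ,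
    propCoeff m a P ≤ if ∑ c, P c = 0 then K * (∑ c, br (P c)) ^ (-2 : ℝ) else 0 := by
  refine ⟨32 / m ^ 2 + 8, by positivity, fun a ha P => ?_⟩
  unfold propCoeff
  split_ifs with h
  · set x := m ^ 2 + ∑ c, (P c : ℝ) ^ 2 with hx
    have hS : 0 ≤ ∑ c, (P c : ℝ) ^ 2 := Finset.sum_nonneg fun _ _ => sq_nonneg _
    have hx0 : 0 < x := by positivity
    set X := ∑ c, br (P c) with hX
    have hX0 : 0 < X := Finset.sum_pos (fun c _ => br_pos _) Finset.univ_nonempty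
    have h1 : X ^ 2 ≤ 32 + 8 * ∑ c, (P c : ℝ) ^ 2 := by
      have h2 : X ^ 2 ≤ 4 * ∑ c, br (P c) ^ 2 := by
        have := sq_sum_le_card_mul_sum_sq (s := (Finset.univ : Finset (Fin 4)))
          (f := fun c => br (P c))
        simpa using this
      have h3 : ∑ c, br (P c) ^ 2 ≤ ∑ c, (2 + 2 * (P c : ℝ) ^ 2) := Finset.sum_le_sum fun c _ => by
        have h := sq_abs (P c : ℝ)
        unfold br; nlinarith [sq_nonneg (|(P c : ℝ)| - 1)]
      rw [Finset.sum_add_distrib, ← Finset.mul_sum] at h3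
      simp at h3
      linarith
    have h4 : X ^ 2 ≤ (32 / m ^ 2 + 8) * x := by
      have : (32 / m ^ 2 + 8) * x = 32 + 8 * m ^ 2 + 8 * ∑ c, (P c : ℝ) ^ 2 +
          32 / m ^ 2 * ∑ c, (P c : ℝ) ^ 2 := by
        rw [hx]; field_simp; ring
      rw [this]
      have : 0 ≤ 32 / m ^ 2 * ∑ c, (P c : ℝ) ^ 2 := by positivity
      nlinarith [sq_nonneg m]
    calc Real.exp (-a * x) / x ≤ 1 / x := by
          gcongr; exact Real.exp_le_one_iff.2 (by nlinarith)
      _ ≤ (32 / m ^ 2 + 8) * (X ^ 2)⁻¹ := by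
          rw [← div_eq_mul_inv, div_le_div_iff₀ hx0 (by positivity)]; linarith
      _ = _ := by
          rw [Real.rpow_neg hX0.le, show (2 : ℝ) = (2 : ℕ) by norm_num, Real.rpow_natCast]
  · exact le_rfl

lemma tendsto_propCoeff (m : ℝ) {a : ℕ → ℝ} (ha : Tendsto a atTop (𝓝 0)) (P : Fin 4 → ℤ) :
    ∃ z, Tendsto (fun ρ => propCoeff m (a ρ) P) atTop (𝓝 z) := by
  unfold propCoeff
  split_ifs
  · exact ⟨_, tendsto_decay ha _⟩
  · exact ⟨0, tendsto_const_nhds⟩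

variable (hG : G.Connected) (hv : G.NonVacuum)

variable (G) in
/-- The melonic lines which are not inserted on another melonic line. -/
def rootLines : Finset (Line b) :=
  open Classical in
  (melonicLines G).filter fun k => ∀ l ∈ melonicLines G, ¬ IsChild G k l

include hG hv in
/-- The external face of an outermost melonic line is an external face of the graph or runs through
a non-melonic line. -/
lemma exists_of_mem_rootLines {k : Line b} (hk : k ∈ rootLines G) :
    face G k.1 (melonColour G k) ∈ externalFaces G ∨ ∃ l ∈ G.lines \ melonicLines G,
      ∃ c, face G l.1 c = face G k.1 (melonColour G k) := by
  classical
  obtain ⟨hkD, hroot⟩ := Finset.mem_filter.1 hk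
  obtain ⟨y, hy, hy'⟩ := exists_not_isMelonic hG hv k.1 (melonColour G k)
  by_cases h : ∃ l ∈ G.lines, l.1 = y
  · obtain ⟨l, hl, rfl⟩ := h
    refine Or.inr ⟨l, Finset.mem_sdiff.2 ⟨hl, fun hlD => ?_⟩, _, hy⟩
    have h1 := hy' l hl rfl
    have hne : k ≠ l := fun e => h1 (e ▸ isMelonic_melonColour hkD)
    exact hroot l hlD (isChild_of_face_eq hlD (melonicLines_subset hkD)
      (fun e => h1 (by rw [e]; exact isMelonic_melonColour hlD)) hne hy.symm)
  · push Not at h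
    exact Or.inl (mem_externalFaces.2 ⟨⟨y, h⟩, _, hy⟩)

include hG hv in
/-- A face which is not a closed face of a melonic line is external or runs through a non-melonic
line. -/
lemma compl_innerFaces :
    (innerFaces G (melonicLines G))ᶜ = externalFaces G ∪ newFaces G (G.lines \ melonicLines G) := by
  classical
  ext f
  simp only [Finset.mem_compl, Finset.mem_union]
  constructor
  · intro hf
    by_cases hext : f ∈ externalFaces G
    · exact Or.inl hext
    refine Or.inr (mem_newFaces.2 ⟨?_, ?_⟩)
    · obtain ⟨w, c, rfl⟩ := face_surjective f
      obtain ⟨y, hy, hy'⟩ := exists_not_isMelonic hG hv w c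
      by_cases h : ∃ l ∈ G.lines, l.1 = y
      · obtain ⟨l, hl, rfl⟩ := h
        refine ⟨l, Finset.mem_sdiff.2 ⟨hl, fun hlD => hf ?_⟩, c, hy⟩
        exact mem_innerFaces.2 ⟨l, hlD, c,
          fun e => hy' l hl rfl (e ▸ isMelonic_melonColour hlD), hy⟩
      · push Not at h
        exact absurd (mem_externalFaces.2 ⟨⟨y, h⟩, c, hy⟩) hext
    · rintro (h | ⟨k, hk, hk', -⟩)
      · exact hext h
      · exact hk' hk
  · intro h hf
    obtain ⟨l, hl, c, hc, rfl⟩ := mem_innerFaces.1 hf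
    refine not_isOld_of_isMelonic (E := ∅) (isMelonic_melonColour hl) hc ?_
    rcases h with h | h
    · exact Or.inl h
    · obtain ⟨⟨k, hk, h⟩, -⟩ := mem_newFaces.1 h
      exact Or.inr ⟨k, hk, Finset.notMem_empty k, h⟩

/-- The part of the amplitude which remains after the sum over the closed faces of the melonic
lines. -/
def reducedAmplitude (m : ℝ) (a : ℕ → ℝ) (R : Line b → ℕ → ℤ → ℂ) (ρ : ℕ) (q : Face G → ℤ) : ℂ :=
  (∏ k ∈ rootLines G, R k ρ (q (face G k.1 (melonColour G k)))) *
    ∏ l ∈ G.lines \ melonicLines G, (propCoeff m (a ρ) (faceMom q l) : ℂ)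

include hG hv in
/-- The mild functions are absorbed by small powers of the momenta of the non-melonic lines and of
the external faces. -/
lemma reducedAmplitude_le {m : ℝ} (hm : 0 < m) {a : ℕ → ℝ} (ha : ∀ ρ, 0 < a ρ)
    {R : Line b → ℕ → ℤ → ℂ} (hR : ∀ k, IsMild (R k)) {ε : ℝ} (hε : 0 < ε) :
    ∃ K : ENNReal, K ≠ ⊤ ∧ ∀ ρ (q : Face G → ℤ),
      ENNReal.ofReal ‖reducedAmplitude m a R ρ q‖ ≤
        K * ((∏ l ∈ G.lines \ melonicLines G, lineWeight ε (face G l.1) q) *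
          ∏ f ∈ externalFaces G, brPow (1 / 8) (q f)) := by
  classical
  set L := G.lines \ melonicLines G with hL
  set N : ℝ := ((rootLines G).card : ℝ) with hN
  have hN0 : 0 ≤ N := Nat.cast_nonneg _
  set η : ℝ := min ε (1 / 8) / (N + 1) with hη
  have hη0 : 0 < η := by positivity
  have hηN : η * N ≤ min ε (1 / 8) := by
    rw [hη, div_mul_eq_mul_div, div_le_iff₀ (by positivity)]
    have : 0 < min ε (1 / 8) := by positivity
    nlinarith
  choose C hC hCR using fun k => (hR k).growth η hη0
  obtain ⟨K, hK, hKP⟩ := propCoeff_le_size hm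
  refine ⟨(∏ k ∈ rootLines G, ENNReal.ofReal (C k)) * ENNReal.ofReal K ^ L.card,
    ENNReal.mul_ne_top (ENNReal.prod_ne_top fun k _ => ENNReal.ofReal_ne_top)
      (ENNReal.pow_ne_top ENNReal.ofReal_ne_top), fun ρ q => ?_⟩
  have hX : ∀ l : Line b, 1 ≤ totalSize (face G l.1) q := fun l => one_le_totalSize _ _
  have hX0 : ∀ l : Line b, 0 ≤ totalSize (face G l.1) q := fun l => (totalSize_pos _ _).le
  set V : ENNReal := (∏ f ∈ externalFaces G, brPow η (q f)) *
    ∏ l ∈ L, ENNReal.ofReal (totalSize (face G l.1) q ^ η) with hV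
  have one_ext : ∀ f ∈ externalFaces G, 1 ≤ brPow η (q f) := fun f _ =>
    ENNReal.one_le_ofReal.2 (Real.one_le_rpow (one_le_br _) hη0.le)
  have one_L : ∀ l ∈ L, 1 ≤ ENNReal.ofReal (totalSize (face G l.1) q ^ η) := fun l _ =>
    ENNReal.one_le_ofReal.2 (Real.one_le_rpow (hX l) hη0.le)
  have hroot : ∀ k ∈ rootLines G, ENNReal.ofReal ‖R k ρ (q (face G k.1 (melonColour G k)))‖ ≤
      ENNReal.ofReal (C k) * V := by
    intro k hk
    have h1 := ENNReal.ofReal_le_ofReal (hCR k ρ (q (face G k.1 (melonColour G k))))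
    rw [ENNReal.ofReal_mul (hC k)] at h1
    refine h1.trans (mul_le_mul_right ?_ _)
    rcases exists_of_mem_rootLines hG hv hk with h | ⟨l, hl, c, h⟩
    · exact (Finset.single_le_prod' one_ext h).trans
        (le_mul_of_one_le_right' (Finset.one_le_prod' one_L))
    · refine le_trans ?_ (le_mul_of_one_le_left' (Finset.one_le_prod' one_ext))
      refine le_trans ?_ (Finset.single_le_prod' one_L hl)
      rw [← h]
      exact ENNReal.ofReal_le_ofReal (Real.rpow_le_rpow (br_pos _).le
        (br_le_totalSize (face G l.1) q c) hη0.le)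
  have hline : ∀ l ∈ L, ENNReal.ofReal ‖(propCoeff m (a ρ) (faceMom q l) : ℂ)‖ ≤
      ENNReal.ofReal K * lineWeight 0 (face G l.1) q := by
    intro l _
    have h1 := hKP (a ρ) (ha ρ).le (faceMom q l)
    rw [Complex.norm_real, Real.norm_of_nonneg (propCoeff_nonneg _ _ _)]
    refine (ENNReal.ofReal_le_ofReal h1).trans ?_
    by_cases h : ∑ c, faceMom q l c = 0
    · rw [if_pos h, lineWeight, if_pos (show ∑ c, q (face G l.1 c) = 0 from h), add_zero,
        ENNReal.ofReal_mul hK]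
      rfl
    · rw [if_neg h]; simp
  have hVpow : V ^ (rootLines G).card ≤ (∏ f ∈ externalFaces G, brPow (1 / 8) (q f)) *
      ∏ l ∈ L, ENNReal.ofReal (totalSize (face G l.1) q ^ ε) := by
    rw [hV, mul_pow, ← Finset.prod_pow, ← Finset.prod_pow]
    refine mul_le_mul' (Finset.prod_le_prod' fun f _ => ?_) (Finset.prod_le_prod' fun l _ => ?_)
    · rw [brPow, ← ENNReal.ofReal_pow (br_rpow_nonneg _ _), ← Real.rpow_natCast,
        ← Real.rpow_mul (br_pos _).le]
      exact ENNReal.ofReal_le_ofReal (Real.rpow_le_rpow_of_exponent_le (one_le_br _)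
        (hηN.trans (min_le_right _ _)))
    · rw [← ENNReal.ofReal_pow (Real.rpow_nonneg (hX0 l) _), ← Real.rpow_natCast,
        ← Real.rpow_mul (hX0 l)]
      exact ENNReal.ofReal_le_ofReal (Real.rpow_le_rpow_of_exponent_le (hX l)
        (hηN.trans (min_le_left _ _)))
  clear_value V
  rw [reducedAmplitude, norm_mul, norm_prod, norm_prod,
    ENNReal.ofReal_mul (Finset.prod_nonneg fun _ _ => norm_nonneg _),
    ENNReal.ofReal_prod_of_nonneg fun _ _ => norm_nonneg _,
    ENNReal.ofReal_prod_of_nonneg fun _ _ => norm_nonneg _]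
  refine (mul_le_mul' (Finset.prod_le_prod' hroot) (Finset.prod_le_prod' hline)).trans ?_
  rw [Finset.prod_mul_distrib, Finset.prod_mul_distrib, Finset.prod_const, Finset.prod_const]
  have hcomb : (∏ l ∈ L, ENNReal.ofReal (totalSize (face G l.1) q ^ ε)) *
      ∏ l ∈ L, lineWeight 0 (face G l.1) q = ∏ l ∈ L, lineWeight ε (face G l.1) q := by
    rw [← Finset.prod_mul_distrib]
    refine Finset.prod_congr rfl fun l _ => ?_
    simp only [lineWeight]
    split_ifs
    · rw [← ENNReal.ofReal_mul (Real.rpow_nonneg (hX0 l) _), ← Real.rpow_add (totalSize_pos _ _)]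
      congr 2; ring
    · simp
  calc _ ≤ (∏ k ∈ rootLines G, ENNReal.ofReal (C k)) *
        ((∏ f ∈ externalFaces G, brPow (1 / 8) (q f)) *
          ∏ l ∈ L, ENNReal.ofReal (totalSize (face G l.1) q ^ ε)) *
        (ENNReal.ofReal K ^ L.card * ∏ l ∈ L, lineWeight 0 (face G l.1) q) :=
        mul_le_mul' (mul_le_mul_right hVpow _) le_rfl
    _ = _ := by rw [← hcomb]; ring

variable (G) in
/-- Summability of a function of the external momenta, with a small power of the momenta as
weight. -/
def ExternallySummable (g : LegMom G → ℝ) : Prop :=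
  partialSum (externalFaces G) (fun q => ENNReal.ofReal (g (legMom q)) *
    ∏ f ∈ externalFaces G, brPow (1 / 8) (q f)) 0 ≠ ⊤

lemma legMom_congr {p q : Face G → ℤ} (h : ∀ f ∈ externalFaces G, p f = q f) :
    legMom p = legMom q := by
  refine Prod.ext (funext fun w => funext fun c => h _ (mem_externalFaces.2 ⟨w, c, rfl⟩))
    (funext fun u => funext fun c => h _ ?_)
  obtain ⟨w, hw⟩ := u.exists_whiteLeg c
  exact mem_externalFaces.2 ⟨w, c, hw⟩

include hG hv in
/-- The renormalized amplitudes converge when the cutoff is removed, uniformly in parameters `x` on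
which the external factors only depend by a phase. -/
theorem tendstoUniformly_smearedRenormalizedAmplitude {m : ℝ} (hm : 0 < m) {a : ℕ → ℝ}
    (ha : ∀ ρ, 0 < a ρ) (ha' : Tendsto a atTop (𝓝 0)) {X : Type*} {γ : ℕ → LegMom G → ℂ}
    {χ : X → LegMom G → ℂ} (hχ : ∀ x k, ‖χ x k‖ ≤ 1) {g : LegMom G → ℝ}
    (hγg : ∀ ρ k, ‖γ ρ k‖ ≤ g k) (hg : ExternallySummable G g)
    (hγ : ∀ k, ∃ z, Tendsto (fun ρ => γ ρ k) atTop (𝓝 z)) (hs : ∀ ρ, Summable fun k => ‖γ ρ k‖)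
    {Φ : ℕ → X → LegFunction G} (hΦ : ∀ ρ x gw gb,
      HasSum (fun k => γ ρ k * χ x k * chr (legPhase k gw gb)) (Φ ρ x gw gb)) :
    ∃ A : X → ℂ, TendstoUniformly (fun ρ x => smearedRenormalizedAmplitude m (a ρ) G (Φ ρ x))
      A atTop := by
  classical
  obtain ⟨R, hR, hsum⟩ := exists_mild_factors hG hv hm ha ha' (melonicLines G) subset_rfl
    fun l _ k hk => let ⟨_, hd⟩ := hk.isMelonic; hd.mem_melonicLines
  obtain ⟨ε, hε, hε1, C, hC, hnew⟩ := exists_bound_newFaces hG hv (G.lines \ melonicLines G)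
    subset_rfl
  obtain ⟨K, hK, hbound⟩ := reducedAmplitude_le hG hv hm ha hR hε
  set L := G.lines \ melonicLines G with hL
  set O := (innerFaces G (melonicLines G))ᶜ with hO
  set ext : (O → ℤ) → Face G → ℤ := fun u => Function.updateFinset 0 O u with hext
  set T : ℕ → (O → ℤ) → ℂ := fun ρ u =>
    reducedAmplitude m a R ρ (ext u) * γ ρ (legMom (ext u)) with hT
  -- the amplitude as a sum over the momenta of the faces which are not inner faces
  have hindep : ∀ (β : LegMom G → ℂ) (α : ℝ), IndepOf (innerFaces G (melonicLines G))
      fun q : Face G → ℤ => (∏ l ∈ L, (propCoeff m α (faceMom q l) : ℂ)) * β (legMom q) := by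
    intro β α p q h
    have h1 : legMom p = legMom q := legMom_congr fun f hf => h f fun hf' => by
      have : f ∈ O := by rw [hO, compl_innerFaces hG hv]; exact Finset.mem_union_left _ hf
      exact Finset.mem_compl.1 this hf'
    have h2 : ∀ l ∈ L, faceMom p l = faceMom q l := fun l hl => funext fun c => h _ fun hf' => by
      obtain ⟨k, hk, c', hc', e⟩ := mem_innerFaces.1 hf'
      exact not_isOld_of_isMelonic (E := ∅) (isMelonic_melonColour hk) hc'
        (Or.inr ⟨l, hl, Finset.notMem_empty l, c, e.symm⟩)
    simp only [h1]
    rw [Finset.prod_congr rfl fun l hl => by rw [h2 l hl]]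
  have hcover : Finset.univ = O ∪ innerFaces G (melonicLines G) := by
    rw [hO, Finset.union_comm, Finset.union_compl]
  have hamp : ∀ ρ x, smearedRenormalizedAmplitude m (a ρ) G (Φ ρ x) =
      ∑' u, T ρ u * χ x (legMom (ext u)) := by
    intro ρ x
    have hβ : Summable fun k => ‖γ ρ k * χ x k‖ := by
      refine (hs ρ).of_nonneg_of_le (fun _ => norm_nonneg _) fun k => ?_
      rw [norm_mul]
      exact mul_le_of_le_one_right (norm_nonneg _) (hχ x k)
    have h := hasSum_smearedRenormalizedAmplitude hG hv hm (ha ρ) hβ (hΦ ρ x)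
    rw [← h.tsum_eq, ← partialSum_univ 0, hcover,
      partialSum_union disjoint_compl_left h.summable,
      funext (hsum ρ _ (hindep (fun k => γ ρ k * χ x k) (a ρ)) h.summable), partialSum]
    refine tsum_congr fun u => ?_
    simp only [hT, reducedAmplitude, rootLines, hext]
    ring
  -- domination, uniformly in the cutoff
  set D : (O → ℤ) → ENNReal := fun u => K * ((∏ l ∈ L, lineWeight ε (face G l.1) (ext u)) *
    ∏ f ∈ externalFaces G, brPow (1 / 8) (ext u f)) * ENNReal.ofReal (g (legMom (ext u))) with hD
  have hTD : ∀ ρ u, ENNReal.ofReal ‖T ρ u‖ ≤ D u := by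
    intro ρ u
    rw [hT, norm_mul, ENNReal.ofReal_mul (norm_nonneg _)]
    exact mul_le_mul' (hbound ρ _) (ENNReal.ofReal_le_ofReal (hγg ρ _))
  have hDsum : ∑' u, D u ≠ ⊤ := by
    have e1 : ∑' u, D u = partialSum O (fun q => (∏ l ∈ L, lineWeight ε (face G l.1) q) *
        (K * (ENNReal.ofReal (g (legMom q)) * ∏ f ∈ externalFaces G, brPow (1 / 8) (q f)))) 0 := by
      refine tsum_congr fun u => ?_
      simp only [hD, hext]; ring
    have hdisj : Disjoint (externalFaces G) (newFaces G L) :=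
      Finset.disjoint_left.2 fun f hf hf' => (mem_newFaces.1 hf').2 (Or.inl hf)
    rw [e1, hO, compl_innerFaces hG hv, partialSum_union_ennreal hdisj]
    refine ne_top_of_le_ne_top (ENNReal.mul_ne_top hg (ENNReal.mul_ne_top hC hK)) ?_
    rw [← partialSum_mul_right_ennreal _ (fun _ => C * K) 0 fun _ _ => rfl]
    refine partialSum_mono _ fun q _ => ?_
    rw [partialSum_mul_right_ennreal]
    · refine (mul_le_mul_left (hnew q) _).trans ?_
      calc _ ≤ C * 1 * (K * (ENNReal.ofReal (g (legMom q)) *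
            ∏ f ∈ externalFaces G, brPow (1 / 8) (q f))) := by
            refine mul_le_mul_left (mul_le_mul_right ?_ _) _
            exact Finset.prod_le_one' fun f _ =>
              ENNReal.ofReal_le_one.2 (br_rpow_le_one _ (by linarith))
        _ = _ := by ring
    · intro q' hq'
      have he : ∀ f ∈ externalFaces G, q' f = q f := fun f hf =>
        hq' f fun h => Finset.disjoint_left.1 hdisj hf h
      rw [legMom_congr he, Finset.prod_congr rfl fun f hf => by rw [he f hf]]
  have hDtop : ∀ u, D u ≠ ⊤ := ENNReal.ne_top_of_tsum_ne_top hDsum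
  have hDr : Summable fun u => (D u).toReal := ENNReal.summable_toReal hDsum
  have hTn : ∀ ρ u, ‖T ρ u‖ ≤ (D u).toReal := fun ρ u =>
    (ENNReal.ofReal_le_iff_le_toReal (hDtop u)).1 (hTD ρ u)
  have hlim : ∀ u, ∃ z, Tendsto (fun ρ => T ρ u) atTop (𝓝 z) := by
    intro u
    choose zR hzR using fun k q => (hR k).limit q
    choose zP hzP using tendsto_propCoeff m ha'
    obtain ⟨z, hz⟩ := hγ (legMom (ext u))
    exact ⟨_, ((tendsto_finsetProd _ fun k _ => hzR k _).mul (tendsto_finsetProd _ fun l _ =>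
      (Complex.continuous_ofReal.tendsto _).comp (hzP (faceMom (ext u) l)))).mul hz⟩
  choose Z hZ using hlim
  have hZn : ∀ u, ‖Z u‖ ≤ (D u).toReal := fun u =>
    le_of_tendsto (hZ u).norm (Eventually.of_forall fun ρ => hTn ρ u)
  have herr : Tendsto (fun ρ => ∑' u, ‖T ρ u - Z u‖) atTop (𝓝 0) := by
    have h := tendsto_tsum_of_dominated_convergence (𝓕 := atTop)
      (f := fun ρ u => ‖T ρ u - Z u‖) (g := fun _ => (0 : ℝ)) (hDr.mul_left 2)
      (fun u => by simpa using ((hZ u).sub_const (Z u)).norm)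
      (Eventually.of_forall fun ρ u => by
        rw [norm_norm, two_mul]
        exact (norm_sub_le _ _).trans (add_le_add (hTn ρ u) (hZn u)))
    simpa using h
  refine ⟨fun x => ∑' u, Z u * χ x (legMom (ext u)), ?_⟩
  rw [Metric.tendstoUniformly_iff]
  intro δ hδ
  filter_upwards [(tendsto_order.1 herr).2 δ hδ] with ρ hρ x
  have hsm : ∀ {f : (O → ℤ) → ℂ}, (∀ u, ‖f u‖ ≤ (D u).toReal) →
      Summable fun u => f u * χ x (legMom (ext u)) := fun hf =>
    Summable.of_norm_bounded hDr fun u => by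
      rw [norm_mul]
      exact (mul_le_of_le_one_right (norm_nonneg _) (hχ x _)).trans (hf u)
  rw [dist_comm, dist_eq_norm, hamp, ← (hsm (hTn ρ)).tsum_sub (hsm hZn)]
  refine (tsum_of_norm_bounded (Summable.hasSum ?_) fun u => ?_).trans_lt hρ
  · refine Summable.of_nonneg_of_le (fun _ => norm_nonneg _) (fun u => ?_) (hDr.mul_left 2)
    rw [two_mul]
    exact (norm_sub_le _ _).trans (add_le_add (hTn ρ u) (hZn u))
  · rw [← sub_mul, norm_mul]
    exact mul_le_of_le_one_right (norm_nonneg _) (hχ x _)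

end Limit

/-! ### Fourier series of smooth functions -/

section Torus

open UnitAddTorus

variable {J : Type*} [Fintype J]

/-- The normalized Haar measure of the torus. -/
abbrev torusMeasure (J : Type*) [Fintype J] : Measure (UnitAddTorus J) :=
  Measure.pi fun _ => AddCircle.haarAddCircle

lemma mFourierCoeff_eq (f : UnitAddTorus J → ℂ) (k : J → ℤ) :
    mFourierCoeff f k = ∫ x, mFourier (-k) x * f x ∂torusMeasure J := rfl

lemma mFourier_apply_add (k : J → ℤ) (x y : UnitAddTorus J) :
    mFourier k (x + y) = mFourier k x * mFourier k y := by
  simp only [mFourier, ContinuousMap.coe_mk, Pi.add_apply, ← Finset.prod_mul_distrib]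
  refine Finset.prod_congr rfl fun i _ => ?_
  simp [fourier_apply, smul_add, AddCircle.toCircle_add]

lemma mFourier_apply_single [DecidableEq J] (k : J → ℤ) (j : J) (t : UnitAddCircle) :
    mFourier k (Pi.single j t) = fourier (k j) t := by
  simp only [mFourier, ContinuousMap.coe_mk]
  rw [Finset.prod_eq_single j]
  · rw [Pi.single_eq_same]
  · intro i _ hi
    rw [Pi.single_eq_of_ne hi, fourier_eval_zero]
  · simp

lemma norm_mFourier_apply (k : J → ℤ) (x : UnitAddTorus J) : ‖mFourier k x‖ = 1 := by
  simp only [mFourier, ContinuousMap.coe_mk, norm_prod, fourier_apply]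
  exact Finset.prod_eq_one fun i _ => Circle.norm_coe _

/-- The projection onto the torus. -/
def torusProj (z : J → ℝ) : UnitAddTorus J := fun j => (z j : UnitAddCircle)

omit [Fintype J] in
lemma isOpenQuotientMap_torusProj : IsOpenQuotientMap (torusProj (J := J)) :=
  IsOpenQuotientMap.piMap fun _ => QuotientAddGroup.isOpenQuotientMap_mk

/-- The translation by `t` in the direction `j`. -/
abbrev dirShift [DecidableEq J] (j : J) (t : ℝ) : UnitAddTorus J :=
  Pi.single j (t : UnitAddCircle)

/-- Smooth functions on the torus are given by smooth periodic functions. -/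
def IsSmoothTorus (f : UnitAddTorus J → ℂ) : Prop := ContDiff ℝ ∞ (f ∘ torusProj)

lemma IsSmoothTorus.continuous {f : UnitAddTorus J → ℂ} (hf : IsSmoothTorus f) : Continuous f :=
  isOpenQuotientMap_torusProj.isQuotientMap.continuous_iff.2 (ContDiff.continuous hf)

omit [Fintype J] in
lemma exists_norm_le {f : UnitAddTorus J → ℂ} (hf : Continuous f) : ∃ C, ∀ x, ‖f x‖ ≤ C := by
  obtain ⟨C, hC⟩ := isCompact_univ.exists_bound_of_continuousOn hf.continuousOn
  exact ⟨C, fun x => hC x (Set.mem_univ x)⟩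

/-- The partial derivatives of a smooth function on the torus. -/
lemma IsSmoothTorus.exists_deriv [DecidableEq J] {f : UnitAddTorus J → ℂ} (hf : IsSmoothTorus f)
    (j : J) : ∃ f', IsSmoothTorus f' ∧ ∀ x (t : ℝ),
      HasDerivAt (fun t : ℝ => f (x + dirShift j t))
        (f' (x + dirShift j t)) t := by
  set e : J → ℝ := Pi.single j 1
  set F : (J → ℝ) → ℂ := f ∘ torusProj with hF
  have hline : ∀ z (t : ℝ), f (torusProj z + dirShift j t) = F (z + t • e) := by
    intro z t
    refine congrArg f (funext fun i => ?_)
    by_cases h : i = j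
    · subst h; simp [torusProj, e]
    · simp [torusProj, e, h]
  have hd : ∀ z (t : ℝ), HasDerivAt (fun t : ℝ => F (z + t • e)) (fderiv ℝ F (z + t • e) e) t := by
    intro z t
    have h1 := (hf.differentiable (by simp)).differentiableAt (x := z + t • e) |>.hasFDerivAt
    have h2 : HasDerivAt (fun t : ℝ => z + t • e) e t := by
      simpa using ((hasDerivAt_id t).smul_const e).const_add z
    exact h1.comp_hasDerivAt t h2
  set f' : UnitAddTorus J → ℂ := fun x =>
    deriv (fun t : ℝ => f (x + dirShift j t)) 0
  have hf' : ∀ z, f' (torusProj z) = fderiv ℝ F z e := by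
    intro z
    have h := (hd z 0).deriv
    simp only [zero_smul, add_zero] at h
    rw [← h]
    simp only [f', hline]
  refine ⟨f', ?_, fun x t => ?_⟩
  · have : f' ∘ torusProj = fun z => fderiv ℝ F z e := funext hf'
    rw [IsSmoothTorus, this]
    exact (hf.fderiv_right (m := ∞) (by simp)).clm_apply contDiff_const
  · obtain ⟨z, rfl⟩ := isOpenQuotientMap_torusProj.surjective x
    have h := hd z t
    have e1 : f' (torusProj z + dirShift j t) = fderiv ℝ F (z + t • e) e := by
      rw [← hf']
      refine congrArg f' (funext fun i => ?_)
      by_cases h : i = j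
      · subst h; simp [torusProj, e]
      · simp [torusProj, e, h]
    rw [e1]
    simpa only [hline] using h

/-- The Fourier coefficients of a partial derivative. -/
lemma mFourierCoeff_deriv [DecidableEq J] {f f' : UnitAddTorus J → ℂ} (hf : Continuous f)
    (hf' : Continuous f') (j : J) (h : ∀ x (t : ℝ),
      HasDerivAt (fun t : ℝ => f (x + dirShift j t))
        (f' (x + dirShift j t)) t) (k : J → ℤ) :
    mFourierCoeff f' k = 2 * π * Complex.I * k j * mFourierCoeff f k := by
  obtain ⟨C, hC⟩ := exists_norm_le hf'
  set I : ℝ → ℂ := fun t => ∫ x, mFourier (-k) x * f (x + dirShift j t)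
    ∂torusMeasure J with hI
  have h1 : HasDerivAt I
      (∫ x, mFourier (-k) x * f' (x + dirShift j 0) ∂torusMeasure J) 0 := by
    refine (hasDerivAt_integral_of_dominated_loc_of_deriv_le (bound := fun _ => C)
      (s := Set.univ) univ_mem (Eventually.of_forall fun t => ?_) ?_ ?_
      (Eventually.of_forall fun x t _ => ?_) (integrable_const C)
      (Eventually.of_forall fun x t _ => (h x t).const_mul _)).2
    · exact (by fun_prop : Continuous fun x => mFourier (-k) x *
        f (x + dirShift j t)).aestronglyMeasurable
    · exact (by fun_prop : Continuous fun x => mFourier (-k) x *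
        f (x + dirShift j 0)).integrable_of_hasCompactSupport
          (HasCompactSupport.of_compactSpace _)
    · exact (by fun_prop : Continuous fun x => mFourier (-k) x *
        f' (x + dirShift j 0)).aestronglyMeasurable
    · rw [norm_mul, norm_mFourier_apply, one_mul]; exact hC _
  have h2 : I = fun t : ℝ => fourier (k j) (t : UnitAddCircle) * mFourierCoeff f k := by
    funext t
    rw [mFourierCoeff_eq, ← integral_const_mul, hI]
    have := integral_add_right_eq_self (μ := torusMeasure J)
      (fun x => fourier (k j) (t : UnitAddCircle) * (mFourier (-k) x * f x))
      (dirShift j t)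
    rw [← this]
    refine integral_congr_ae (Eventually.of_forall fun x => ?_)
    simp only [mFourier_apply_add, mFourier_apply_single, Pi.neg_apply]
    have e : fourier (k j) (t : UnitAddCircle) * fourier (-k j) (t : UnitAddCircle) = 1 := by
      rw [← fourier_add, add_neg_cancel, fourier_zero]
    linear_combination (-(mFourier (-k) x * f (x + dirShift j t))) * e
  have h3 : HasDerivAt I (2 * π * Complex.I * k j * mFourierCoeff f k) 0 := by
    rw [h2]
    have := (hasDerivAt_fourier (1 : ℝ) (k j) 0).mul_const (mFourierCoeff f k)
    simpa using this
  have h4 := h1.unique h3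
  rw [← h4, mFourierCoeff_eq]
  have h0 : dirShift j 0 = 0 := by simp [dirShift]
  simp only [h0, add_zero]

lemma mFourierCoeff_pow_le [DecidableEq J] (j : J) (N : ℕ) {f : UnitAddTorus J → ℂ}
    (hf : IsSmoothTorus f) :
    ∃ C, 0 ≤ C ∧ ∀ k : J → ℤ, |(k j : ℝ)| ^ N * ‖mFourierCoeff f k‖ ≤ C := by
  induction N generalizing f with
  | zero =>
    obtain ⟨C, hC⟩ := exists_norm_le hf.continuous
    refine ⟨C, (norm_nonneg _).trans (hC 0), fun k => ?_⟩
    rw [pow_zero, one_mul, mFourierCoeff_eq]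
    refine (norm_integral_le_of_norm_le_const (C := C) (Eventually.of_forall fun x => ?_)).trans ?_
    · rw [norm_mul, norm_mFourier_apply, one_mul]; exact hC x
    · simp
  | succ N ih =>
    obtain ⟨f', hf', h⟩ := hf.exists_deriv j
    obtain ⟨C, hC0, hC⟩ := ih hf'
    refine ⟨C, hC0, fun k => le_trans ?_ (hC k)⟩
    rw [mFourierCoeff_deriv hf.continuous hf'.continuous j h, norm_mul, pow_succ, mul_assoc]
    refine mul_le_mul_of_nonneg_left (mul_le_mul_of_nonneg_right ?_ (norm_nonneg _)) (by positivity)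
    simp only [norm_mul, Complex.norm_I, mul_one, Complex.norm_intCast, Complex.norm_real,
      Complex.norm_ofNat, Real.norm_of_nonneg Real.pi_pos.le]
    nlinarith [Real.pi_gt_three, abs_nonneg (k j : ℝ)]

/-- The Fourier coefficients of a smooth function decay faster than any power, in all directions. -/
lemma mFourierCoeff_le_prod {f : UnitAddTorus J → ℂ} (hf : IsSmoothTorus f) :
    ∃ C, 0 ≤ C ∧ ∀ k : J → ℤ, ‖mFourierCoeff f k‖ ≤ C * ∏ j, br (k j) ^ (-2 : ℝ) := by
  classical
  set N := 2 * Fintype.card J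
  have h1 : ∀ j : J, ∃ C, 0 ≤ C ∧ ∀ k : J → ℤ, br (k j) ^ N * ‖mFourierCoeff f k‖ ≤ C := by
    intro j
    obtain ⟨C, hC, h⟩ := mFourierCoeff_pow_le j N hf
    obtain ⟨C', hC', h'⟩ := mFourierCoeff_pow_le j 0 hf
    refine ⟨2 ^ (N - 1) * (C' + C), by positivity, fun k => ?_⟩
    have h2 := add_pow_le zero_le_one (abs_nonneg (k j : ℝ)) N
    have h3 := h k
    have h4 := h' k
    rw [one_pow] at h2
    rw [pow_zero, one_mul] at h4
    calc br (k j) ^ N * ‖mFourierCoeff f k‖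
        ≤ 2 ^ (N - 1) * (1 + |(k j : ℝ)| ^ N) * ‖mFourierCoeff f k‖ :=
          mul_le_mul_of_nonneg_right h2 (norm_nonneg _)
      _ = 2 ^ (N - 1) * (‖mFourierCoeff f k‖ + |(k j : ℝ)| ^ N * ‖mFourierCoeff f k‖) := by ring
      _ ≤ _ := by gcongr
  choose C hC h using h1
  obtain ⟨C₀, hC₀⟩ := exists_norm_le hf.continuous
  have hC₀n : 0 ≤ C₀ := (norm_nonneg _).trans (hC₀ 0)
  refine ⟨C₀ + ∑ j, C j, add_nonneg hC₀n (Finset.sum_nonneg fun j _ => hC j), fun k => ?_⟩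
  have hp : ∏ j, br (k j) ^ (-2 : ℝ) = (∏ j, br (k j) ^ 2)⁻¹ := by
    rw [← Finset.prod_inv_distrib]
    refine Finset.prod_congr rfl fun j _ => ?_
    rw [Real.rpow_neg (br_pos _).le, show (2 : ℝ) = (2 : ℕ) by norm_num, Real.rpow_natCast]
  have hpos : 0 < ∏ j, br (k j) ^ 2 := Finset.prod_pos fun j _ => pow_pos (br_pos _) 2
  rw [hp, ← div_eq_mul_inv, le_div_iff₀ hpos]
  rcases isEmpty_or_nonempty J with hJ | hJ
  · simp only [Finset.univ_eq_empty, Finset.prod_empty, mul_one, Finset.sum_empty, add_zero]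
    rw [mFourierCoeff_eq]
    refine (norm_integral_le_of_norm_le_const (C := C₀) (Eventually.of_forall fun x => ?_)).trans ?_
    · rw [norm_mul, norm_mFourier_apply, one_mul]; exact hC₀ x
    · simp
  · obtain ⟨j, -, hj⟩ := Finset.exists_max_image Finset.univ (fun j => br (k j))
      Finset.univ_nonempty
    have h2 : ∏ i, br (k i) ^ 2 ≤ br (k j) ^ N := by
      refine (Finset.prod_le_prod (fun i _ => (pow_pos (br_pos _) 2).le) fun i hi =>
        pow_le_pow_left₀ (br_pos _).le (hj i hi) 2).trans_eq ?_
      rw [Finset.prod_const, ← pow_mul]; rfl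
    calc ‖mFourierCoeff f k‖ * ∏ i, br (k i) ^ 2 ≤ br (k j) ^ N * ‖mFourierCoeff f k‖ := by
          rw [mul_comm]; gcongr
      _ ≤ C j := h j k
      _ ≤ ∑ j, C j := Finset.single_le_sum (fun j _ => hC j) (Finset.mem_univ j)
      _ ≤ _ := le_add_of_nonneg_left hC₀n

end Torus

/-! ### External legs -/

section Legs

variable {n : ℕ} {b : Fin n → Bubble} {G : FeynmanGraph b}

/-! The external faces are labelled by `e i c`, with `i` a leg and `c` a colour. This can be done
with the white legs as well as with the black legs. -/

section Reindex

variable {ι : Type*} [Fintype ι] {e : ι → Fin 4 → Face G}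
  (he : ∀ i c i' c', e i c = e i' c' → i = i' ∧ c = c')
  (hr : ∀ f, f ∈ externalFaces G ↔ ∃ i c, e i c = f)

include he hr

lemma prod_externalFaces {R : Type*} [CommMonoid R] (φ : Face G → R) :
    ∏ f ∈ externalFaces G, φ f = ∏ i, ∏ c, φ (e i c) := by
  rw [← Fintype.prod_prod_type' fun i c => φ (e i c)]
  symm
  refine Finset.prod_bij (fun x _ => e x.1 x.2) (fun x _ => (hr _).2 ⟨_, _, rfl⟩) ?_ ?_
    fun _ _ => rfl
  · intro x _ x' _ h
    exact Prod.ext (he _ _ _ _ h).1 (he _ _ _ _ h).2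
  · intro f hf
    obtain ⟨i, c, h⟩ := (hr f).1 hf
    exact ⟨(i, c), Finset.mem_univ _, h⟩

omit [Fintype ι] in
lemma partialSum_externalFaces (h : (ι → Fin 4 → ℤ) → ENNReal) :
    partialSum (externalFaces G) (fun q => h fun i c => q (e i c)) 0 = ∑' P, h P := by
  have hmem : ∀ i c, e i c ∈ externalFaces G := fun i c => (hr _).2 ⟨i, c, rfl⟩
  let E : ι × Fin 4 ≃ externalFaces G := Equiv.ofBijective (fun x => ⟨e x.1 x.2, hmem _ _⟩) <| by
    refine ⟨fun x x' hx => ?_, fun f => ?_⟩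
    · have := he _ _ _ _ (Subtype.ext_iff.1 hx)
      exact Prod.ext this.1 this.2
    · obtain ⟨i, c, hf⟩ := (hr f.1).1 f.2
      exact ⟨(i, c), Subtype.ext hf⟩
  rw [partialSum,
    ← ((Equiv.arrowCongr E.symm (Equiv.refl ℤ)).trans (Equiv.curry ι (Fin 4) ℤ)).tsum_eq]
  refine tsum_congr fun u => congrArg h (funext fun i => funext fun c => ?_)
  rw [Function.updateFinset, dif_pos (hmem i c)]
  rfl

/-- A bound by a product over the legs reduces external summability to the summability over the
four momenta of one leg. -/
lemma externallySummable_of_prod {f : (Fin 4 → ℤ) → ℝ} (hf0 : ∀ P, 0 ≤ f P)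
    (hf : Summable fun P => f P * ∏ c, br (P c) ^ (1 / 8 : ℝ)) {K : ℝ}
    {g : LegMom G → ℝ} (hg : ∀ q, g (legMom q) ≤ K * ∏ i, f fun c => q (e i c)) :
    ExternallySummable G g := by
  set h : (ι → Fin 4 → ℤ) → ℝ := fun P => ∏ i, (f (P i) * ∏ c, br (P i c) ^ (1 / 8 : ℝ)) with hh
  have hf1 : ∀ P, 0 ≤ f P * ∏ c, br (P c) ^ (1 / 8 : ℝ) := fun P =>
    mul_nonneg (hf0 P) (Finset.prod_nonneg fun _ _ => br_rpow_nonneg _ _)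
  have hs : Summable h := (hasSum_pi (ι := ι)
    (fun _ P => f P * ∏ c, br (P c) ^ (1 / 8 : ℝ)) fun _ => hf.norm).2.summable
  have hle : partialSum (externalFaces G) (fun q => ENNReal.ofReal (g (legMom q)) *
      ∏ f ∈ externalFaces G, brPow (1 / 8) (q f)) 0 ≤
      partialSum (externalFaces G) (fun q => ENNReal.ofReal (K * h fun i c => q (e i c))) 0 := by
    refine partialSum_mono _ fun q _ => ?_
    rw [prod_externalFaces he hr]
    have e1 : ∏ i, ∏ c, brPow (1 / 8) (q (e i c)) =
        ENNReal.ofReal (∏ i, ∏ c, br (q (e i c)) ^ (1 / 8 : ℝ)) := by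
      rw [ENNReal.ofReal_prod_of_nonneg fun _ _ =>
        Finset.prod_nonneg fun _ _ => br_rpow_nonneg _ _]
      exact Finset.prod_congr rfl fun i _ =>
        (ENNReal.ofReal_prod_of_nonneg fun _ _ => br_rpow_nonneg _ _).symm
    have hnn : 0 ≤ ∏ i, ∏ c, br (q (e i c)) ^ (1 / 8 : ℝ) :=
      Finset.prod_nonneg fun _ _ => Finset.prod_nonneg fun _ _ => br_rpow_nonneg _ _
    rw [e1, ← ENNReal.ofReal_mul' hnn]
    refine ENNReal.ofReal_le_ofReal ((mul_le_mul_of_nonneg_right (hg q) hnn).trans_eq ?_)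
    simp only [hh]
    rw [Finset.prod_mul_distrib, mul_assoc]
  refine ne_top_of_le_ne_top ?_ hle
  rw [partialSum_externalFaces he hr fun P => ENNReal.ofReal (K * h P)]
  exact (hs.mul_left K).tsum_ofReal_ne_top

end Reindex

lemma whiteLeg_face_inj (i : WhiteLeg G) (c : Fin 4) (i' : WhiteLeg G) (c' : Fin 4)
    (h : face G i.1 c = face G i'.1 c') : i = i' ∧ c = c' := WhiteLeg.face_injective h

lemma blackLeg_face_inj (i : BlackLeg G) (c : Fin 4) (i' : BlackLeg G) (c' : Fin 4)
    (h : face G ((col b c).symm i.1) c = face G ((col b c').symm i'.1) c') : i = i' ∧ c = c' :=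
  BlackLeg.face_injective h

lemma mem_externalFaces_iff_blackLeg (f : Face G) :
    f ∈ externalFaces G ↔ ∃ (u : BlackLeg G) (c : Fin 4), face G ((col b c).symm u.1) c = f := by
  rw [mem_externalFaces]
  constructor
  · rintro ⟨w, c, rfl⟩
    obtain ⟨u, hu⟩ := w.exists_blackLeg c
    exact ⟨u, c, hu⟩
  · rintro ⟨u, c, rfl⟩
    obtain ⟨w, hw⟩ := u.exists_whiteLeg c
    exact ⟨w, c, hw⟩

lemma ExternallySummable.of_le_add {g g₁ g₂ : LegMom G → ℝ} (h₁ : ExternallySummable G g₁)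
    (h₂ : ExternallySummable G g₂) (h : ∀ k, g k ≤ g₁ k + g₂ k) : ExternallySummable G g := by
  refine ne_top_of_le_ne_top (ENNReal.add_ne_top.2 ⟨h₁, h₂⟩) ?_
  rw [partialSum, partialSum, partialSum, ← ENNReal.tsum_add]
  refine ENNReal.tsum_le_tsum fun u => ?_
  rw [← add_mul]
  exact mul_le_mul_left ((ENNReal.ofReal_le_ofReal (h _)).trans ENNReal.ofReal_add_le) _

/-- The decay of a propagator on an external leg. -/
def legDecay (P : Fin 4 → ℤ) : ℝ := if ∑ c, P c = 0 then (∑ c, br (P c)) ^ (-2 : ℝ) else 0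

lemma legDecay_nonneg (P : Fin 4 → ℤ) : 0 ≤ legDecay P := by
  unfold legDecay
  split_ifs
  · exact Real.rpow_nonneg (Finset.sum_nonneg fun _ _ => (br_pos _).le) _
  · exact le_rfl

/-- The square of a propagator is summable over the momenta of a leg, even with a small power as
weight. -/
lemma summable_legDecay_sq :
    Summable fun P : Fin 4 → ℤ => legDecay P ^ 2 * ∏ c, br (P c) ^ (1 / 8 : ℝ) := by
  set e : (Fin 3 → ℤ) → Fin 4 → ℤ := fun u => Fin.cons (-∑ j, u j) u with he
  have hinj : Function.Injective e := fun u u' h => by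
    funext j
    have := congrFun h j.succ
    simpa [he] using this
  rw [← hinj.summable_iff]
  · have hs := (hasSum_pi (ι := Fin 3) (fun _ (q : ℤ) => br q ^ (-(7 / 6) : ℝ))
      fun _ => (summable_br (by norm_num)).norm).2.summable
    refine Summable.of_nonneg_of_le (fun u => mul_nonneg (sq_nonneg _)
      (Finset.prod_nonneg fun _ _ => br_rpow_nonneg _ _)) (fun u => ?_) hs
    have h0 : ∑ c, e u c = 0 := by simp [he, Fin.sum_univ_succ]
    simp only [Function.comp_apply, legDecay, if_pos h0]
    set X := ∑ c, br (e u c) with hX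
    have hb : ∀ c, br (e u c) ≤ X := fun c =>
      Finset.single_le_sum (f := fun c => br (e u c)) (fun _ _ => (br_pos _).le) (Finset.mem_univ c)
    have hX0 : 0 < X := (br_pos _).trans_le (hb 0)
    have h1 : ∏ c, br (e u c) ^ (1 / 8 : ℝ) ≤ X ^ (1 / 2 : ℝ) := by
      refine (Finset.prod_le_prod (fun _ _ => br_rpow_nonneg _ _) fun c _ =>
        Real.rpow_le_rpow (br_pos _).le (hb c) (by norm_num)).trans_eq ?_
      rw [Finset.prod_const, ← Real.rpow_natCast, ← Real.rpow_mul hX0.le]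
      norm_num
    have h2 : X ^ (-(7 / 2) : ℝ) ≤ ∏ j, br (u j) ^ (-(7 / 6) : ℝ) := by
      have h3 : ∏ _j : Fin 3, X ^ (-(7 / 6) : ℝ) ≤ ∏ j, br (u j) ^ (-(7 / 6) : ℝ) := by
        refine Finset.prod_le_prod (fun _ _ => Real.rpow_nonneg hX0.le _) fun j _ =>
          rpow_le_rpow_of_neg (br_pos _) ?_ (by norm_num)
        have := hb j.succ
        simpa [he] using this
      refine le_trans (le_of_eq ?_) h3
      rw [Finset.prod_const, ← Real.rpow_natCast, ← Real.rpow_mul hX0.le]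
      norm_num
    calc (X ^ (-2 : ℝ)) ^ 2 * ∏ c, br (e u c) ^ (1 / 8 : ℝ)
        ≤ (X ^ (-2 : ℝ)) ^ 2 * X ^ (1 / 2 : ℝ) := by gcongr
      _ = X ^ (-(7 / 2) : ℝ) := by
          rw [← Real.rpow_natCast, ← Real.rpow_mul hX0.le, ← Real.rpow_add hX0]; norm_num
      _ ≤ _ := h2
  · intro P hP
    have : legDecay P = 0 := by
      refine if_neg fun h => hP ⟨fun j => P j.succ, ?_⟩
      rw [Fin.sum_univ_succ] at h
      funext c
      refine Fin.cases ?_ (fun j => ?_) c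
      · simp only [he, Fin.cons_zero]; linarith
      · simp [he]
    rw [this]; simp

variable (hG : G.Connected) (hv : G.NonVacuum)

include hG hv

/-- With propagators on the external legs, the renormalized amplitude converges uniformly in the
external points: the two propagators at the ends of each external face provide the summability over
its momentum. -/
theorem tendstoUniformly_renormalizedAmplitude {m : ℝ} (hm : 0 < m) {a : ℕ → ℝ}
    (ha : ∀ ρ, 0 < a ρ) (ha' : Tendsto a atTop (𝓝 0)) :
    ∃ A : (BlackLeg G → Fin 4 → U1) × (WhiteLeg G → Fin 4 → U1) → ℂ,
      TendstoUniformly (fun ρ z => renormalizedAmplitude m (a ρ) G z.1 z.2) A atTop := by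
  obtain ⟨K, hK, hKP⟩ := propCoeff_le_size hm
  have hle : ∀ ρ P, propCoeff m (a ρ) P ≤ K * legDecay P := fun ρ P => by
    refine (hKP (a ρ) (ha ρ).le P).trans_eq ?_
    rw [legDecay]; split_ifs <;> simp
  set γ : ℕ → LegMom G → ℂ := fun ρ k =>
    (∏ w, (propCoeff m (a ρ) (k.1 w) : ℂ)) * ∏ u, (propCoeff m (a ρ) (k.2 u) : ℂ) with hγ
  set χ : (BlackLeg G → Fin 4 → U1) × (WhiteLeg G → Fin 4 → U1) → LegMom G → ℂ := fun z k =>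
    chr ((∑ u, ∑ c, k.2 u c • z.1 u c) - ∑ w, ∑ c, k.1 w c • z.2 w c) with hχ
  set K₁ : ℝ := ∏ _w : WhiteLeg G, K
  set K₂ : ℝ := ∏ _u : BlackLeg G, K
  have hK₁ : 0 ≤ K₁ := Finset.prod_nonneg fun _ _ => hK
  have hK₂ : 0 ≤ K₂ := Finset.prod_nonneg fun _ _ => hK
  set g₁ : LegMom G → ℝ := fun k => K₁ * K₂ * ∏ w, legDecay (k.1 w) ^ 2
  set g₂ : LegMom G → ℝ := fun k => K₁ * K₂ * ∏ u, legDecay (k.2 u) ^ 2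
  have hg₁ : ExternallySummable G g₁ := externallySummable_of_prod (f := fun P => legDecay P ^ 2)
    whiteLeg_face_inj (fun f => mem_externalFaces) (fun _ => sq_nonneg _) summable_legDecay_sq
    fun q => le_rfl
  have hg₂ : ExternallySummable G g₂ := externallySummable_of_prod (f := fun P => legDecay P ^ 2)
    blackLeg_face_inj mem_externalFaces_iff_blackLeg (fun _ => sq_nonneg _) summable_legDecay_sq
    fun q => le_rfl
  refine tendstoUniformly_smearedRenormalizedAmplitude hG hv hm ha ha' (γ := γ) (χ := χ)
    (g := fun k => g₁ k + g₂ k) (fun _ _ => (norm_chr _).le) (fun ρ k => ?_)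
    (hg₁.of_le_add hg₂ fun _ => le_rfl) (fun k => ?_) (fun ρ => ?_) fun ρ z gw gb => ?_
  · rw [hγ, norm_mul, norm_prod, norm_prod]
    simp only [Complex.norm_real, Real.norm_of_nonneg (propCoeff_nonneg _ _ _)]
    set x := ∏ w, legDecay (k.1 w) with hx
    set y := ∏ u, legDecay (k.2 u) with hy
    have hx0 : 0 ≤ x := Finset.prod_nonneg fun _ _ => legDecay_nonneg _
    have hy0 : 0 ≤ y := Finset.prod_nonneg fun _ _ => legDecay_nonneg _
    have h1 : ∏ w, propCoeff m (a ρ) (k.1 w) ≤ K₁ * x := by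
      rw [hx, ← Finset.prod_mul_distrib]
      exact Finset.prod_le_prod (fun _ _ => propCoeff_nonneg _ _ _) fun w _ => hle ρ _
    have h2 : ∏ u, propCoeff m (a ρ) (k.2 u) ≤ K₂ * y := by
      rw [hy, ← Finset.prod_mul_distrib]
      exact Finset.prod_le_prod (fun _ _ => propCoeff_nonneg _ _ _) fun w _ => hle ρ _
    refine (mul_le_mul h1 h2 (Finset.prod_nonneg fun _ _ => propCoeff_nonneg _ _ _)
      (mul_nonneg hK₁ hx0)).trans ?_
    have e1 : g₁ k = K₁ * K₂ * x ^ 2 := by simp only [g₁, hx, Finset.prod_pow]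
    have e2 : g₂ k = K₁ * K₂ * y ^ 2 := by simp only [g₂, hy, Finset.prod_pow]
    rw [e1, e2, ← mul_add, mul_mul_mul_comm]
    exact mul_le_mul_of_nonneg_left (by nlinarith [sq_nonneg (x - y)]) (mul_nonneg hK₁ hK₂)
  · choose z hz using tendsto_propCoeff m ha'
    exact ⟨_, (tendsto_finsetProd _ fun w _ => (Complex.continuous_ofReal.tendsto _).comp
      (hz (k.1 w))).mul (tendsto_finsetProd _ fun u _ =>
        (Complex.continuous_ofReal.tendsto _).comp (hz (k.2 u)))⟩
  · have h1 := (hasSum_prod_propagator (ι := WhiteLeg G) hm (ha ρ) (fun _ _ => 0) fun _ _ => 0).1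
    have h2 := (hasSum_prod_propagator (ι := BlackLeg G) hm (ha ρ) (fun _ _ => 0) fun _ _ => 0).1
    simp only [norm_mul, norm_chr, mul_one] at h1 h2
    exact Summable.mul_norm (f := fun P : WhiteLeg G → Fin 4 → ℤ =>
      ∏ w, (propCoeff m (a ρ) (P w) : ℂ)) (g := fun P : BlackLeg G → Fin 4 → ℤ =>
      ∏ u, (propCoeff m (a ρ) (P u) : ℂ)) h1 h2
  · have h1 := hasSum_prod_propagator (ι := WhiteLeg G) hm (ha ρ) gw z.2
    have h2 := hasSum_prod_propagator (ι := BlackLeg G) hm (ha ρ) z.1 gb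
    have h := hasSum_mul_of_summable_norm h1.2 h2.2 h1.1 h2.1
    have e1 : legPropagators m (a ρ) G z.1 z.2 gw gb =
        (∏ w, (propagator m (a ρ) (gw w) (z.2 w) : ℂ)) *
          ∏ u, (propagator m (a ρ) (z.1 u) (gb u) : ℂ) := by
      simp only [legPropagators]; push_cast; rfl
    rw [e1]
    refine h.congr_fun fun k => ?_
    have e2 : (∑ u, ∑ c, k.2 u c • z.1 u c) - (∑ w, ∑ c, k.1 w c • z.2 w c) + legPhase k gw gb =
        (∑ w, ∑ c, k.1 w c • (gw w c - z.2 w c)) + ∑ u, ∑ c, k.2 u c • (z.1 u c - gb u c) := by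
      simp only [legPhase, smul_sub, Finset.sum_sub_distrib]; abel
    simp only [hγ, hχ]
    rw [mul_assoc, ← chr_add, e2, chr_add]
    ring

end Legs

/-! ### Smooth test functions -/

section Smooth

open UnitAddTorus

variable {n : ℕ} {b : Fin n → Bubble} {G : FeynmanGraph b}

variable (G) in
/-- The arguments of a function of the variables of the external legs. -/
abbrev LegArg : Type := (WhiteLeg G ⊕ BlackLeg G) × Fin 4

/-- The rescaling of angles, from period `1` to period `2π`. -/
abbrev angle : UnitAddCircle ≃ₜ U1 :=
  AddCircle.homeomorphAddCircle 1 (2 * π) one_ne_zero Real.two_pi_pos.ne'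

lemma angle_coe (t : ℝ) : angle (t : UnitAddCircle) = ((2 * π * t : ℝ) : U1) := by
  rw [angle, AddCircle.homeomorphAddCircle_apply_mk]
  congr 1; ring

lemma fourier_eq_chr_angle (p : ℤ) (t : UnitAddCircle) : fourier p t = chr (p • angle t) := by
  rw [← fourier_eq_chr]
  induction t using QuotientAddGroup.induction_on with
  | H t =>
    rw [angle_coe, fourier_coe_apply, fourier_coe_apply]
    congr 1
    have : (π : ℂ) ≠ 0 := by exact_mod_cast Real.pi_ne_zero
    push_cast
    field_simp

/-- The momenta of the external legs as frequencies on the torus: the momenta at black nodes enter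
the phase with the opposite sign. -/
def legFreq : (LegArg G → ℤ) ≃ LegMom G where
  toFun i := (fun w c => i (Sum.inl w, c), fun u c => -i (Sum.inr u, c))
  invFun k := fun x => Sum.elim (fun w => k.1 w x.2) (fun u => -k.2 u x.2) x.1
  left_inv i := by
    funext ⟨x, c⟩
    cases x <;> simp
  right_inv k := by
    refine Prod.ext ?_ ?_ <;> funext w c <;> simp

variable (hG : G.Connected) (hv : G.NonVacuum)

include hG hv

/-- Integrated against a smooth function of the variables of the external legs, the amputated
renormalized amplitude converges: the Fourier coefficients of the function provide the summability
over the momenta of the external faces. -/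
theorem exists_tendsto_smearedRenormalizedAmplitude {m : ℝ} (hm : 0 < m) {a : ℕ → ℝ}
    (ha : ∀ ρ, 0 < a ρ) (ha' : Tendsto a atTop (𝓝 0)) {Φ : LegFunction G} (hΦ : IsSmooth G Φ) :
    ∃ A : ℂ, Tendsto (fun ρ => smearedRenormalizedAmplitude m (a ρ) G Φ) atTop (𝓝 A) := by
  set f : UnitAddTorus (LegArg G) → ℂ := fun x =>
    Φ (fun w c => angle (x (Sum.inl w, c))) (fun u c => angle (x (Sum.inr u, c))) with hf
  have hfs : IsSmoothTorus f := by
    have hlin : ContDiff ℝ ∞ fun (z : LegArg G → ℝ) (i : WhiteLeg G ⊕ BlackLeg G) (c : Fin 4) =>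
        2 * π * z (i, c) := by fun_prop
    have e : f ∘ torusProj = (fun z : WhiteLeg G ⊕ BlackLeg G → Fin 4 → ℝ =>
        Φ (fun w c => (z (Sum.inl w) c : U1)) (fun u c => (z (Sum.inr u) c : U1))) ∘
        fun z i c => 2 * π * z (i, c) := by
      funext z
      simp only [Function.comp_apply, hf, torusProj, angle_coe]
    rw [IsSmoothTorus, e]
    exact ContDiff.comp hΦ hlin
  obtain ⟨C, hC, hfC⟩ := mFourierCoeff_le_prod hfs
  set β : LegMom G → ℂ := fun k => mFourierCoeff f (legFreq.symm k) with hβ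
  have hβC : ∀ k : LegMom G, ‖β k‖ ≤ C * ((∏ w, ∏ c, br (k.1 w c) ^ (-2 : ℝ)) *
      ∏ u, ∏ c, br (k.2 u c) ^ (-2 : ℝ)) := fun k => by
    refine (hfC _).trans_eq ?_
    rw [Fintype.prod_prod_type, Fintype.prod_sum_type]
    simp [legFreq, br_neg]
  have hsq : Summable fun P : Fin 4 → ℤ => ∏ c, br (P c) ^ (-2 : ℝ) :=
    (hasSum_pi (ι := Fin 4) (fun _ (q : ℤ) => br q ^ (-2 : ℝ))
      fun _ => (summable_br (by norm_num)).norm).2.summable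
  have hsq' : Summable fun P : Fin 4 → ℤ => (∏ c, br (P c) ^ (-2 : ℝ)) *
      ∏ c, br (P c) ^ (1 / 8 : ℝ) := by
    refine (hasSum_pi (ι := Fin 4) (fun _ (q : ℤ) => br q ^ (-(15 / 8) : ℝ))
      fun _ => (summable_br (by norm_num)).norm).2.summable.congr fun P => ?_
    rw [← Finset.prod_mul_distrib]
    refine Finset.prod_congr rfl fun c _ => ?_
    rw [← Real.rpow_add (br_pos _)]; norm_num
  have hnn : ∀ P : Fin 4 → ℤ, 0 ≤ ∏ c, br (P c) ^ (-2 : ℝ) := fun P =>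
    Finset.prod_nonneg fun _ _ => br_rpow_nonneg _ _
  have hβs : Summable fun k => ‖β k‖ := by
    have h1 := (hasSum_pi (ι := WhiteLeg G) (fun _ (P : Fin 4 → ℤ) => ∏ c, br (P c) ^ (-2 : ℝ))
      fun _ => hsq.norm).2.summable
    have h2 := (hasSum_pi (ι := BlackLeg G) (fun _ (P : Fin 4 → ℤ) => ∏ c, br (P c) ^ (-2 : ℝ))
      fun _ => hsq.norm).2.summable
    exact Summable.of_nonneg_of_le (fun _ => norm_nonneg _) hβC
      ((h1.mul_of_nonneg h2 (fun _ => Finset.prod_nonneg fun _ _ => hnn _)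
        fun _ => Finset.prod_nonneg fun _ _ => hnn _).mul_left C)
  have hfsum : Summable (mFourierCoeff f) := by
    refine Summable.of_norm ?_
    refine (legFreq (G := G)).symm.summable_iff.1 ?_
    exact hβs
  obtain ⟨A, hA⟩ := tendstoUniformly_smearedRenormalizedAmplitude hG hv hm ha ha'
    (X := Unit) (γ := fun _ => β) (χ := fun _ _ => 1) (g := fun k => ‖β k‖) (Φ := fun _ _ => Φ)
    (fun _ _ => norm_one.le) (fun _ _ => le_rfl)
    (externallySummable_of_prod (f := fun P => ∏ c, br (P c) ^ (-2 : ℝ)) whiteLeg_face_inj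
      (fun f => mem_externalFaces) hnn hsq' (K := C) fun q => by
        refine (hβC _).trans (mul_le_mul_of_nonneg_left ?_ hC)
        refine mul_le_of_le_one_right (Finset.prod_nonneg fun _ _ => hnn _) ?_
        exact Finset.prod_le_one (fun _ _ => hnn _) fun _ _ =>
          Finset.prod_le_one (fun _ _ => br_rpow_nonneg _ _) fun _ _ =>
            br_rpow_le_one _ (by norm_num))
    (fun _ => ⟨_, tendsto_const_nhds⟩) (fun _ => hβs) fun _ _ gw gb => by
      set x : UnitAddTorus (LegArg G) := fun j =>
        angle.symm (Sum.elim (fun w => gw w j.2) (fun u => gb u j.2) j.1) with hx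
      have h := hasSum_mFourier_series_apply_of_summable
        (f := (⟨f, hfs.continuous⟩ : C(UnitAddTorus (LegArg G), ℂ))) hfsum x
      rw [← (legFreq (G := G)).symm.hasSum_iff] at h
      have e : f x = Φ gw gb := by simp [hf, hx]
      rw [ContinuousMap.coe_mk, e] at h
      refine h.congr_fun fun k => ?_
      have e2 : mFourier (legFreq.symm k) x = chr (legPhase k gw gb) := by
        simp only [mFourier, ContinuousMap.coe_mk, fourier_eq_chr_angle]
        rw [← chr_sum, Fintype.sum_prod_type, Fintype.sum_sum_type]
        simp [legFreq, hx, legPhase, sub_eq_add_neg]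
      simp only [Function.comp_apply, mul_one, smul_eq_mul, e2]
      rfl
  exact ⟨A (), hA.tendsto_at ()⟩

end Smooth

/-! ### Connected Schwinger functions -/

section Schwinger

variable {n : ℕ} {b : Fin n → Bubble}

/-- The graph obtained by keeping only the lines in a given set; the other lines are cut into
external legs. -/
def FeynmanGraph.restrict (G : FeynmanGraph b) (H : Finset (Line b)) : FeynmanGraph b where
  lines := G.lines ∩ H
  white_inj l hl l' hl' := G.white_inj l (Finset.mem_inter.1 hl).1 l' (Finset.mem_inter.1 hl').1
  black_inj l hl l' hl' := G.black_inj l (Finset.mem_inter.1 hl).1 l' (Finset.mem_inter.1 hl').1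

open Classical in
lemma FeynmanGraph.mem_meloforests_iff (G : FeynmanGraph b) (M : Finset (Finset (Line b))) :
    M ∈ G.meloforests ↔ G.IsMeloforest M := by
  simp only [FeynmanGraph.meloforests, Finset.mem_filter, Finset.mem_powerset,
    and_iff_right_iff_imp]
  exact fun h H hH => Finset.mem_powerset.2 (h.1 H hH).1

/-- Whether a set of sets of lines is a meloforest depends on the graph only through the presence of
its lines. -/
lemma FeynmanGraph.isMeloforest_iff_of_le {P G : FeynmanGraph b} (h : P.lines ⊆ G.lines)
    {M : Finset (Finset (Line b))} (hM : M.sup id = P.lines) :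
    P.IsMeloforest M ↔ G.IsMeloforest M := by
  have hP : ∀ H ∈ M, H ⊆ P.lines := fun H hH => hM ▸ Finset.le_sup (f := id) hH
  refine and_congr_left fun _ => forall₂_congr fun H hH => ?_
  exact and_congr_left fun _ => ⟨fun h' => h'.trans h, fun _ => hP H hH⟩

open Classical in
/-- The contractions inside the melordered interactions together with the Wick contractions of the
remaining fields are all the Wick contractions with a choice of a meloforest. -/
lemma sum_melordered (G : FeynmanGraph b) (g : Finset (Finset (Line b)) → ℂ) :
    ∑ P : FeynmanGraph b, ∑ M ∈ P.meloforests.filter fun M => M.sup id = P.lines,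
      (if P.lines ⊆ G.lines then g M else 0) = ∑ M ∈ G.meloforests, g M := by
  rw [← Finset.sum_fiberwise G.meloforests fun M => G.restrict (M.sup id)]
  refine Finset.sum_congr rfl fun P _ => ?_
  have hiff : ∀ M ∈ G.meloforests, (G.restrict (M.sup id) = P ↔ M.sup id = P.lines) := by
    intro M hM
    have hs : M.sup id ⊆ G.lines := Finset.sup_le fun H hH =>
      (((G.mem_meloforests_iff M).1 hM).1 H hH).1
    rw [FeynmanGraph.ext_iff]
    simp only [FeynmanGraph.restrict, Finset.inter_eq_right.2 hs]
  by_cases h : P.lines ⊆ G.lines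
  · simp only [if_pos h]
    refine Finset.sum_congr (Finset.ext fun M => ?_) fun _ _ => rfl
    simp only [Finset.mem_filter]
    constructor
    · rintro ⟨h1, h2⟩
      have hM := (G.mem_meloforests_iff M).2
        ((FeynmanGraph.isMeloforest_iff_of_le h h2).1 ((P.mem_meloforests_iff M).1 h1))
      exact ⟨hM, (hiff M hM).2 h2⟩
    · rintro ⟨h1, h2⟩
      have h3 := (hiff M h1).1 h2
      exact ⟨(P.mem_meloforests_iff M).2
        ((FeynmanGraph.isMeloforest_iff_of_le h h3).2 ((G.mem_meloforests_iff M).1 h1)), h3⟩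
  · simp only [if_neg h, Finset.sum_const_zero]
    refine (Finset.sum_eq_zero fun M hM => absurd ?_ h).symm
    obtain ⟨-, h2⟩ := Finset.mem_filter.1 hM
    rw [← h2]
    exact Finset.inter_subset_left

end Schwinger

open Classical in
/-- The Schwinger functions are finite sums of renormalized amplitudes. -/
lemma schwingerTerm_eq (m a : ℝ) (𝓑 : Finset Bubble) (t : 𝓑 → ℂ) (n N : ℕ)
    (x y : Fin N → Fin 4 → U1) :
    schwingerTerm m a 𝓑 t n N x y =
      (n.factorial : ℂ)⁻¹ * ∑ b : Fin n → 𝓑, (∏ v, -t (b v)) *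
        ∑ G : FeynmanGraph fun v => (b v : Bubble), if G.Connected then
          ∑ σ : BlackLeg G ≃ Fin N, ∑ σ' : WhiteLeg G ≃ Fin N,
            renormalizedAmplitude m a G (fun u => x (σ u)) (fun w => y (σ' w)) else 0 := by
  unfold schwingerTerm
  congr 1
  refine Finset.sum_congr rfl fun b _ => congrArg _ ?_
  trans ∑ P : FeynmanGraph fun v => (b v : Bubble),
      ∑ G : FeynmanGraph fun v => (b v : Bubble),
        ∑ M ∈ P.meloforests.filter fun M => M.sup id = P.lines,
          if P.lines ⊆ G.lines ∧ G.Connected then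
            ∑ σ : BlackLeg G ≃ Fin N, ∑ σ' : WhiteLeg G ≃ Fin N,
              (-1 : ℂ) ^ M.card * feynmanIntegral m a G (tauProd M)
                (legPropagators m a G (fun u => x (σ u)) (fun w => y (σ' w)))
          else 0
  · exact Finset.sum_congr rfl fun P _ => Finset.sum_comm
  rw [Finset.sum_comm]
  refine Finset.sum_congr rfl fun G _ => ?_
  by_cases hG : G.Connected
  · simp only [hG, and_true, if_true]
    rw [sum_melordered G fun M => ∑ σ : BlackLeg G ≃ Fin N, ∑ σ' : WhiteLeg G ≃ Fin N,
      (-1 : ℂ) ^ M.card * feynmanIntegral m a G (tauProd M)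
        (legPropagators m a G (fun u => x (σ u)) (fun w => y (σ' w)))]
    rw [Finset.sum_comm]
    refine Finset.sum_congr rfl fun σ _ => ?_
    rw [Finset.sum_comm]
    rfl
  · simp [hG]

section UniformLimits

variable {X ι : Type*}

lemma exists_tendstoUniformly_sum (s : Finset ι) {F : ι → ℕ → X → ℂ}
    (h : ∀ i ∈ s, ∃ A : X → ℂ, TendstoUniformly (F i) A atTop) :
    ∃ A : X → ℂ, TendstoUniformly (fun ρ x => ∑ i ∈ s, F i ρ x) A atTop := by
  classical
  induction s using Finset.induction_on with
  | empty =>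
    refine ⟨fun _ => 0, ?_⟩
    simp only [Finset.sum_empty]
    exact fun u hu => Eventually.of_forall fun _ _ => refl_mem_uniformity hu
  | insert i s hi ih =>
    obtain ⟨A, hA⟩ := ih fun j hj => h j (Finset.mem_insert_of_mem hj)
    obtain ⟨B, hB⟩ := h i (Finset.mem_insert_self i s)
    simp only [Finset.sum_insert hi]
    exact ⟨B + A, hB.add hA⟩

lemma exists_tendstoUniformly_const_mul (z : ℂ) {F : ℕ → X → ℂ}
    (h : ∃ A : X → ℂ, TendstoUniformly F A atTop) :
    ∃ A : X → ℂ, TendstoUniformly (fun ρ x => z * F ρ x) A atTop := by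
  obtain ⟨A, hA⟩ := h
  exact ⟨fun x => z * A x, (uniformContinuous_const_smul z).comp_tendstoUniformly hA⟩

end UniformLimits

/-- Each graph contributing to a Schwinger function has external legs, since `1 ≤ N`. -/
theorem tendstoUniformly_schwingerTerm {m : ℝ} (hm : 0 < m) {a : ℕ → ℝ} (ha : ∀ ρ, 0 < a ρ)
    (ha' : Tendsto a atTop (𝓝 0)) (𝓑 : Finset Bubble) (t : 𝓑 → ℂ) (n : ℕ) {N : ℕ} (hN : 1 ≤ N) :
    ∃ S : (Fin N → Fin 4 → U1) × (Fin N → Fin 4 → U1) → ℂ,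
      TendstoUniformly (fun ρ z => schwingerTerm m (a ρ) 𝓑 t n N z.1 z.2) S atTop := by
  classical
  simp only [schwingerTerm_eq]
  refine exists_tendstoUniformly_const_mul _ (exists_tendstoUniformly_sum _ fun b _ =>
    exists_tendstoUniformly_const_mul _ (exists_tendstoUniformly_sum _ fun G _ => ?_))
  split_ifs with hG
  · refine exists_tendstoUniformly_sum _ fun σ _ => exists_tendstoUniformly_sum _ fun σ' _ => ?_
    have hv : G.NonVacuum := Or.inr ⟨σ.symm ⟨0, hN⟩⟩
    obtain ⟨A, hA⟩ := tendstoUniformly_renormalizedAmplitude hG hv hm ha ha'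
    exact ⟨_, hA.comp fun z : (Fin N → Fin 4 → U1) × (Fin N → Fin 4 → U1) =>
      (fun u => z.1 (σ u), fun w => z.2 (σ' w))⟩
  · exact ⟨fun _ => 0, fun u hu => Eventually.of_forall fun _ _ => refl_mem_uniformity hu⟩

/-! ### The cutoff -/

lemma cutoff_pos {M : ℝ} (hM : 1 < M) (ρ : ℕ) : 0 < cutoff M ρ :=
  inv_pos.2 (pow_pos (zero_lt_one.trans hM) _)

lemma tendsto_cutoff {M : ℝ} (hM : 1 < M) : Tendsto (cutoff M) atTop (𝓝 0) := by
  refine tendsto_inv_atTop_zero.comp ?_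
  have h : Tendsto (fun ρ : ℕ => (M ^ 2) ^ ρ) atTop atTop :=
    tendsto_pow_atTop_atTop_of_one_lt (one_lt_pow₀ hM two_ne_zero)
  simpa only [pow_mul] using h

end TGFT

end

theorem mainTheorem1 (m : ℝ) (hm : 0 < m) (M : ℝ) (hM : 1 < M) (𝓑 : Finset TGFT.Bubble) :
    (∀ (n : ℕ) (b : Fin n → 𝓑) (G : TGFT.FeynmanGraph fun v => (b v : TGFT.Bubble)),
      G.Connected → G.NonVacuum →
        (∃ A : (TGFT.BlackLeg G → Fin 4 → TGFT.U1) × (TGFT.WhiteLeg G → Fin 4 → TGFT.U1) → ℂ,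
          TendstoUniformly
            (fun (ρ : ℕ) z => TGFT.renormalizedAmplitude m (TGFT.cutoff M ρ) G z.1 z.2)
            A atTop) ∧
        (∀ Φ : TGFT.LegFunction G, TGFT.IsSmooth G Φ →
          ∃ A : ℂ, Tendsto
            (fun ρ : ℕ => TGFT.smearedRenormalizedAmplitude m (TGFT.cutoff M ρ) G Φ)
            atTop (𝓝 A))) ∧
    (∀ (t : 𝓑 → ℂ) (n N : ℕ), 1 ≤ n → 1 ≤ N →
      ∃ S : (Fin N → Fin 4 → TGFT.U1) × (Fin N → Fin 4 → TGFT.U1) → ℂ,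
        TendstoUniformly
          (fun (ρ : ℕ) z => TGFT.schwingerTerm m (TGFT.cutoff M ρ) 𝓑 t n N z.1 z.2)
          S atTop) := by
  have ha := TGFT.cutoff_pos hM
  have ha' := TGFT.tendsto_cutoff hM
  refine ⟨fun n b G hG hv => ⟨?_, fun Φ hΦ => ?_⟩, fun t n N _ hN => ?_⟩
  · exact TGFT.tendstoUniformly_renormalizedAmplitude hG hv hm ha ha'
  · exact TGFT.exists_tendsto_smearedRenormalizedAmplitude hG hv hm ha ha' hΦ
  · exact TGFT.tendstoUniformly_schwingerTerm hm ha ha' 𝓑 t n hN
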